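/- Let $W(y|x)$ be a discrete memoryless channel with finite input alphabet $\mathcal X$ and finite output alphabet $\mathcal Y$, let $R>0$ (nats), and let $P_X$ be the empirical distribution of some vector over $\mathcal X$ (i.e. $P_X$ is rational). For vectors $\mathbf x,\mathbf y$ of length $n$ let $\hat Q_{\mathbf{xy}}$ be their joint empirical distribution. For a joint distribution $Q$ on $\mathcal X\times\mathcal Y$ put $f(Q)=\sum_{x,y}Q(x,y)\log W(y|x)\in[-\infty,0]$, and let $I(Q)$ be its mutual information. Let $h$ be a threshold function: it is finite and continuous on some compact set $\mathcal G$ of joint distributions and equals $+\infty$ at all joint distributions outside $\mathcal G$. For a codebook $\mathbf x_1,\dots,\mathbf x_M$, the list decoder $\phi_h$ puts $m$ on the list when $f(\hat Q_{\mathbf x_m\mathbf y})\ge\max_{l\ne m}h(\hat Q_{\mathbf x_l\mathbf y})$. Let $M=\lceil e^{nR}\rceil$ codewords be drawn independently and uniformly from the type class of $P_X$ (all vectors of length $n$ with empirical distribution $P_X$), and let $\overline{P_e}$ and $\overline{L}$ be the ensemble averages of the average probability that the transmitted codeword is not on the list, and of the average number of incorrect codewords on the list. Put $$E_e(R,h)=\liminf_{n\to\infty}-\tfrac1n\log\overline{P_e},\qquad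 E_l(R,h)=\liminf_{n\to\infty}-\tfrac1n\log\overline{L},$$ where $n$ runs over the lengths for which the type class is non-empty and $-\log0=+\infty$. Below, all joint distributions $Q,\tilde Q,Q'$ have $\mathcal X$-marginal $P_X$, and an infimum over the empty set is $+\infty$. Let $\mathbf V_h(q,R)=\sup\{h(Q'):Q'_Y=q,\ I(Q')\le R\}$ and $$F_e(h)=\inf_{\tilde Q}\ \inf_{Q:\,Q_Y=\tilde Q_Y,\ h(Q)\ge f(\tilde Q)}\{D(\tilde Q_{Y|X}\|W|P_X)+[I(Q)-R]_+\},$$ $$F_l(h)=\inf_{\tilde Q}\ \inf_{Q:\,Q_Y=\tilde Q_Y,\ f(Q)\ge\max\{\mathbf V_h(Q_Y,R),\,h(\tilde Q)\}}\{D(\tilde Q_{Y|X}\|W|P_X)+I(Q)-R\}.$$ Let $F_e^{>}(h)$ be $F_e(h)$ with the constraint $h(Q)>f(\tilde Q)$ in place of $h(Q)\ge f(\tilde Q)$. Let $F_l^{>}(h)$ be $F_l(h)$ with the constraint $f(Q)>\max\{\mathbf V_{\bar h}(Q_Y,R),\bar h(\tilde Q)\}$, where $\bar h(Q)=\limsup_{Q'\to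 Q}h(Q')$ (limit points $Q'=Q$ included) is the upper envelope of $h$ (so $\bar h=h$ if $h$ is finite everywhere). Then: 1. $E_e(R,h)\ge F_e(h)$ and $E_e(R,h)=F_e^{>}(h)$; in particular $E_e(R,h)=F_e(h)$ whenever $F_e^{>}(h)=F_e(h)$. 2. $F_l(h)\le E_l(R,h)\le F_l^{>}(h)$; in particular $E_l(R,h)=F_l(h)$ whenever $F_l^{>}(h)=F_l(h)$. 3. For all but countably many $t\in\mathbb R$, $E_e(R,h+t)=F_e(h+t)$; and if $h$ is finite everywhere, then for all but countably many $t\in\mathbb R$, $E_l(R,h+t)=F_l(h+t)$. -/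

import Mathlib

open Filter Topology

namespace ErasureList

noncomputable section

/-! ### Empirical distributions and single-letter quantities

Distributions on a finite alphabet are real vectors; a joint distribution on `X × Y`
is an element of `stdSimplex ℝ (X × Y)`. -/

/-- The empirical distribution of a vector. -/
def empDist {A : Type*} [DecidableEq A] {n : ℕ} (x : Fin n → A) : A → ℝ :=
  fun a => ((Finset.univ.filter fun i => x i = a).card : ℝ) / (n : ℝ)

/-- The joint empirical distribution of a pair of vectors. -/
def jointEmpDist {X Y : Type*} [DecidableEq X] [DecidableEq Y] {n : ℕ}
    (x : Fin n → X) (y : Fin n → Y) : X × Y → ℝ :=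
  empDist fun i => (x i, y i)

open Classical in
/-- The type class of `P`: all vectors of length `n` with empirical distribution `P`. -/
def typeClass {X : Type*} [Fintype X] [DecidableEq X] (P : X → ℝ) (n : ℕ) :
    Finset (Fin n → X) :=
  Finset.univ.filter fun x => empDist x = P

/-- The `X`-marginal of a joint distribution. -/
def margX {X Y : Type*} [Fintype Y] (Q : X × Y → ℝ) : X → ℝ := fun x => ∑ y, Q (x, y)

/-- The `Y`-marginal of a joint distribution. -/
def margY {X Y : Type*} [Fintype X] (Q : X × Y → ℝ) : Y → ℝ := fun y => ∑ x, Q (x, y)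

/-- The joint distributions of the form `P × Q_{Y|X}`. -/
def jointWith {X Y : Type*} [Fintype X] [Fintype Y] (P : X → ℝ) : Set (X × Y → ℝ) :=
  {Q | Q ∈ stdSimplex ℝ (X × Y) ∧ margX Q = P}

/-- Stochastic matrices, `W x y = W(y|x)`. -/
def IsChannel {X Y : Type*} [Fintype Y] (W : X → Y → ℝ) : Prop :=
  (∀ x y, 0 ≤ W x y) ∧ ∀ x, ∑ y, W x y = 1

/-- The mutual information (in nats). -/
def mutualInfo {X Y : Type*} [Fintype X] [Fintype Y] (Q : X × Y → ℝ) : ℝ :=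
  ∑ x, ∑ y, Q (x, y) * Real.log (Q (x, y) / (margX Q x * margY Q y))

open Classical in
/-- The conditional divergence `D(Q_{Y|X} ‖ W | Q_X)`; it is `+∞` if `Q` charges a pair
`(x, y)` with `W(y|x) = 0`. -/
def condDiv {X Y : Type*} [Fintype X] [Fintype Y] (W : X → Y → ℝ) (Q : X × Y → ℝ) : EReal :=
  if ∀ x y, W x y = 0 → Q (x, y) = 0 then
    ((∑ x, ∑ y, Q (x, y) * Real.log (Q (x, y) / margX Q x / W x y) : ℝ) : EReal)
  else ⊤

open Classical in
/-- The normalized log-likelihood `f(Q) = ∑ Q(x,y) log W(y|x)`, with `0 · log 0 = 0`; it is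
`-∞` if `Q` charges a pair `(x, y)` with `W(y|x) = 0`. -/
def logLik {X Y : Type*} [Fintype X] [Fintype Y] (W : X → Y → ℝ) (Q : X × Y → ℝ) : EReal :=
  if ∀ x y, W x y = 0 → Q (x, y) = 0 then
    ((∑ x, ∑ y, Q (x, y) * Real.log (W x y) : ℝ) : EReal)
  else ⊥

/-! ### Threshold decoders -/

/-- Threshold functions of the class `Ψ`: finite and continuous on a compact set `G` of joint
distributions, and `+∞` at all other joint distributions. -/
def IsThreshold {X Y : Type*} [Fintype X] [Fintype Y] (h : (X × Y → ℝ) → EReal) : Prop :=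
  ∃ G : Set (X × Y → ℝ), G ⊆ stdSimplex ℝ (X × Y) ∧ IsCompact G ∧ ContinuousOn h G ∧
    (∀ Q ∈ G, h Q ≠ ⊥ ∧ h Q ≠ ⊤) ∧ ∀ Q ∈ stdSimplex ℝ (X × Y), Q ∉ G → h Q = ⊤

/-- The decoding regions of the threshold decoder `φ_h` for the codebook `C`: codeword `m` is
on the list iff `f(Q̂_{x_m y}) ≥ max_{l ≠ m} h(Q̂_{x_l y})`. -/
def region {X Y : Type*} [Fintype X] [Fintype Y] [DecidableEq X] [DecidableEq Y]
    (W : X → Y → ℝ) (h : (X × Y → ℝ) → EReal) {M n : ℕ} (C : Fin M → Fin n → X) (m : Fin M) :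
    Set (Fin n → Y) :=
  {y | ⨆ (l : Fin M) (_ : l ≠ m), h (jointEmpDist (C l) y) ≤ logLik W (jointEmpDist (C m) y)}

/-- The transition probability `P(y|x)` of the memoryless channel. -/
def chanProb {X Y : Type*} (W : X → Y → ℝ) {n : ℕ} (x : Fin n → X) (y : Fin n → Y) : ℝ :=
  ∏ i, W (x i) (y i)

open Classical in
/-- The average error probability of a list decoder with decoding regions `D m`. -/
def errProb {X Y : Type*} [Fintype Y] (W : X → Y → ℝ) {M n : ℕ}
    (C : Fin M → Fin n → X) (D : Fin M → Set (Fin n → Y)) : ℝ :=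
  (1 / (M : ℝ)) * ∑ m, ∑ y : Fin n → Y, if y ∉ D m then chanProb W (C m) y else 0

open Classical in
/-- The average number of erroneous codewords on the list. -/
def listSize {X Y : Type*} [Fintype Y] (W : X → Y → ℝ) {M n : ℕ}
    (C : Fin M → Fin n → X) (D : Fin M → Set (Fin n → Y)) : ℝ :=
  ∑ y : Fin n → Y, (1 / (M : ℝ)) * ∑ m, chanProb W (C m) y *
    ((Finset.univ.filter fun l => l ≠ m ∧ y ∈ D l).card : ℝ)

/-! ### The fixed-composition random coding ensemble -/

/-- The average of `F` over codebooks with `M` codewords drawn independently and uniformly from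
the type class of `P`, i.e. over all `M`-tuples of vectors from the type class. -/
def ensembleAvg {X : Type*} [Fintype X] [DecidableEq X] (P : X → ℝ) (M n : ℕ)
    (F : (Fin M → Fin n → X) → ℝ) : ℝ :=
  (∑ C ∈ Fintype.piFinset (fun _ : Fin M => typeClass P n), F C) /
    ((Fintype.piFinset (fun _ : Fin M => typeClass P n)).card : ℝ)

/-- The number of codewords at rate `R`. -/
def numCodewords (R : ℝ) (n : ℕ) : ℕ := ⌈Real.exp (n * R)⌉₊

/-- `-(1/n) log a` for `a ≥ 0`, equal to `+∞` at `a = 0`. -/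
def negLogRate (n : ℕ) (a : ℝ) : EReal :=
  if a = 0 then ⊤ else ((-(1 / (n : ℝ)) * Real.log a : ℝ) : EReal)

/-- Block lengths going to infinity, along those for which the ensemble exists. -/
def blockLengths {X : Type*} [Fintype X] [DecidableEq X] (P : X → ℝ) : Filter ℕ :=
  atTop ⊓ 𝓟 {n | (typeClass P n).Nonempty}

/-- The random coding error exponent of `φ_h`. -/
def errExponent {X Y : Type*} [Fintype X] [Fintype Y] [DecidableEq X] [DecidableEq Y]
    (W : X → Y → ℝ) (P : X → ℝ) (R : ℝ) (h : (X × Y → ℝ) → EReal) : EReal :=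
  liminf (fun n : ℕ => negLogRate n (ensembleAvg P (numCodewords R n) n
    fun C => errProb W C (region W h C))) (blockLengths P)

/-- The random coding list size exponent of `φ_h`. -/
def listExponent {X Y : Type*} [Fintype X] [Fintype Y] [DecidableEq X] [DecidableEq Y]
    (W : X → Y → ℝ) (P : X → ℝ) (R : ℝ) (h : (X × Y → ℝ) → EReal) : EReal :=
  liminf (fun n : ℕ => negLogRate n (ensembleAvg P (numCodewords R n) n
    fun C => listSize W C (region W h C))) (blockLengths P)

/-! ### The single-letter expressions

Minima over infeasible sets are `+∞`. -/

/-- `min D(Q̃_{Y|X}‖W|P) + [I(Q) - R]₊` over `Q_Y = Q̃_Y`, `h(Q) ≥ f(Q̃)`. -/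
def errFormula {X Y : Type*} [Fintype X] [Fintype Y]
    (W : X → Y → ℝ) (P : X → ℝ) (R : ℝ) (h : (X × Y → ℝ) → EReal) : EReal :=
  ⨅ Qt ∈ (jointWith P : Set (X × Y → ℝ)),
    ⨅ Q ∈ {Q : X × Y → ℝ | Q ∈ jointWith P ∧ margY Q = margY Qt ∧ logLik W Qt ≤ h Q},
      condDiv W Qt + ((max (mutualInfo Q - R) 0 : ℝ) : EReal)

/-- The same with the strict constraint `h(Q) > f(Q̃)`. -/
def errFormulaStrict {X Y : Type*} [Fintype X] [Fintype Y]
    (W : X → Y → ℝ) (P : X → ℝ) (R : ℝ) (h : (X × Y → ℝ) → EReal) : EReal :=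
  ⨅ Qt ∈ (jointWith P : Set (X × Y → ℝ)),
    ⨅ Q ∈ {Q : X × Y → ℝ | Q ∈ jointWith P ∧ margY Q = margY Qt ∧ logLik W Qt < h Q},
      condDiv W Qt + ((max (mutualInfo Q - R) 0 : ℝ) : EReal)

/-- `V(q, R) = max h(Q')` over `Q'_Y = q`, `I(Q') ≤ R`. -/
def maxThreshold {X Y : Type*} [Fintype X] [Fintype Y]
    (P : X → ℝ) (R : ℝ) (h : (X × Y → ℝ) → EReal) (q : Y → ℝ) : EReal :=
  ⨆ Q' ∈ {Q' : X × Y → ℝ | Q' ∈ jointWith P ∧ margY Q' = q ∧ mutualInfo Q' ≤ R}, h Q'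

/-- `min D(Q̃_{Y|X}‖W|P) + I(Q) - R` over `Q_Y = Q̃_Y`, `f(Q) ≥ max {V(Q_Y, R), h(Q̃)}`. -/
def listFormula {X Y : Type*} [Fintype X] [Fintype Y]
    (W : X → Y → ℝ) (P : X → ℝ) (R : ℝ) (h : (X × Y → ℝ) → EReal) : EReal :=
  ⨅ Qt ∈ (jointWith P : Set (X × Y → ℝ)),
    ⨅ Q ∈ {Q : X × Y → ℝ | Q ∈ jointWith P ∧ margY Q = margY Qt ∧
        max (maxThreshold P R h (margY Q)) (h Qt) ≤ logLik W Q},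
      condDiv W Qt + ((mutualInfo Q - R : ℝ) : EReal)

/-- The upper envelope of the threshold function. It equals `h` wherever `h` is finite and
continuous in a neighbourhood, in particular everywhere if `h` is finite and continuous. -/
def upperEnvelope {X Y : Type*} [Fintype X] [Fintype Y]
    (P : X → ℝ) (h : (X × Y → ℝ) → EReal) (Q : X × Y → ℝ) : EReal :=
  limsup h (𝓝[jointWith P] Q)

/-- The list size expression with a strict constraint, for the upper envelope of `h`. -/
def listFormulaStrict {X Y : Type*} [Fintype X] [Fintype Y]
    (W : X → Y → ℝ) (P : X → ℝ) (R : ℝ) (h : (X × Y → ℝ) → EReal) : EReal :=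
  ⨅ Qt ∈ (jointWith P : Set (X × Y → ℝ)),
    ⨅ Q ∈ {Q : X × Y → ℝ | Q ∈ jointWith P ∧ margY Q = margY Qt ∧
        max (maxThreshold P R (upperEnvelope P h) (margY Q)) (upperEnvelope P h Qt)
          < logLik W Q},
      condDiv W Qt + ((mutualInfo Q - R : ℝ) : EReal)

end

end ErasureList

/-!
The proof is the method of types. Up to powers of `slack n = e (n + 1)` the type class of a
distribution `Q` has `exp (n H(Q))` elements (`card_typeClass_le`, `le_card_typeClass`). Since
functions of the joint type, summed over a type class of inputs, depend on the output only through
its type, this gives for a word drawn uniformly from the type class of `P` the probability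
`exp (-n I(Q))` of having joint type `Q` with a given output, and for the transmitted word and the
channel output the probability `exp (-n D(Q_{Y|X} ‖ W | P))` of having joint type `Q`. The upper
bounds are used in integrated form, as bounds on exponential moments of `I` and `D`
(`sum_exp_mutualInfo_le`, `sum_chanProb_mul_exp_le`).

By independence of the codewords, both ensemble averages are exact expressions in the probability
`p = beatProb` that one competing codeword has a threshold above the likelihood in question
(`ensembleAvg_errProb`, `ensembleAvg_listSize`). The error probability is a sum of terms
`1 - (1 - p) ^ (M - 1)`, which is `min 1 (M p)` up to constants and hence gives `[I - R]₊`; the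
strict constraint `h(Q) > f(Q̃)` in it is the negation of the decoding rule, so that the error
exponent is `errFormulaStrict`. The list size is a sum of terms `M (1 - p) ^ (M - 2)`. The power is
superexponentially small if some competing type of mutual information below `R` beats the listed
word, and tends to one if all competing types have mutual information above `R`. This is the
origin of `maxThreshold`.

Passing from types to arbitrary distributions takes two forms. Lower bounds on the averages are
only needed along a subsequence of block lengths, so a feasible pair may be replaced by a nearby
rational pair with the same linear constraints (`exists_rational_approx`); strict constraints
survive because `h` is lower semicontinuous, respectively because its upper envelope is used.
For the upper bound on the list size, types violating the claimed bound converge along an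
ultrafilter to a feasible pair. Feasibility of the limit requires competing types with exactly
the `Y`-marginals of the given sequence of types, which `exists_hasDenominator_tendsto` provides
after the competitor has been mixed with the product of its marginals (`exists_mutualInfo_lt`).

As a function of the offset `t`, the formulas with strict and with weak constraints interlace, so
they agree wherever the strict one is continuous, that is, off a countable set.
-/

namespace ErasureList

set_option linter.unusedSectionVars false

/-! ### Type classes and entropy -/

section Types

variable {A : Type*} [DecidableEq A]

lemma empDist_nonneg {n : ℕ} (z : Fin n → A) (a : A) : 0 ≤ empDist z a := by
  unfold empDist; positivity

lemma mul_empDist {n : ℕ} (hn : 0 < n) (z : Fin n → A) (a : A) :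
    n * empDist z a = ((Finset.univ.filter fun i => z i = a).card : ℝ) := by
  have : (n : ℝ) ≠ 0 := by positivity
  unfold empDist
  field_simp

/-- Vectors of the same type differ by a permutation of the positions. -/
lemma exists_perm_of_empDist_eq {n : ℕ} (hn : 0 < n) {z z' : Fin n → A}
    (h : empDist z = empDist z') : ∃ σ : Equiv.Perm (Fin n), z' = z ∘ σ := by
  have hc : ∀ a, Fintype.card {i // z' i = a} = Fintype.card {i // z i = a} := by
    intro a
    have h1 := mul_empDist hn z a
    rw [h, mul_empDist hn z' a] at h1
    rw [Fintype.card_subtype, Fintype.card_subtype]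
    exact_mod_cast h1
  refine ⟨(Equiv.sigmaFiberEquiv z').symm.trans
    ((Equiv.sigmaCongrRight fun a => Fintype.equivOfCardEq (hc a)).trans
      (Equiv.sigmaFiberEquiv z)), ?_⟩
  funext i
  simp only [Function.comp, Equiv.trans_apply, Equiv.sigmaFiberEquiv]
  exact ((Fintype.equivOfCardEq (hc (z' i))) ⟨i, rfl⟩).2.symm

lemma empDist_comp_perm {n : ℕ} (z : Fin n → A) (σ : Equiv.Perm (Fin n)) :
    empDist (z ∘ σ) = empDist z := by
  funext a
  unfold empDist
  congr 2
  exact Finset.card_bij (fun i _ => σ i) (by simp) (by simp)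
    (fun b hb => ⟨σ.symm b, by simpa using hb, by simp⟩)

variable [Fintype A]

lemma mem_typeClass {P : A → ℝ} {n : ℕ} {z : Fin n → A} :
    z ∈ typeClass P n ↔ empDist z = P := by
  simp [typeClass]

lemma sum_card_fiber {n : ℕ} (z : Fin n → A) :
    ∑ a, (Finset.univ.filter fun i => z i = a).card = n := by
  rw [← Finset.card_eq_sum_card_fiberwise (s := Finset.univ) (fun _ _ => Finset.mem_coe.2
    (Finset.mem_univ _))]
  simp

lemma sum_empDist {n : ℕ} (hn : 0 < n) (z : Fin n → A) : ∑ a, empDist z a = 1 := by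
  have h0 : (n : ℝ) ≠ 0 := by positivity
  unfold empDist
  rw [← Finset.sum_div, ← Nat.cast_sum, sum_card_fiber, div_self h0]

/-- The entropy of a distribution, in nats. -/
noncomputable def entropy (Q : A → ℝ) : ℝ := ∑ a, Real.negMulLog (Q a)

/-- The base of the polynomial factors in the estimates on type classes: the sizes of
type classes are determined by entropies up to powers of `slack n = e (n + 1)`. -/
noncomputable def slack (n : ℕ) : ℝ := Real.exp 1 * (n + 1)

lemma add_one_le_slack (n : ℕ) : (n : ℝ) + 1 ≤ slack n := by
  unfold slack
  have := Real.add_one_le_exp (1 : ℝ)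
  nlinarith [Nat.cast_nonneg (α := ℝ) n]

lemma one_le_slack (n : ℕ) : 1 ≤ slack n := by
  have := add_one_le_slack n
  have := Nat.cast_nonneg (α := ℝ) n
  linarith

lemma slack_pos (n : ℕ) : 0 < slack n := lt_of_lt_of_le one_pos (one_le_slack n)

/-- The type class of `z` is its orbit under permutations of the positions, hence its size is a
multinomial coefficient. -/
lemma card_typeClass_mul_prod_factorial {n : ℕ} (hn : 0 < n) (z : Fin n → A) :
    (typeClass (empDist z) n).card *
      ∏ a, (Finset.univ.filter fun i => z i = a).card.factorial = n.factorial := by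
  have hst := DomMulAct.stabilizer_card z
  simp only [Fintype.card_subtype] at hst
  rw [← hst]
  -- the fibres of `g ↦ z ∘ g` over the type class are cosets of the stabilizer
  have h1 : (Finset.univ : Finset (Equiv.Perm (Fin n))).card
      = ∑ w ∈ typeClass (empDist z) n,
        ((Finset.univ : Finset (Equiv.Perm (Fin n))).filter
          fun g : Equiv.Perm (Fin n) => z ∘ g = w).card := by
    apply Finset.card_eq_sum_card_fiberwise
    intro g _
    simp [mem_typeClass, empDist_comp_perm]
  rw [Finset.card_univ, Fintype.card_perm, Fintype.card_fin] at h1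
  rw [h1, ← smul_eq_mul, ← Finset.sum_const]
  refine Finset.sum_congr rfl fun w hw => ?_
  obtain ⟨σ, rfl⟩ := exists_perm_of_empDist_eq hn (mem_typeClass.1 hw).symm
  refine Finset.card_bij (fun (g : Equiv.Perm (Fin n)) _ => g * σ) ?_ ?_ ?_
  · intro g hg
    simp only [Finset.mem_filter, Finset.mem_univ, true_and] at hg ⊢
    rw [Equiv.Perm.coe_mul, ← Function.comp_assoc, hg]
  · intro a _ b _ hab
    exact mul_right_cancel hab
  · intro g hg
    refine ⟨g * σ⁻¹, ?_, by simp⟩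
    simp only [Finset.mem_filter, Finset.mem_univ, true_and] at hg ⊢
    rw [Equiv.Perm.coe_mul, ← Function.comp_assoc, hg]
    funext i
    simp

/-- A crude upper Stirling bound, `k! ≤ e (k + 1) (k / e) ^ k`. -/
lemma factorial_mul_exp_le (k : ℕ) :
    (k.factorial : ℝ) * Real.exp k ≤ Real.exp 1 * (k + 1) * (k : ℝ) ^ k := by
  have key : ∀ j : ℕ, ((j + 1).factorial : ℝ) * Real.exp ((j + 1 : ℕ) : ℝ)
      ≤ Real.exp 1 * ((j : ℝ) + 1) ^ (j + 2) := by
    intro j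
    induction j with
    | zero => simp
    | succ j ih =>
      have hstep : Real.exp 1 * ((j : ℝ) + 1) ^ (j + 2) ≤ ((j : ℝ) + 2) ^ (j + 2) := by
        have hp : (0 : ℝ) < (j : ℝ) + 1 := by positivity
        have hq : (0 : ℝ) < (j : ℝ) + 2 := by positivity
        -- `(1 - 1/(j+2)) ^ (j+2) ≤ e⁻¹`
        have h1 : ((j : ℝ) + 1) / (j + 2) ≤ Real.exp (-(1 / ((j : ℝ) + 2))) := by
          have := Real.add_one_le_exp (-(1 / ((j : ℝ) + 2)))
          have h2 : ((j : ℝ) + 1) / (j + 2) = -(1 / ((j : ℝ) + 2)) + 1 := by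
            field_simp; ring
          linarith
        have h3 : (((j : ℝ) + 1) / (j + 2)) ^ (j + 2) ≤ Real.exp (-1) := by
          calc (((j : ℝ) + 1) / (j + 2)) ^ (j + 2)
              ≤ (Real.exp (-(1 / ((j : ℝ) + 2)))) ^ (j + 2) := by gcongr
            _ = Real.exp (-1) := by
              rw [← Real.exp_nat_mul]; congr 1; push_cast; field_simp
        rw [div_pow, div_le_iff₀ (by positivity)] at h3
        calc Real.exp 1 * ((j : ℝ) + 1) ^ (j + 2)
            ≤ Real.exp 1 * (Real.exp (-1) * ((j : ℝ) + 2) ^ (j + 2)) := by gcongr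
          _ = _ := by rw [← mul_assoc, ← Real.exp_add]; simp
      have e1 : (((j + 1 + 1).factorial : ℕ) : ℝ) * Real.exp ((j + 1 + 1 : ℕ) : ℝ)
          = ((j : ℝ) + 2) * Real.exp 1 *
            (((j + 1).factorial : ℝ) * Real.exp ((j + 1 : ℕ) : ℝ)) := by
        rw [Nat.factorial_succ (j + 1)]
        push_cast
        rw [Real.exp_add ((j : ℝ) + 1) 1]
        ring
      rw [e1]
      calc ((j : ℝ) + 2) * Real.exp 1 * (((j + 1).factorial : ℝ) * Real.exp ((j + 1 : ℕ) : ℝ))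
          ≤ ((j : ℝ) + 2) * Real.exp 1 * (((j : ℝ) + 2) ^ (j + 2)) := by
            gcongr
            exact ih.trans hstep
        _ = Real.exp 1 * (((j + 1 : ℕ) : ℝ) + 1) ^ (j + 1 + 2) := by push_cast; ring
  cases k with
  | zero => simp
  | succ j =>
    refine (key j).trans ?_
    push_cast
    have : ((j : ℝ) + 1) ^ (j + 2) = ((j : ℝ) + 1) * ((j : ℝ) + 1) ^ (j + 1) := by ring
    rw [this, ← mul_assoc]
    gcongr
    linarith

lemma prod_card_fiber_pow {n : ℕ} (hn : 0 < n) (z : Fin n → A) :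
    ∏ a, (((Finset.univ.filter fun i => z i = a).card : ℝ) ^
      (Finset.univ.filter fun i => z i = a).card)
      = (n : ℝ) ^ n * Real.exp (-(n * entropy (empDist z))) := by
  have hn' : (0 : ℝ) < n := by positivity
  have h1 : ∀ a, (((Finset.univ.filter fun i => z i = a).card : ℝ) ^
      (Finset.univ.filter fun i => z i = a).card)
      = (n : ℝ) ^ (Finset.univ.filter fun i => z i = a).card
        * Real.exp (-(n * Real.negMulLog (empDist z a))) := by
    intro a
    have hm := mul_empDist hn z a
    set c := (Finset.univ.filter fun i => z i = a).card
    rcases Nat.eq_zero_or_pos c with hc | hc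
    · have : empDist z a = 0 := by
        rw [hc] at hm; simpa [hn'.ne'] using hm
      simp [hc, this]
    · have hc' : (0 : ℝ) < c := by positivity
      have hq : 0 < empDist z a := by
        rw [← hm] at hc'
        exact (pos_iff_pos_of_mul_pos hc').1 hn'
      have e : -(n * Real.negMulLog (empDist z a)) = c * Real.log (empDist z a) := by
        rw [← hm, Real.negMulLog]; ring
      rw [e, ← hm, mul_comm ((n : ℝ) * _) (Real.log _), hm, mul_comm (Real.log _),
        Real.exp_nat_mul, Real.exp_log hq, ← mul_pow, hm]
  rw [Finset.prod_congr rfl fun a _ => h1 a, Finset.prod_mul_distrib, Finset.prod_pow_eq_pow_sum,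
    sum_card_fiber, ← Real.exp_sum]
  simp [entropy, Finset.mul_sum]

lemma prod_empDist {n : ℕ} (hn : 0 < n) (z : Fin n → A) :
    ∏ a, (empDist z a ^ (Finset.univ.filter fun i => z i = a).card)
      = Real.exp (-(n * entropy (empDist z))) := by
  have h0 : (n : ℝ) ^ n ≠ 0 := by positivity
  apply mul_left_cancel₀ h0
  have h1 : ∏ a, ((n : ℝ) * empDist z a) ^ (Finset.univ.filter fun i => z i = a).card
      = (n : ℝ) ^ n * ∏ a, (empDist z a ^ (Finset.univ.filter fun i => z i = a).card) := by
    simp only [mul_pow, Finset.prod_mul_distrib, Finset.prod_pow_eq_pow_sum, sum_card_fiber]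
  rw [← prod_card_fiber_pow hn z, ← h1]
  simp only [mul_empDist hn]

lemma card_typeClass_le {n : ℕ} (hn : 0 < n) (z : Fin n → A) :
    ((typeClass (empDist z) n).card : ℝ) ≤ Real.exp (n * entropy (empDist z)) := by
  -- the type class has probability at most one under the product of its type
  have h1 : ∑ w ∈ typeClass (empDist z) n, ∏ i, empDist z (w i) ≤ 1 := by
    calc ∑ w ∈ typeClass (empDist z) n, ∏ i, empDist z (w i)
        ≤ ∑ w : Fin n → A, ∏ i, empDist z (w i) :=
          Finset.sum_le_sum_of_subset_of_nonneg (Finset.subset_univ _)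
            fun w _ _ => Finset.prod_nonneg fun i _ => empDist_nonneg z _
      _ = ∏ _i : Fin n, ∑ a, empDist z a := by
          rw [Finset.prod_univ_sum, Fintype.piFinset_univ]
      _ = 1 := by simp [sum_empDist hn]
  have h2 : ∀ w ∈ typeClass (empDist z) n, ∏ i, empDist z (w i)
      = Real.exp (-(n * entropy (empDist z))) := by
    intro w hw
    rw [mem_typeClass] at hw
    rw [← hw, ← prod_empDist hn w]
    rw [← Finset.prod_fiberwise_of_maps_to (s := Finset.univ) (t := Finset.univ) (g := w)
      (fun _ _ => Finset.mem_univ _)]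
    refine Finset.prod_congr rfl fun a _ => ?_
    rw [← Finset.prod_const]
    exact Finset.prod_congr rfl fun i hi => by rw [(Finset.mem_filter.1 hi).2]
  rw [Finset.sum_congr rfl h2, Finset.sum_const, nsmul_eq_mul, Real.exp_neg,
    ← div_eq_mul_inv, div_le_one (Real.exp_pos _)] at h1
  exact h1

lemma le_card_typeClass {n : ℕ} (hn : 0 < n) (z : Fin n → A) :
    Real.exp (n * entropy (empDist z)) ≤
      slack n ^ Fintype.card A * ((typeClass (empDist z) n).card : ℝ) := by
  have h1 := card_typeClass_mul_prod_factorial hn z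
  have h2 := prod_card_fiber_pow hn z
  set c : A → ℕ := fun a => (Finset.univ.filter fun i => z i = a).card with hc
  change (typeClass (empDist z) n).card * ∏ a, (c a).factorial = _ at h1
  change ∏ a, ((c a : ℝ) ^ c a) = _ at h2
  have hsum : ∑ a, c a = n := sum_card_fiber z
  have hcn : ∀ a, c a ≤ n := fun a => by
    rw [← hsum]; exact Finset.single_le_sum (fun _ _ => Nat.zero_le _) (Finset.mem_univ a)
  have h3 : (∏ a, ((c a).factorial : ℝ)) * Real.exp n
      ≤ slack n ^ Fintype.card A * ∏ a, ((c a : ℝ) ^ c a) := by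
    have : Real.exp n = ∏ a, Real.exp (c a) := by
      rw [← Real.exp_sum, ← Nat.cast_sum, hsum]
    rw [this, ← Finset.prod_mul_distrib, ← Finset.card_univ, ← Finset.prod_const,
      ← Finset.prod_mul_distrib]
    refine Finset.prod_le_prod (fun a _ => by positivity) fun a _ => ?_
    refine (factorial_mul_exp_le (c a)).trans ?_
    unfold slack
    have := hcn a
    gcongr
  have h4 : (n : ℝ) ^ n ≤ n.factorial * Real.exp n := by
    have := Real.pow_div_factorial_le_exp (x := n) (by positivity) n
    rw [div_le_iff₀ (by positivity)] at this
    linarith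
  have h5 : (n.factorial : ℝ) = (typeClass (empDist z) n).card * ∏ a, ((c a).factorial : ℝ) := by
    exact_mod_cast h1.symm
  have h0 : (0 : ℝ) < (n : ℝ) ^ n := by positivity
  have h6 : (n : ℝ) ^ n * 1 ≤ (n : ℝ) ^ n * ((slack n ^ Fintype.card A *
      ((typeClass (empDist z) n).card : ℝ)) * Real.exp (-(n * entropy (empDist z)))) := by
    calc (n : ℝ) ^ n * 1 ≤ (typeClass (empDist z) n).card *
          ((∏ a, ((c a).factorial : ℝ)) * Real.exp n) := by
          rw [mul_one]; refine h4.trans (le_of_eq ?_); rw [h5]; ring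
      _ ≤ (typeClass (empDist z) n).card * (slack n ^ Fintype.card A * ∏ a, ((c a : ℝ) ^ c a)) := by
          gcongr
      _ = _ := by rw [h2]; ring
  have h7 := le_of_mul_le_mul_left h6 h0
  rwa [Real.exp_neg, ← div_eq_mul_inv, le_div_iff₀ (Real.exp_pos _), one_mul] at h7

lemma card_image_empDist_le {n : ℕ} :
    (Finset.univ.image (empDist : (Fin n → A) → A → ℝ)).card ≤ (n + 1) ^ Fintype.card A := by
  have : Finset.univ.image (empDist : (Fin n → A) → A → ℝ) ⊆
      (Fintype.piFinset fun _ : A => Finset.range (n + 1)).image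
        fun c a => (c a : ℝ) / n := by
    intro Q hQ
    obtain ⟨z, -, rfl⟩ := Finset.mem_image.1 hQ
    refine Finset.mem_image.2 ⟨fun a => (Finset.univ.filter fun i => z i = a).card, ?_, rfl⟩
    refine Fintype.mem_piFinset.2 fun a => Finset.mem_range_succ_iff.2 ?_
    exact (Finset.card_filter_le _ _).trans (by simp)
  refine (Finset.card_le_card this).trans (Finset.card_image_le.trans ?_)
  simp

/-- There are only polynomially many types. -/
lemma sum_exp_neg_entropy_le {n : ℕ} (hn : 0 < n) :
    ∑ z : Fin n → A, Real.exp (-(n * entropy (empDist z))) ≤ slack n ^ Fintype.card A := by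
  have h1 : ∀ Q ∈ Finset.univ.image (empDist : (Fin n → A) → A → ℝ),
      ∑ z ∈ Finset.univ.filter (fun z : Fin n → A => empDist z = Q),
        Real.exp (-(n * entropy (empDist z))) ≤ 1 := by
    intro Q hQ
    obtain ⟨w, -, rfl⟩ := Finset.mem_image.1 hQ
    have h2 : ∀ z ∈ Finset.univ.filter (fun z : Fin n → A => empDist z = empDist w),
        Real.exp (-(n * entropy (empDist z))) = Real.exp (-(n * entropy (empDist w))) := by
      intro z hz
      rw [(Finset.mem_filter.1 hz).2]
    rw [Finset.sum_congr rfl h2, Finset.sum_const, nsmul_eq_mul, Real.exp_neg, ← div_eq_mul_inv,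
      div_le_one (Real.exp_pos _)]
    have h3 : Finset.univ.filter (fun z : Fin n → A => empDist z = empDist w)
        = typeClass (empDist w) n := by
      ext z
      simp [mem_typeClass]
    rw [h3]
    exact card_typeClass_le hn w
  rw [← Finset.sum_fiberwise_of_maps_to (s := Finset.univ)
    (t := Finset.univ.image (empDist : (Fin n → A) → A → ℝ)) (g := empDist)
    (fun z _ => Finset.mem_image_of_mem _ (Finset.mem_univ z))]
  refine (Finset.sum_le_card_nsmul _ _ 1 h1).trans ?_
  rw [nsmul_eq_mul, mul_one]
  calc ((Finset.univ.image (empDist : (Fin n → A) → A → ℝ)).card : ℝ)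
      ≤ ((n : ℝ) + 1) ^ Fintype.card A := by exact_mod_cast card_image_empDist_le
    _ ≤ _ := by
      gcongr
      exact add_one_le_slack n

/-- Every vector of nonnegative integers with sum `n` is the vector of counts of some word. -/
lemma exists_empDist_eq {n : ℕ} (c : A → ℕ) (hc : ∑ a, c a = n) :
    ∃ z : Fin n → A, empDist z = fun a => (c a : ℝ) / n := by
  have e : Fin n ≃ (a : A) × Fin (c a) := Fintype.equivOfCardEq (by simp [hc])
  refine ⟨fun i => (e i).1, funext fun a => ?_⟩
  unfold empDist
  congr 2
  rw [← Fintype.card_fin (c a), ← Finset.card_univ]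
  symm
  refine Finset.card_bij (fun j _ => e.symm ⟨a, j⟩) (by simp)
    (fun j _ j' _ h => by simpa using h) ?_
  intro i hi
  have hi' : (e i).1 = a := by simpa using hi
  refine ⟨hi' ▸ (e i).2, Finset.mem_univ _, ?_⟩
  rw [Equiv.symm_apply_eq]
  ext
  · exact hi'.symm
  · simp

end Types

/-! ### Joint types: information quantities and probabilities -/

section Joint

variable {X Y : Type*} [Fintype X] [Fintype Y]

/-- The absolute continuity condition under which `condDiv W Q` and `logLik W Q` are finite. -/
def IsSupported (W : X → Y → ℝ) (Q : X × Y → ℝ) : Prop := ∀ x y, W x y = 0 → Q (x, y) = 0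

/-- The finite part of `logLik`. -/
noncomputable def realLogLik (W : X → Y → ℝ) (Q : X × Y → ℝ) : ℝ :=
  ∑ x, ∑ y, Q (x, y) * Real.log (W x y)

/-- The finite part of `condDiv`, written as a combination of entropies so that it is continuous
on the whole space. -/
noncomputable def realCondDiv (W : X → Y → ℝ) (Q : X × Y → ℝ) : ℝ :=
  entropy (margX Q) - entropy Q - realLogLik W Q

lemma logLik_of_isSupported {W : X → Y → ℝ} {Q : X × Y → ℝ} (h : IsSupported W Q) :
    logLik W Q = (realLogLik W Q : EReal) := if_pos h

lemma logLik_of_not_isSupported {W : X → Y → ℝ} {Q : X × Y → ℝ} (h : ¬ IsSupported W Q) :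
    logLik W Q = ⊥ := if_neg h

lemma condDiv_of_not_isSupported {W : X → Y → ℝ} {Q : X × Y → ℝ} (h : ¬ IsSupported W Q) :
    condDiv W Q = ⊤ := if_neg h

lemma entropy_margX (Q : X × Y → ℝ) :
    entropy (margX Q) = -∑ x, ∑ y, Q (x, y) * Real.log (margX Q x) := by
  simp only [entropy, Real.negMulLog, neg_mul, Finset.sum_neg_distrib, ← Finset.sum_mul]
  rfl

lemma entropy_margY (Q : X × Y → ℝ) :
    entropy (margY Q) = -∑ x, ∑ y, Q (x, y) * Real.log (margY Q y) := by
  rw [Finset.sum_comm]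
  simp only [entropy, Real.negMulLog, neg_mul, Finset.sum_neg_distrib, ← Finset.sum_mul]
  rfl

lemma entropy_joint (Q : X × Y → ℝ) :
    entropy Q = -∑ x, ∑ y, Q (x, y) * Real.log (Q (x, y)) := by
  simp only [entropy, Real.negMulLog, neg_mul, Finset.sum_neg_distrib, Fintype.sum_prod_type]

lemma le_margX {Q : X × Y → ℝ} (hQ : ∀ a, 0 ≤ Q a) (x : X) (y : Y) : Q (x, y) ≤ margX Q x :=
  Finset.single_le_sum (f := fun y => Q (x, y)) (fun _ _ => hQ _) (Finset.mem_univ y)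

lemma le_margY {Q : X × Y → ℝ} (hQ : ∀ a, 0 ≤ Q a) (x : X) (y : Y) : Q (x, y) ≤ margY Q y :=
  Finset.single_le_sum (f := fun x => Q (x, y)) (fun _ _ => hQ _) (Finset.mem_univ x)

lemma mutualInfo_eq_entropy {Q : X × Y → ℝ} (hQ : ∀ a, 0 ≤ Q a) :
    mutualInfo Q = entropy (margX Q) + entropy (margY Q) - entropy Q := by
  rw [entropy_margX, entropy_margY, entropy_joint, mutualInfo, ← neg_add, sub_neg_eq_add,
    neg_add_eq_sub, ← Finset.sum_add_distrib, ← Finset.sum_sub_distrib]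
  refine Finset.sum_congr rfl fun x _ => ?_
  rw [← Finset.sum_add_distrib, ← Finset.sum_sub_distrib]
  refine Finset.sum_congr rfl fun y _ => ?_
  rcases (hQ (x, y)).eq_or_lt with h0 | h0
  · simp [← h0]
  · have h1 := h0.trans_le (le_margX hQ x y)
    have h2 := h0.trans_le (le_margY hQ x y)
    rw [Real.log_div h0.ne' (by positivity), Real.log_mul h1.ne' h2.ne']
    ring

lemma condDiv_of_isSupported {W : X → Y → ℝ} {Q : X × Y → ℝ} (hQ : ∀ a, 0 ≤ Q a)
    (h : IsSupported W Q) : condDiv W Q = (realCondDiv W Q : EReal) := by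
  refine (if_pos h).trans ?_
  congr 1
  rw [realCondDiv, entropy_margX, entropy_joint, realLogLik, neg_sub_neg,
    ← Finset.sum_sub_distrib, ← Finset.sum_sub_distrib]
  refine Finset.sum_congr rfl fun x _ => ?_
  rw [← Finset.sum_sub_distrib, ← Finset.sum_sub_distrib]
  refine Finset.sum_congr rfl fun y _ => ?_
  rcases (hQ (x, y)).eq_or_lt with h0 | h0
  · simp [← h0]
  · have h1 := h0.trans_le (le_margX hQ x y)
    have h2 : W x y ≠ 0 := fun hw => h0.ne' (h x y hw)
    rw [Real.log_div (by positivity) h2, Real.log_div h0.ne' h1.ne']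
    ring

lemma continuous_entropy {A : Type*} [Fintype A] :
    Continuous (entropy : (A → ℝ) → ℝ) := by
  unfold entropy
  exact continuous_finsetSum _ fun a _ => Real.continuous_negMulLog.comp (continuous_apply a)

lemma continuous_margX : Continuous (margX : (X × Y → ℝ) → X → ℝ) := by
  unfold margX; fun_prop

lemma continuous_margY : Continuous (margY : (X × Y → ℝ) → Y → ℝ) := by
  unfold margY; fun_prop

lemma continuous_realLogLik (W : X → Y → ℝ) : Continuous (realLogLik W) := by
  unfold realLogLik; fun_prop

lemma continuous_realCondDiv (W : X → Y → ℝ) : Continuous (realCondDiv W) :=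
  ((continuous_entropy.comp continuous_margX).sub continuous_entropy).sub
    (continuous_realLogLik W)

lemma nonneg_of_mem_jointWith {P : X → ℝ} {Q : X × Y → ℝ} (hQ : Q ∈ jointWith P) (a : X × Y) :
    0 ≤ Q a := hQ.1.1 a

lemma continuousOn_mutualInfo (P : X → ℝ) :
    ContinuousOn (mutualInfo : (X × Y → ℝ) → ℝ) (jointWith P) := by
  refine ContinuousOn.congr (f := fun Q => entropy (margX Q) + entropy (margY Q) - entropy Q)
    (Continuous.continuousOn ?_)
    fun Q hQ => mutualInfo_eq_entropy (nonneg_of_mem_jointWith hQ)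
  exact ((continuous_entropy.comp continuous_margX).add
    (continuous_entropy.comp continuous_margY)).sub continuous_entropy

lemma isCompact_jointWith (P : X → ℝ) : IsCompact (jointWith P : Set (X × Y → ℝ)) :=
  (isCompact_stdSimplex ℝ (X × Y)).inter_right (isClosed_eq continuous_margX continuous_const)

lemma isClosed_isSupported (W : X → Y → ℝ) : IsClosed {Q : X × Y → ℝ | IsSupported W Q} := by
  simp only [IsSupported, Set.ofPred_forall]
  exact isClosed_iInter fun x => isClosed_iInter fun y => isClosed_iInter fun _ =>
    isClosed_eq (continuous_apply _) continuous_const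

variable [DecidableEq X] [DecidableEq Y]

lemma margX_jointEmpDist {n : ℕ} (x : Fin n → X) (y : Fin n → Y) :
    margX (jointEmpDist x y) = empDist x := by
  funext a
  simp only [margX, jointEmpDist, empDist, ← Finset.sum_div, ← Nat.cast_sum]
  congr 2
  rw [Finset.card_eq_sum_card_fiberwise (f := y) (t := Finset.univ) (by simp)]
  refine Finset.sum_congr rfl fun b _ => ?_
  rw [Finset.filter_filter]
  simp

lemma margY_jointEmpDist {n : ℕ} (x : Fin n → X) (y : Fin n → Y) :
    margY (jointEmpDist x y) = empDist y := by
  funext b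
  simp only [margY, jointEmpDist, empDist, ← Finset.sum_div, ← Nat.cast_sum]
  congr 2
  rw [Finset.card_eq_sum_card_fiberwise (f := x) (t := Finset.univ) (by simp)]
  refine Finset.sum_congr rfl fun a _ => ?_
  rw [Finset.filter_filter]
  simp [and_comm]

lemma jointEmpDist_mem_jointWith {P : X → ℝ} {n : ℕ} (hn : 0 < n) {x : Fin n → X}
    (hx : x ∈ typeClass P n) (y : Fin n → Y) : jointEmpDist x y ∈ jointWith P :=
  ⟨⟨fun a => empDist_nonneg _ a, sum_empDist hn _⟩,
    (margX_jointEmpDist x y).trans (mem_typeClass.1 hx)⟩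

lemma exp_mul_realLogLik {W : X → Y → ℝ} (hW : IsChannel W) {n : ℕ} (hn : 0 < n)
    {x : Fin n → X} {y : Fin n → Y} (h : IsSupported W (jointEmpDist x y)) :
    Real.exp (n * realLogLik W (jointEmpDist x y)) = chanProb W x y := by
  have hpos : ∀ i, 0 < W (x i) (y i) := by
    intro i
    refine (hW.1 _ _).lt_of_ne fun h0 => ?_
    have h1 := mul_empDist hn (fun i => (x i, y i)) (x i, y i)
    have h2 := h _ _ h0.symm
    rw [jointEmpDist] at h2
    rw [h2, mul_zero] at h1
    have h3 : (Finset.univ.filter fun j => (x j, y j) = (x i, y i)).card = 0 := by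
      exact_mod_cast h1.symm
    rw [Finset.card_eq_zero] at h3
    exact Finset.notMem_empty i (h3 ▸ by simp)
  have h1 : n * realLogLik W (jointEmpDist x y) = ∑ i, Real.log (W (x i) (y i)) := by
    rw [realLogLik, ← Fintype.sum_prod_type' (f := fun a b => jointEmpDist x y (a, b) *
      Real.log (W a b)), Finset.mul_sum]
    rw [← Finset.sum_fiberwise_of_maps_to (s := Finset.univ) (t := Finset.univ)
      (g := fun i => (x i, y i)) (fun _ _ => Finset.mem_univ _)]
    refine Finset.sum_congr rfl fun a _ => ?_
    rw [← mul_assoc, jointEmpDist, mul_empDist hn, ← nsmul_eq_mul, ← Finset.sum_const]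
    refine Finset.sum_congr rfl fun i hi => ?_
    rw [← (Finset.mem_filter.1 hi).2]
  rw [h1, Real.exp_sum, chanProb]
  exact Finset.prod_congr rfl fun i _ => Real.exp_log (hpos i)

omit [Fintype X] in
lemma chanProb_nonneg {W : X → Y → ℝ} (hW : IsChannel W) {n : ℕ} (x : Fin n → X)
    (y : Fin n → Y) : 0 ≤ chanProb W x y := Finset.prod_nonneg fun _ _ => hW.1 _ _

lemma isSupported_of_chanProb_ne_zero {W : X → Y → ℝ} {n : ℕ}
    {x : Fin n → X} {y : Fin n → Y} (h : chanProb W x y ≠ 0) :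
    IsSupported W (jointEmpDist x y) := by
  intro a b hab
  have : Finset.univ.filter (fun i => (x i, y i) = (a, b)) = ∅ := by
    refine Finset.filter_eq_empty_iff.2 fun i _ hi => ?_
    rw [Prod.mk.injEq] at hi
    refine (Finset.prod_ne_zero_iff.1 h) i (Finset.mem_univ i) ?_
    rw [hi.1, hi.2, hab]
  rw [jointEmpDist, empDist, this]
  simp

lemma sum_jointEmpDist {n : ℕ} (g : (X × Y → ℝ) → ℝ) :
    ∑ x : Fin n → X, ∑ y : Fin n → Y, g (jointEmpDist x y)
      = ∑ z : Fin n → X × Y, g (empDist z) := by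
  rw [← Fintype.sum_prod_type' (f := fun x y => g (jointEmpDist x y))]
  exact (Fintype.sum_equiv (Equiv.arrowProdEquivProdArrow (Fin n) (fun _ => X) (fun _ => Y))
    _ _ fun z => rfl).symm

/-- Sums of functions of the joint type over a type class of inputs depend on the output only
through its type. -/
lemma card_mul_sum_typeClass {P : X → ℝ} {n : ℕ} (hn : 0 < n) (y : Fin n → Y)
    (g : (X × Y → ℝ) → ℝ) :
    ((typeClass (empDist y) n).card : ℝ) * ∑ x ∈ typeClass P n, g (jointEmpDist x y)
      = ∑ x ∈ typeClass P n, ∑ y' ∈ typeClass (empDist y) n, g (jointEmpDist x y') := by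
  rw [Finset.sum_comm, ← nsmul_eq_mul, ← Finset.sum_const]
  refine Finset.sum_congr rfl fun y' hy' => ?_
  obtain ⟨σ, rfl⟩ := exists_perm_of_empDist_eq hn (mem_typeClass.1 hy').symm
  refine Finset.sum_bij (fun x _ => x ∘ σ) ?_ ?_ ?_ ?_
  · intro x hx
    rw [mem_typeClass] at hx ⊢
    rw [empDist_comp_perm, hx]
  · intro a _ b _ hab
    exact σ.surjective.injective_comp_right hab
  · intro x hx
    refine ⟨x ∘ σ.symm, ?_, by funext i; simp⟩
    rw [mem_typeClass] at hx ⊢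
    rw [empDist_comp_perm, hx]
  · intro x _
    exact congrArg g (empDist_comp_perm (fun i => (x i, y i)) σ).symm

/-- The number of slack factors lost in the estimates on joint types. -/
def slackDegree (X Y : Type*) [Fintype X] [Fintype Y] : ℕ :=
  Fintype.card X + Fintype.card Y + Fintype.card (X × Y)

lemma slack_pow_card_le_left (n : ℕ) :
    slack n ^ (Fintype.card X + Fintype.card (X × Y)) ≤ slack n ^ slackDegree X Y :=
  pow_le_pow_right₀ (one_le_slack n) (by unfold slackDegree; omega)

lemma slack_pow_card_le_right (n : ℕ) :
    slack n ^ Fintype.card (X × Y) ≤ slack n ^ slackDegree X Y :=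
  pow_le_pow_right₀ (one_le_slack n) (by unfold slackDegree; omega)

lemma exp_entropy_le {P : X → ℝ} {n : ℕ} (hn : 0 < n) (hT : (typeClass P n).Nonempty) :
    Real.exp (n * entropy P) ≤ slack n ^ Fintype.card X * ((typeClass P n).card : ℝ) := by
  obtain ⟨x, hx⟩ := hT
  rw [mem_typeClass] at hx
  subst hx
  exact le_card_typeClass hn x

lemma self_mem_typeClass {A : Type*} [Fintype A] [DecidableEq A] {n : ℕ} (z : Fin n → A) :
    z ∈ typeClass (empDist z) n := mem_typeClass.2 rfl

/-- For fixed `y` and `X` uniform on the type class of `P`, the exponential moment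
`E exp (n I(X, y))` is at most polynomial. This carries all union bounds over wrong codewords. -/
lemma sum_exp_mutualInfo_le {P : X → ℝ} {n : ℕ} (hn : 0 < n) (hT : (typeClass P n).Nonempty)
    (y : Fin n → Y) :
    ∑ x ∈ typeClass P n, Real.exp (n * mutualInfo (jointEmpDist x y))
      ≤ slack n ^ slackDegree X Y * (typeClass P n).card := by
  have hI : ∀ x ∈ typeClass P n, Real.exp (n * mutualInfo (jointEmpDist x y))
      = Real.exp (n * entropy P) * Real.exp (n * entropy (empDist y)) *
        Real.exp (-(n * entropy (jointEmpDist x y))) := by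
    intro x hx
    rw [mutualInfo_eq_entropy (nonneg_of_mem_jointWith (jointEmpDist_mem_jointWith hn hx y)),
      margX_jointEmpDist, margY_jointEmpDist, mem_typeClass.1 hx, ← Real.exp_add, ← Real.exp_add]
    congr 1; ring
  rw [Finset.sum_congr rfl hI, ← Finset.mul_sum]
  set S := ∑ x ∈ typeClass P n, Real.exp (-(n * entropy (jointEmpDist x y))) with hS
  have hS0 : 0 ≤ S := Finset.sum_nonneg fun _ _ => (Real.exp_pos _).le
  have h1 : ((typeClass (empDist y) n).card : ℝ) * S ≤ slack n ^ Fintype.card (X × Y) := by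
    rw [hS, card_mul_sum_typeClass hn y (fun Q => Real.exp (-(n * entropy Q)))]
    refine le_trans ?_ (sum_exp_neg_entropy_le (A := X × Y) hn)
    rw [← sum_jointEmpDist (fun Q => Real.exp (-(n * entropy Q)))]
    refine (Finset.sum_le_sum fun x _ => Finset.sum_le_sum_of_subset_of_nonneg
      (Finset.subset_univ _) fun _ _ _ => (Real.exp_pos _).le).trans ?_
    exact Finset.sum_le_sum_of_subset_of_nonneg (Finset.subset_univ _)
      fun _ _ _ => Finset.sum_nonneg fun _ _ => (Real.exp_pos _).le
  have hs := slack_pos n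
  calc Real.exp (n * entropy P) * Real.exp (n * entropy (empDist y)) * S
      ≤ (slack n ^ Fintype.card X * (typeClass P n).card) *
        (slack n ^ Fintype.card Y * (typeClass (empDist y) n).card) * S := by
        gcongr
        · exact exp_entropy_le hn hT
        · exact exp_entropy_le hn ⟨y, self_mem_typeClass y⟩
    _ = (slack n ^ (Fintype.card X + Fintype.card Y)) * (typeClass P n).card *
        ((typeClass (empDist y) n).card * S) := by rw [pow_add]; ring
    _ ≤ (slack n ^ (Fintype.card X + Fintype.card Y)) * (typeClass P n).card *
        slack n ^ Fintype.card (X × Y) := by gcongr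
    _ = _ := by rw [slackDegree, pow_add]; ring

/-- For the transmitted codeword and the channel output, the exponential moment of the
conditional divergence of their joint type is at most polynomial. -/
lemma sum_chanProb_mul_exp_le {W : X → Y → ℝ} (hW : IsChannel W) {P : X → ℝ} {n : ℕ}
    (hn : 0 < n) (hT : (typeClass P n).Nonempty) :
    ∑ x ∈ typeClass P n, ∑ y, chanProb W x y * Real.exp (n * realCondDiv W (jointEmpDist x y))
      ≤ slack n ^ slackDegree X Y * (typeClass P n).card := by
  have h1 : ∀ x ∈ typeClass P n, ∀ y : Fin n → Y,
      chanProb W x y * Real.exp (n * realCondDiv W (jointEmpDist x y))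
        ≤ Real.exp (n * entropy P) * Real.exp (-(n * entropy (jointEmpDist x y))) := by
    intro x hx y
    by_cases h0 : chanProb W x y = 0
    · rw [h0, zero_mul]; positivity
    · rw [← exp_mul_realLogLik hW hn (isSupported_of_chanProb_ne_zero h0), realCondDiv,
        margX_jointEmpDist, mem_typeClass.1 hx, ← Real.exp_add, ← Real.exp_add]
      apply le_of_eq
      congr 1; ring
  calc ∑ x ∈ typeClass P n, ∑ y, chanProb W x y *
        Real.exp (n * realCondDiv W (jointEmpDist x y))
      ≤ ∑ x ∈ typeClass P n, ∑ y : Fin n → Y,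
        Real.exp (n * entropy P) * Real.exp (-(n * entropy (jointEmpDist x y))) :=
        Finset.sum_le_sum fun x hx => Finset.sum_le_sum fun y _ => h1 x hx y
    _ ≤ ∑ x : Fin n → X, ∑ y : Fin n → Y,
        Real.exp (n * entropy P) * Real.exp (-(n * entropy (jointEmpDist x y))) :=
        Finset.sum_le_sum_of_subset_of_nonneg (Finset.subset_univ _)
          fun _ _ _ => Finset.sum_nonneg fun _ _ => by positivity
    _ = Real.exp (n * entropy P) * ∑ z : Fin n → X × Y, Real.exp (-(n * entropy (empDist z))) := by
        rw [← sum_jointEmpDist (fun Q => Real.exp (-(n * entropy Q)))]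
        simp only [Finset.mul_sum]
    _ ≤ (slack n ^ Fintype.card X * (typeClass P n).card) * slack n ^ Fintype.card (X × Y) := by
        gcongr
        · have := slack_pos n
          positivity
        · exact exp_entropy_le hn hT
        · exact sum_exp_neg_entropy_le hn
    _ = slack n ^ (Fintype.card X + Fintype.card (X × Y)) * (typeClass P n).card := by
        rw [pow_add]; ring
    _ ≤ _ := by
        exact mul_le_mul_of_nonneg_right (slack_pow_card_le_left n) (by positivity)

open Classical in
/-- A random word of type `P` has joint type `Q` with a given word `y` of type `Q_Y` with
probability at least `exp (-n I(Q))`, up to a polynomial factor. -/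
lemma exp_neg_mutualInfo_le {n : ℕ} (hn : 0 < n) {x₀ : Fin n → X} {y₀ y : Fin n → Y}
    (hy : empDist y = empDist y₀) :
    Real.exp (-(n * mutualInfo (jointEmpDist x₀ y₀))) * (typeClass (empDist x₀) n).card ≤
      slack n ^ slackDegree X Y *
      ((typeClass (empDist x₀) n).filter fun x => jointEmpDist x y = jointEmpDist x₀ y₀).card := by
  set Q := jointEmpDist x₀ y₀ with hQ
  set N := ((typeClass (empDist x₀) n).filter fun x => jointEmpDist x y = Q).card with hN
  -- double counting of the type class of `Q`
  have hcount : ((typeClass (empDist y) n).card : ℝ) * N = (typeClass Q n).card := by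
    have h1 := card_mul_sum_typeClass (P := empDist x₀) hn y
      (fun Q' => if Q' = Q then (1 : ℝ) else 0)
    rw [Finset.sum_boole] at h1
    rw [hN, h1]
    have h2 := sum_jointEmpDist (n := n) (fun Q' => if Q' = Q then (1 : ℝ) else 0)
    rw [Finset.sum_boole] at h2
    have h3 : Finset.univ.filter (fun z : Fin n → X × Y => empDist z = Q) = typeClass Q n := by
      ext z; simp [mem_typeClass]
    rw [← h3, ← h2]
    rw [← Finset.sum_subset (Finset.subset_univ (typeClass (empDist x₀) n))]
    · refine Finset.sum_congr rfl fun x _ => Finset.sum_subset (Finset.subset_univ _) ?_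
      intro y' _ hy'
      refine if_neg fun h => hy' (mem_typeClass.2 ?_)
      rw [hy, ← margY_jointEmpDist x y', h, hQ, margY_jointEmpDist]
    · intro x _ hx
      refine Finset.sum_eq_zero fun y' _ => if_neg fun h => hx (mem_typeClass.2 ?_)
      rw [← margX_jointEmpDist x y', h, hQ, margX_jointEmpDist]
  have hI : Real.exp (-(n * mutualInfo Q)) = Real.exp (n * entropy Q) *
      (Real.exp (-(n * entropy (empDist x₀))) * Real.exp (-(n * entropy (empDist y)))) := by
    rw [hQ, mutualInfo_eq_entropy (Q := jointEmpDist x₀ y₀) (fun a => empDist_nonneg _ a),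
      margX_jointEmpDist, margY_jointEmpDist, hy, ← Real.exp_add, ← Real.exp_add]
    congr 1; ring
  have hs := slack_pos n
  have e1 : Real.exp (-(n * entropy (empDist x₀))) * (typeClass (empDist x₀) n).card ≤ 1 := by
    rw [Real.exp_neg, inv_mul_le_one₀ (Real.exp_pos _)]
    exact card_typeClass_le hn x₀
  have e2 : Real.exp (-(n * entropy (empDist y))) * (typeClass (empDist y) n).card ≤ 1 := by
    rw [Real.exp_neg, inv_mul_le_one₀ (Real.exp_pos _)]
    exact card_typeClass_le hn y
  calc Real.exp (-(n * mutualInfo Q)) * (typeClass (empDist x₀) n).card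
      = Real.exp (n * entropy Q) * Real.exp (-(n * entropy (empDist y))) *
        (Real.exp (-(n * entropy (empDist x₀))) * (typeClass (empDist x₀) n).card) := by
        rw [hI]; ring
    _ ≤ Real.exp (n * entropy Q) * Real.exp (-(n * entropy (empDist y))) * 1 := by gcongr
    _ ≤ (slack n ^ Fintype.card (X × Y) * (typeClass Q n).card) *
        Real.exp (-(n * entropy (empDist y))) * 1 := by
        gcongr
        exact le_card_typeClass hn (fun i => (x₀ i, y₀ i))
    _ = slack n ^ Fintype.card (X × Y) *
        (Real.exp (-(n * entropy (empDist y))) * (typeClass (empDist y) n).card) * N := by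
        rw [← hcount]; ring
    _ ≤ slack n ^ Fintype.card (X × Y) * 1 * N := by gcongr
    _ ≤ _ := by
        rw [mul_one]
        exact mul_le_mul_of_nonneg_right (slack_pow_card_le_right n) (by positivity)

open Classical in
/-- The transmitted codeword and the channel output have joint type `Q` with probability at least
`exp (-n D(Q_{Y|X} ‖ W | P))`, up to a polynomial factor. -/
lemma exp_neg_realCondDiv_le {W : X → Y → ℝ} (hW : IsChannel W) {n : ℕ} (hn : 0 < n)
    {x₀ : Fin n → X} {y₀ : Fin n → Y} (hs : IsSupported W (jointEmpDist x₀ y₀)) :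
    Real.exp (-(n * realCondDiv W (jointEmpDist x₀ y₀))) * (typeClass (empDist x₀) n).card ≤
      slack n ^ slackDegree X Y *
        ∑ x ∈ typeClass (empDist x₀) n, ∑ y : Fin n → Y,
          if jointEmpDist x y = jointEmpDist x₀ y₀ then chanProb W x y else 0 := by
  set Q := jointEmpDist x₀ y₀ with hQ
  have hcount : ∑ x ∈ typeClass (empDist x₀) n, ∑ y : Fin n → Y,
      (if jointEmpDist x y = Q then chanProb W x y else 0)
      = Real.exp (n * realLogLik W Q) * (typeClass Q n).card := by
    have h2 := sum_jointEmpDist (n := n)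
      (fun Q' => if Q' = Q then Real.exp (n * realLogLik W Q) else 0)
    rw [← Finset.sum_filter, Finset.sum_const, nsmul_eq_mul] at h2
    have h3 : Finset.univ.filter (fun z : Fin n → X × Y => empDist z = Q) = typeClass Q n := by
      ext z; simp [mem_typeClass]
    rw [← h3, mul_comm, ← h2]
    rw [← Finset.sum_subset (Finset.subset_univ (typeClass (empDist x₀) n))]
    · refine Finset.sum_congr rfl fun x _ => Finset.sum_congr rfl fun y _ => ?_
      split_ifs with h
      · rw [← h] at hs ⊢
        rw [exp_mul_realLogLik hW hn hs]
      · rfl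
    · intro x _ hx
      refine Finset.sum_eq_zero fun y' _ => if_neg fun h => hx (mem_typeClass.2 ?_)
      rw [← margX_jointEmpDist x y', h, hQ, margX_jointEmpDist]
  have hD : Real.exp (-(n * realCondDiv W Q)) = Real.exp (n * entropy Q) *
      (Real.exp (-(n * entropy (empDist x₀))) * Real.exp (n * realLogLik W Q)) := by
    rw [realCondDiv, hQ, margX_jointEmpDist, ← Real.exp_add, ← Real.exp_add]
    congr 1; ring
  have hs := slack_pos n
  have e1 : Real.exp (-(n * entropy (empDist x₀))) * (typeClass (empDist x₀) n).card ≤ 1 := by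
    rw [Real.exp_neg, inv_mul_le_one₀ (Real.exp_pos _)]
    exact card_typeClass_le hn x₀
  rw [hcount, hD]
  calc _ = Real.exp (n * entropy Q) * Real.exp (n * realLogLik W Q) *
        (Real.exp (-(n * entropy (empDist x₀))) * (typeClass (empDist x₀) n).card) := by ring
    _ ≤ Real.exp (n * entropy Q) * Real.exp (n * realLogLik W Q) * 1 := by gcongr
    _ ≤ (slack n ^ Fintype.card (X × Y) * (typeClass Q n).card) *
        Real.exp (n * realLogLik W Q) * 1 := by
        gcongr
        exact le_card_typeClass hn (fun i => (x₀ i, y₀ i))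
    _ = slack n ^ Fintype.card (X × Y) *
        (Real.exp (n * realLogLik W Q) * (typeClass Q n).card) := by ring
    _ ≤ _ := by
        exact mul_le_mul_of_nonneg_right (slack_pow_card_le_right n) (by positivity)

end Joint

/-! ### Averages over the ensemble -/

section Ensemble

lemma sum_piFinset_apply {V : Type*} [DecidableEq V] {M : ℕ} (t : Fin M → Finset V) (m : Fin M)
    (g : V → ℝ) :
    ∑ C ∈ Fintype.piFinset t, g (C m)
      = (∑ x ∈ t m, g x) * ∏ j ∈ Finset.univ.erase m, ((t j).card : ℝ) := by
  have h1 : ∀ C : Fin M → V, g (C m) = ∏ j, if j = m then g (C j) else 1 := by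
    intro C; simp
  simp only [h1]
  rw [← Finset.prod_univ_sum t (fun j x => if j = m then g x else 1),
    ← Finset.mul_prod_erase _ _ (Finset.mem_univ m)]
  congr 1
  · simp
  · refine Finset.prod_congr rfl fun j hj => ?_
    simp [Finset.ne_of_mem_erase hj]

lemma sum_piFinset_ite {V : Type*} [DecidableEq V] {M : ℕ} {S : Finset V} {B : V → Finset V}
    (hB : ∀ x, B x ⊆ S) (l : Fin M) (F : (Fin M → V) → ℝ)
    [∀ C : Fin M → V, Decidable (∀ j, j ≠ l → C j ∈ B (C l))] :
    ∑ C ∈ Fintype.piFinset (fun _ => S), (if ∀ j, j ≠ l → C j ∈ B (C l) then F C else 0)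
      = ∑ x ∈ S, ∑ C ∈ Fintype.piFinset (fun j => if j = l then {x} else B x), F C := by
  rw [← Finset.sum_fiberwise_of_maps_to (t := S) (g := fun C => C l)
    (fun C hC => Fintype.mem_piFinset.1 hC l)]
  refine Finset.sum_congr rfl fun x hx => ?_
  rw [← Finset.sum_filter, Finset.filter_filter]
  refine Finset.sum_congr ?_ fun _ _ => rfl
  ext C
  simp only [Finset.mem_filter, Fintype.mem_piFinset]
  constructor
  · rintro ⟨-, rfl, h⟩ j
    by_cases hj : j = l
    · simp [hj]
    · simpa [hj] using h j hj
  · intro h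
    have hl : C l = x := by simpa using h l
    have h' : ∀ j, j ≠ l → C j ∈ B x := fun j hj => by simpa [hj] using h j
    refine ⟨fun j => ?_, hl, by rwa [hl]⟩
    by_cases hj : j = l
    · rw [hj, hl]; exact hx
    · exact hB x (h' j hj)

/-- If all words but the `l`-th are required to lie in a set depending on the `l`-th, their number
of choices is a power. -/
lemma sum_piFinset_ite_self {V : Type*} [DecidableEq V] {M : ℕ} {S : Finset V} {B : V → Finset V}
    (hB : ∀ x, B x ⊆ S) (l : Fin M) (g : V → ℝ)
    [∀ C : Fin M → V, Decidable (∀ j, j ≠ l → C j ∈ B (C l))] :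
    ∑ C ∈ Fintype.piFinset (fun _ => S), (if ∀ j, j ≠ l → C j ∈ B (C l) then g (C l) else 0)
      = ∑ x ∈ S, g x * ((B x).card : ℝ) ^ (M - 1) := by
  rw [sum_piFinset_ite hB l fun C => g (C l)]
  refine Finset.sum_congr rfl fun x _ => ?_
  rw [sum_piFinset_apply _ l g]
  congr 1
  · simp
  · rw [Finset.prod_congr rfl (g := fun _ => ((B x).card : ℝ))
      fun j hj => by simp [Finset.ne_of_mem_erase hj]]
    rw [Finset.prod_const, Finset.card_erase_of_mem (Finset.mem_univ _)]
    simp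

lemma sum_piFinset_ite_other {V : Type*} [DecidableEq V] {M : ℕ} {S : Finset V} {B : V → Finset V}
    (hB : ∀ x, B x ⊆ S) {l m : Fin M} (hlm : l ≠ m) (g : V → V → ℝ)
    [∀ C : Fin M → V, Decidable (∀ j, j ≠ l → C j ∈ B (C l))] :
    ∑ C ∈ Fintype.piFinset (fun _ => S),
        (if ∀ j, j ≠ l → C j ∈ B (C l) then g (C m) (C l) else 0)
      = ∑ x ∈ S, (∑ x' ∈ B x, g x' x) * ((B x).card : ℝ) ^ (M - 2) := by
  rw [sum_piFinset_ite hB l fun C => g (C m) (C l)]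
  refine Finset.sum_congr rfl fun x _ => ?_
  have h1 : ∀ C ∈ Fintype.piFinset (fun j => if j = l then {x} else B x),
      g (C m) (C l) = g (C m) x := by
    intro C hC
    have : C l = x := by simpa using Fintype.mem_piFinset.1 hC l
    rw [this]
  rw [Finset.sum_congr rfl h1, sum_piFinset_apply _ m fun x' => g x' x]
  congr 1
  · rw [if_neg hlm.symm]
  · rw [← Finset.mul_prod_erase _ _ (Finset.mem_erase.2 ⟨hlm, Finset.mem_univ l⟩)]
    rw [Finset.prod_congr rfl (g := fun _ => ((B x).card : ℝ))
      fun j hj => by simp [Finset.ne_of_mem_erase hj]]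
    rw [Finset.prod_const, Finset.card_erase_of_mem (Finset.mem_erase.2 ⟨hlm, Finset.mem_univ l⟩),
      Finset.card_erase_of_mem (Finset.mem_univ _)]
    simp [Nat.sub_sub]

variable {X Y : Type*} [Fintype X] [Fintype Y] [DecidableEq X] [DecidableEq Y]

open Classical in
/-- The probability that a uniform word `x` of the type class of `P` has `h(Q̂_{xy}) > s`. -/
noncomputable def beatProb (P : X → ℝ) {n : ℕ} (h : (X × Y → ℝ) → EReal) (y : Fin n → Y)
    (s : EReal) : ℝ :=
  (((typeClass P n).filter fun x => s < h (jointEmpDist x y)).card : ℝ) / (typeClass P n).card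

lemma beatProb_nonneg (P : X → ℝ) {n : ℕ} (h : (X × Y → ℝ) → EReal) (y : Fin n → Y)
    (s : EReal) : 0 ≤ beatProb P h y s := by unfold beatProb; positivity

lemma beatProb_le_one (P : X → ℝ) {n : ℕ} (h : (X × Y → ℝ) → EReal) (y : Fin n → Y)
    (s : EReal) : beatProb P h y s ≤ 1 :=
  div_le_one_of_le₀ (by exact_mod_cast Finset.card_filter_le _ _) (by positivity)

open Classical in
lemma card_filter_le_eq {P : X → ℝ} {n : ℕ} (hT : (typeClass P n).Nonempty)
    (h : (X × Y → ℝ) → EReal) (y : Fin n → Y) (s : EReal) :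
    (((typeClass P n).filter fun x => h (jointEmpDist x y) ≤ s).card : ℝ)
      = (typeClass P n).card * (1 - beatProb P h y s) := by
  have h0 : ((typeClass P n).card : ℝ) ≠ 0 := by exact_mod_cast hT.card_ne_zero
  have h1 := Finset.card_filter_add_card_filter_not (s := typeClass P n)
    (fun x => h (jointEmpDist x y) ≤ s)
  simp only [not_le] at h1
  unfold beatProb
  rw [mul_sub, mul_one, mul_div_cancel₀ _ h0, ← h1]
  push_cast
  ring

open Classical in
lemma mem_region_iff {W : X → Y → ℝ} {h : (X × Y → ℝ) → EReal} {P : X → ℝ} {M n : ℕ}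
    {C : Fin M → Fin n → X} (hC : C ∈ Fintype.piFinset fun _ : Fin M => typeClass P n)
    (m : Fin M) (y : Fin n → Y) :
    y ∈ region W h C m ↔ ∀ l, l ≠ m → C l ∈ (typeClass P n).filter
      fun x => h (jointEmpDist x y) ≤ logLik W (jointEmpDist (C m) y) := by
  rw [region, Set.mem_ofPred_eq, iSup₂_le_iff]
  refine forall_congr' fun l => forall_congr' fun _ => ?_
  rw [Finset.mem_filter]
  exact ⟨fun h => ⟨Fintype.mem_piFinset.1 hC l, h⟩, fun h => h.2⟩

lemma ensembleAvg_errProb (W : X → Y → ℝ) (h : (X × Y → ℝ) → EReal) {P : X → ℝ} {M n : ℕ}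
    (hM : 1 ≤ M) (hT : (typeClass P n).Nonempty) :
    ensembleAvg P M n (fun C => errProb W C (region W h C))
      = (1 / (typeClass P n).card) * ∑ x ∈ typeClass P n, ∑ y, chanProb W x y *
        (1 - (1 - beatProb P h y (logLik W (jointEmpDist x y))) ^ (M - 1)) := by
  classical
  have h0 : ((typeClass P n).card : ℝ) ≠ 0 := by exact_mod_cast hT.card_ne_zero
  have hM0 : (M : ℝ) ≠ 0 := by positivity
  have key : ∀ (m : Fin M) (y : Fin n → Y),
      ∑ C ∈ Fintype.piFinset (fun _ : Fin M => typeClass P n),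
        (if y ∉ region W h C m then chanProb W (C m) y else 0)
      = ((typeClass P n).card : ℝ) ^ (M - 1) * ∑ x ∈ typeClass P n, chanProb W x y *
        (1 - (1 - beatProb P h y (logLik W (jointEmpDist x y))) ^ (M - 1)) := by
    intro m y
    have e1 := sum_piFinset_ite_self (S := typeClass P n) (B := fun x => (typeClass P n).filter
      fun x' => h (jointEmpDist x' y) ≤ logLik W (jointEmpDist x y))
      (fun x => Finset.filter_subset _ _) m (fun x => chanProb W x y)
    have e2 := sum_piFinset_ite_self (S := typeClass P n) (B := fun _ => typeClass P n)
      (fun x => Finset.Subset.refl _) m (fun x => chanProb W x y)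
    have e3 : ∀ C ∈ Fintype.piFinset (fun _ : Fin M => typeClass P n),
        (if y ∉ region W h C m then chanProb W (C m) y else 0)
        = (if ∀ j, j ≠ m → C j ∈ typeClass P n then chanProb W (C m) y else 0) -
          (if ∀ j, j ≠ m → C j ∈ (typeClass P n).filter
            fun x' => h (jointEmpDist x' y) ≤ logLik W (jointEmpDist (C m) y)
            then chanProb W (C m) y else 0) := by
      intro C hC
      rw [if_pos fun j _ => Fintype.mem_piFinset.1 hC j]
      rw [mem_region_iff hC]
      split_ifs <;> simp_all
    rw [Finset.sum_congr rfl e3, Finset.sum_sub_distrib, e1, e2, ← Finset.sum_sub_distrib,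
      Finset.mul_sum]
    refine Finset.sum_congr rfl fun x _ => ?_
    rw [card_filter_le_eq hT, mul_pow]
    ring
  simp only [ensembleAvg, errProb]
  rw [← Finset.mul_sum, Finset.sum_comm]
  have e4 : ∀ m : Fin M, ∑ C ∈ Fintype.piFinset (fun _ : Fin M => typeClass P n),
      ∑ y, (if y ∉ region W h C m then chanProb W (C m) y else 0)
      = ∑ y, ((typeClass P n).card : ℝ) ^ (M - 1) * ∑ x ∈ typeClass P n, chanProb W x y *
        (1 - (1 - beatProb P h y (logLik W (jointEmpDist x y))) ^ (M - 1)) := by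
    intro m
    rw [Finset.sum_comm]
    exact Finset.sum_congr rfl fun y _ => key m y
  rw [Finset.sum_congr rfl fun m _ => e4 m, Finset.sum_const, ← Finset.mul_sum, Finset.sum_comm]
  have e5 : ((typeClass P n).card : ℝ) ^ M
      = ((typeClass P n).card : ℝ) ^ (M - 1) * (typeClass P n).card := by
    rw [← pow_succ, Nat.sub_add_cancel hM]
  simp only [Fintype.card_piFinset, Finset.prod_const, Finset.card_univ, Fintype.card_fin,
    Nat.cast_pow, nsmul_eq_mul, e5]
  field_simp

open Classical in
lemma ensembleAvg_listSize (W : X → Y → ℝ) (h : (X × Y → ℝ) → EReal) {P : X → ℝ} {M n : ℕ}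
    (hM : 2 ≤ M) (hT : (typeClass P n).Nonempty) :
    ensembleAvg P M n (fun C => listSize W C (region W h C))
      = (((M : ℝ) - 1) / (typeClass P n).card ^ 2) * ∑ y, ∑ x' ∈ typeClass P n,
        (∑ x ∈ (typeClass P n).filter fun x =>
          h (jointEmpDist x y) ≤ logLik W (jointEmpDist x' y), chanProb W x y) *
        (1 - beatProb P h y (logLik W (jointEmpDist x' y))) ^ (M - 2) := by
  have h0 : ((typeClass P n).card : ℝ) ≠ 0 := by exact_mod_cast hT.card_ne_zero
  have hM0 : (M : ℝ) ≠ 0 := by positivity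
  set E : (Fin n → Y) → ℝ := fun y => ∑ x' ∈ typeClass P n,
        (∑ x ∈ (typeClass P n).filter fun x =>
          h (jointEmpDist x y) ≤ logLik W (jointEmpDist x' y), chanProb W x y) *
        (1 - beatProb P h y (logLik W (jointEmpDist x' y))) ^ (M - 2) with hE
  have key : ∀ (m l : Fin M) (y : Fin n → Y), l ≠ m →
      ∑ C ∈ Fintype.piFinset (fun _ : Fin M => typeClass P n),
        (if y ∈ region W h C l then chanProb W (C m) y else 0)
      = ((typeClass P n).card : ℝ) ^ (M - 2) * E y := by
    intro m l y hlm
    have e1 := sum_piFinset_ite_other (S := typeClass P n) (B := fun x => (typeClass P n).filter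
      fun x' => h (jointEmpDist x' y) ≤ logLik W (jointEmpDist x y))
      (fun x => Finset.filter_subset _ _) hlm (fun x _ => chanProb W x y)
    have e3 : ∀ C ∈ Fintype.piFinset (fun _ : Fin M => typeClass P n),
        (if y ∈ region W h C l then chanProb W (C m) y else 0)
        = (if ∀ j, j ≠ l → C j ∈ (typeClass P n).filter
            fun x' => h (jointEmpDist x' y) ≤ logLik W (jointEmpDist (C l) y)
            then chanProb W (C m) y else 0) := by
      intro C hC
      simp only [mem_region_iff hC]
    rw [Finset.sum_congr rfl e3, e1, hE, Finset.mul_sum]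
    refine Finset.sum_congr rfl fun x _ => ?_
    rw [card_filter_le_eq hT, mul_pow]
    ring
  have e1 : ∀ C : Fin M → Fin n → X, listSize W C (region W h C) =
      ∑ y, (1 / (M : ℝ)) * ∑ m, ∑ l ∈ Finset.univ.erase m,
        (if y ∈ region W h C l then chanProb W (C m) y else 0) := by
    intro C
    unfold listSize
    refine Finset.sum_congr rfl fun y _ => ?_
    congr 1
    refine Finset.sum_congr rfl fun m _ => ?_
    rw [← Finset.sum_filter, Finset.sum_const, nsmul_eq_mul, mul_comm]
    congr 3
    ext l
    simp
  have e2 : ∑ C ∈ Fintype.piFinset (fun _ : Fin M => typeClass P n),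
      listSize W C (region W h C)
      = ∑ y, (1 / (M : ℝ)) * ∑ m : Fin M, ∑ l ∈ Finset.univ.erase m,
        ((typeClass P n).card : ℝ) ^ (M - 2) * E y := by
    rw [Finset.sum_congr rfl fun C _ => e1 C, Finset.sum_comm]
    refine Finset.sum_congr rfl fun y _ => ?_
    rw [← Finset.mul_sum, Finset.sum_comm]
    congr 1
    refine Finset.sum_congr rfl fun m _ => ?_
    rw [Finset.sum_comm]
    exact Finset.sum_congr rfl fun l hl => key m l y (Finset.ne_of_mem_erase hl)
  rw [ensembleAvg, e2]
  have e5 : ((typeClass P n).card : ℝ) ^ M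
      = ((typeClass P n).card : ℝ) ^ (M - 2) * (typeClass P n).card ^ 2 := by
    rw [← pow_add, Nat.sub_add_cancel hM]
  have e6 : ((M - 1 : ℕ) : ℝ) = (M : ℝ) - 1 := by
    rw [Nat.cast_sub (by omega)]; simp
  simp only [Finset.sum_const, Finset.card_erase_of_mem (Finset.mem_univ _), Finset.card_univ,
    Fintype.card_fin, Fintype.card_piFinset, Finset.prod_const, Nat.cast_pow, nsmul_eq_mul, e5, e6,
    ← Finset.mul_sum]
  field_simp

end Ensemble

/-! ### Exponential rates -/

section Rates

lemma eventually_slack_pow_le (A : ℝ) (K : ℕ) {ε : ℝ} (hε : 0 < ε) :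
    ∀ᶠ n : ℕ in atTop, A * slack n ^ K ≤ Real.exp (n * ε) := by
  have h1 := (isLittleO_pow_exp_pos_mul_atTop K hε).comp_tendsto
    (tendsto_atTop_add_const_right atTop (1 : ℝ) tendsto_natCast_atTop_atTop)
  have h2 := h1.bound (c := (|A| * Real.exp 1 ^ K * Real.exp ε + 1)⁻¹) (by positivity)
  filter_upwards [h2] with n hn
  simp only [Function.comp, Real.norm_eq_abs, Real.abs_exp] at hn
  rw [abs_of_nonneg (by positivity), inv_mul_eq_div, le_div_iff₀ (by positivity),
    mul_add, mul_add, Real.exp_add] at hn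
  have hp : 0 ≤ ((n : ℝ) + 1) ^ K := by positivity
  have h3 : ((n : ℝ) + 1) ^ K * (|A| * Real.exp 1 ^ K) * Real.exp ε
      ≤ Real.exp (n * ε) * Real.exp ε := by
    rw [mul_comm (n : ℝ) ε, show ε * 1 = ε from mul_one ε] at *
    nlinarith
  have h4 := le_of_mul_le_mul_right h3 (Real.exp_pos ε)
  refine le_trans ?_ h4
  unfold slack
  rw [mul_pow]
  calc A * (Real.exp 1 ^ K * ((n : ℝ) + 1) ^ K) ≤ |A| * (Real.exp 1 ^ K * ((n : ℝ) + 1) ^ K) := by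
        gcongr; exact le_abs_self A
    _ = _ := by ring

variable {X : Type*} [Fintype X] [DecidableEq X]

lemma eventually_blockLengths (P : X → ℝ) :
    ∀ᶠ n in blockLengths P, (typeClass P n).Nonempty :=
  mem_inf_of_right (mem_principal_self _)

lemma blockLengths_le (P : X → ℝ) : blockLengths P ≤ atTop := inf_le_left

/-- Subexponential factors do not affect lower bounds on exponents. -/
lemma le_liminf_negLogRate {P : X → ℝ} {a : ℕ → ℝ} {F : EReal} (A : ℝ) (K : ℕ)
    (ha : ∀ᶠ n in blockLengths P, 0 ≤ a n)
    (hF : ∀ c : ℝ, (c : EReal) < F →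
      ∀ᶠ n in blockLengths P, a n ≤ A * slack n ^ K * Real.exp (-(n * c))) :
    F ≤ liminf (fun n => negLogRate n (a n)) (blockLengths P) := by
  refine le_of_forall_lt fun b hb => ?_
  obtain ⟨c', hbc', hc'F⟩ := EReal.lt_iff_exists_real_btwn.1 hb
  obtain ⟨c, hcc', hcF⟩ := EReal.lt_iff_exists_real_btwn.1 hc'F
  rw [EReal.coe_lt_coe_iff] at hcc'
  refine hbc'.trans_le (le_liminf_of_le (by isBoundedDefault) ?_)
  filter_upwards [ha, hF c hcF, blockLengths_le P (eventually_gt_atTop 0),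
    blockLengths_le P (eventually_slack_pow_le A K (sub_pos.2 hcc'))] with n h0 h1 hn h2
  unfold negLogRate
  split_ifs with hz
  · exact le_top
  · have hpos : 0 < a n := lt_of_le_of_ne h0 (Ne.symm hz)
    have hn' : (0 : ℝ) < n := by positivity
    rw [EReal.coe_le_coe_iff]
    have h3 : a n ≤ Real.exp (-(n * c')) := by
      calc a n ≤ A * slack n ^ K * Real.exp (-(n * c)) := h1
        _ ≤ Real.exp (n * (c - c')) * Real.exp (-(n * c)) := by gcongr
        _ = _ := by rw [← Real.exp_add]; congr 1; ring
    have h4 := (Real.log_le_iff_le_exp hpos).2 h3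
    rw [neg_mul, one_div, inv_mul_eq_div, le_neg, div_le_iff₀ hn']
    linarith

/-- Subexponential factors do not affect upper bounds on exponents, for which a subsequence of
block lengths suffices. -/
lemma liminf_negLogRate_le {P : X → ℝ} {a : ℕ → ℝ} {v : ℝ} (A : ℝ) (K : ℕ)
    (hv : ∃ᶠ n : ℕ in blockLengths P, Real.exp (-(n * v)) ≤ A * slack n ^ K * a n) (hA : 0 ≤ A) :
    liminf (fun n => negLogRate n (a n)) (blockLengths P) ≤ v := by
  refine EReal.le_of_forall_lt_iff_le.1 fun v' hv' => ?_
  rw [EReal.coe_lt_coe_iff] at hv'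
  refine liminf_le_of_frequently_le ?_ (by isBoundedDefault)
  refine (hv.and_eventually (((eventually_gt_atTop 0).and
    (eventually_slack_pow_le A K (sub_pos.2 hv'))).filter_mono (blockLengths_le P))).mono ?_
  rintro n ⟨h1, hn, h2⟩
  have hn' : (0 : ℝ) < n := by positivity
  have hs := slack_pos n
  have hpos : 0 < a n := by
    by_contra! hle
    have := Real.exp_pos (-(n * v))
    have : A * slack n ^ K * a n ≤ 0 := mul_nonpos_of_nonneg_of_nonpos (by positivity) hle
    linarith
  rw [negLogRate, if_neg hpos.ne', EReal.coe_le_coe_iff]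
  have h3 : Real.exp (-(n * v')) ≤ a n := by
    have : Real.exp (-(n * v)) ≤ Real.exp (n * (v' - v)) * a n := h1.trans (by gcongr)
    have e : Real.exp (-(n * v)) = Real.exp (n * (v' - v)) * Real.exp (-(n * v')) := by
      rw [← Real.exp_add]; congr 1; ring
    rw [e] at this
    exact le_of_mul_le_mul_left this (Real.exp_pos _)
  have h4 := (Real.le_log_iff_exp_le hpos).2 h3
  rw [neg_mul, one_div, inv_mul_eq_div, neg_le, le_div_iff₀ hn']
  linarith

lemma exp_le_numCodewords (R : ℝ) (n : ℕ) : Real.exp (n * R) ≤ numCodewords R n :=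
  Nat.le_ceil _

lemma numCodewords_le {R : ℝ} (hR : 0 < R) (n : ℕ) :
    (numCodewords R n : ℝ) ≤ 2 * Real.exp (n * R) := by
  have h1 := Nat.ceil_lt_add_one (Real.exp_pos (n * R)).le
  have h2 : 1 ≤ Real.exp (n * R) := Real.one_le_exp (by positivity)
  unfold numCodewords
  linarith

lemma two_le_numCodewords {R : ℝ} (hR : 0 < R) {n : ℕ} (hn : 0 < n) :
    2 ≤ numCodewords R n := by
  have h2 : 1 < Real.exp (n * R) := Real.one_lt_exp_iff.2 (by positivity)
  have h3 : (1 : ℝ) < numCodewords R n := h2.trans_le (exp_le_numCodewords R n)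
  exact_mod_cast h3

lemma half_exp_le_numCodewords_sub_one {R : ℝ} (hR : 0 < R) {n : ℕ} (hn : 0 < n) :
    Real.exp (n * R) / 2 ≤ (numCodewords R n : ℝ) - 1 := by
  have h1 := exp_le_numCodewords R n
  have h2 : (2 : ℝ) ≤ numCodewords R n := by exact_mod_cast two_le_numCodewords hR hn
  linarith

/-- The union bound is tight up to a factor two for independent events of probability `p`. -/
lemma half_min_le_one_sub_pow {p : ℝ} (h0 : 0 ≤ p) (h1 : p ≤ 1) (k : ℕ) :
    min 1 (k * p) / 2 ≤ 1 - (1 - p) ^ k := by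
  have hb : 1 + k * p ≤ (1 + p) ^ k := one_add_mul_le_pow (by linarith) k
  have hm : (1 - p) ^ k * (1 + p) ^ k ≤ 1 := by
    rw [← mul_pow]
    exact pow_le_one₀ (by nlinarith) (by nlinarith)
  have hp : 0 ≤ (1 - p) ^ k := pow_nonneg (by linarith) k
  have hu : 0 ≤ k * p := by positivity
  have h3 : (1 - p) ^ k * (1 + k * p) ≤ 1 := by nlinarith
  rcases le_total 1 (k * p) with h | h
  · rw [min_eq_left h]; nlinarith
  · rw [min_eq_right h]; nlinarith

lemma one_sub_pow_le_mul {p : ℝ} (h1 : p ≤ 1) (k : ℕ) :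
    1 - (1 - p) ^ k ≤ k * p := by
  have := one_add_mul_le_pow (a := -p) (by linarith) k
  rw [← sub_eq_add_neg] at this
  linarith

end Rates

/-! ### Threshold functions -/

section Threshold

variable {X Y : Type*} [Fintype X] [Fintype Y]

lemma IsThreshold.ne_bot {h : (X × Y → ℝ) → EReal} (hh : IsThreshold h) {Q : X × Y → ℝ}
    (hQ : Q ∈ stdSimplex ℝ (X × Y)) : h Q ≠ ⊥ := by
  obtain ⟨G, -, -, -, hG, hG'⟩ := hh
  by_cases hQG : Q ∈ G
  · exact (hG Q hQG).1
  · rw [hG' Q hQ hQG]; exact top_ne_bot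

/-- Threshold functions are lower semicontinuous, as the value outside the closed set of
finiteness is `+∞`. -/
lemma IsThreshold.lowerSemicontinuousOn {h : (X × Y → ℝ) → EReal} (hh : IsThreshold h) :
    LowerSemicontinuousOn h (stdSimplex ℝ (X × Y)) := by
  obtain ⟨G, -, hGc, hcont, -, hG'⟩ := hh
  intro Q hQ a ha
  have hcl : IsClosed (G ∩ h ⁻¹' Set.Iic a) :=
    hcont.preimage_isClosed_of_isClosed hGc.isClosed isClosed_Iic
  have hmem : Q ∈ (G ∩ h ⁻¹' Set.Iic a)ᶜ := fun hq => ha.not_ge hq.2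
  filter_upwards [mem_nhdsWithin_of_mem_nhds (hcl.isOpen_compl.mem_nhds hmem),
    self_mem_nhdsWithin] with Q' h1 h2
  by_cases hQG : Q' ∈ G
  · exact not_le.1 fun hle => h1 ⟨hQG, hle⟩
  · rw [hG' Q' h2 hQG]; exact ha.trans_le le_top

lemma IsThreshold.add_const {h : (X × Y → ℝ) → EReal} (hh : IsThreshold h) (t : ℝ) :
    IsThreshold (fun Q => h Q + (t : EReal)) := by
  obtain ⟨G, hGs, hGc, hcont, hG, hG'⟩ := hh
  refine ⟨G, hGs, hGc, ?_, fun Q hQ => ⟨?_, ?_⟩, fun Q hQ hQG => ?_⟩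
  · intro Q hQ
    have h1 := EReal.continuousAt_add (p := (h Q, (t : EReal))) (Or.inr (EReal.coe_ne_bot t))
      (Or.inr (EReal.coe_ne_top t))
    exact ContinuousAt.comp_continuousWithinAt (f := fun Q => (h Q, (t : EReal))) h1
      ((hcont Q hQ).prodMk continuousWithinAt_const)
  · rw [Ne, EReal.add_eq_bot_iff]
    simp [(hG Q hQ).1]
  · exact EReal.add_ne_top (hG Q hQ).2 (EReal.coe_ne_top t)
  · simp [hG' Q hQ hQG]

end Threshold

/-! ### Approximation by rational distributions -/

section Rational

/-- The identity of `ℝ` is a pointwise limit of `ℚ`-linear maps to `ℚ` fixing `1`. Applying such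
maps to the coordinates of a real solution of a system of linear equations and sign conditions
with rational coefficients gives rational solutions converging to it. -/
lemma exists_rat_linearMap_tendsto : ∃ φ : ℕ → ℝ →ₗ[ℚ] ℚ,
    (∀ k, φ k 1 = 1) ∧ ∀ r, Tendsto (fun k => ((φ k r : ℚ) : ℝ)) atTop (𝓝 r) := by
  have hli : LinearIndepOn ℚ id ({1} : Set ℝ) := by
    rw [linearIndepOn_singleton_iff]; exact one_ne_zero
  obtain ⟨ι, b, hb1⟩ : ∃ (ι : Type) (b : Module.Basis ι ℚ ℝ), ∃ i, b i = 1 :=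
    ⟨_, Module.Basis.extend hli, ⟨1, hli.subset_extend (Set.subset_univ _) rfl⟩,
      Module.Basis.extend_apply_self _ _⟩
  refine ⟨fun k => b.constr ℚ fun i => (⌊b i * (k + 1)⌋ : ℚ) / (k + 1), fun k => ?_, fun r => ?_⟩
  · obtain ⟨i, hi⟩ := hb1
    refine (congrArg _ hi.symm).trans ?_
    rw [b.constr_basis, hi, one_mul]
    have : ⌊(k : ℝ) + 1⌋ = (k : ℤ) + 1 := by
      rw [Int.floor_add_one, Int.floor_natCast]
    rw [this]
    push_cast
    exact div_self (by positivity)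
  · have hlim : ∀ i, Tendsto (fun k : ℕ => (((⌊b i * (k + 1)⌋ : ℚ) / (k + 1) : ℚ) : ℝ)) atTop
        (𝓝 (b i)) := by
      intro i
      have h1 : Tendsto (fun k : ℕ => b i - 1 / ((k : ℝ) + 1)) atTop (𝓝 (b i)) := by
        simpa using tendsto_const_nhds.sub (tendsto_one_div_add_atTop_nhds_zero_nat (𝕜 := ℝ))
      refine tendsto_of_tendsto_of_tendsto_of_le_of_le h1 tendsto_const_nhds
        (fun k => ?_) fun k => ?_
      · have h2 := Int.sub_one_lt_floor (b i * ((k : ℝ) + 1))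
        have h3 : (0 : ℝ) < (k : ℝ) + 1 := by positivity
        simp only
        push_cast
        rw [le_div_iff₀ h3, sub_mul, one_div, inv_mul_cancel₀ h3.ne']
        exact h2.le
      · have h2 := Int.floor_le (b i * ((k : ℝ) + 1))
        have h3 : (0 : ℝ) < (k : ℝ) + 1 := by positivity
        simp only
        push_cast
        rwa [div_le_iff₀ h3]
    have hr := b.linearCombination_repr r
    have h4 : ∀ k : ℕ, ((b.constr ℚ (fun i => (⌊b i * (k + 1)⌋ : ℚ) / (k + 1)) r : ℚ) : ℝ)
        = ∑ i ∈ (b.repr r).support, ((b.repr r i : ℚ) : ℝ) *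
          (((⌊b i * (k + 1)⌋ : ℚ) / (k + 1) : ℚ) : ℝ) := by
      intro k
      rw [b.constr_apply, Finsupp.sum]
      push_cast
      simp [smul_eq_mul]
    have h5 : r = ∑ i ∈ (b.repr r).support, ((b.repr r i : ℚ) : ℝ) * b i := by
      conv_lhs => rw [← hr, Finsupp.linearCombination_apply, Finsupp.sum]
      exact Finset.sum_congr rfl fun i _ => Rat.smul_def _ _
    simp only [h4]
    conv => rhs; rw [h5]
    exact tendsto_finsetSum _ fun i _ => (hlim i).const_mul _

variable {X Y : Type*} [Fintype X] [Fintype Y]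

/-- All values of `Q` are multiples of `1 / N`. -/
def HasDenominator {A : Type*} (N : ℕ) (Q : A → ℝ) : Prop := ∀ a, ∃ j : ℕ, Q a = (j : ℝ) / N

lemma HasDenominator.mul {A : Type*} {N : ℕ} {Q : A → ℝ} (hQ : HasDenominator N Q) {k : ℕ}
    (hk : 0 < k) : HasDenominator (k * N) Q := by
  intro a
  obtain ⟨j, hj⟩ := hQ a
  refine ⟨k * j, ?_⟩
  have : (k : ℝ) ≠ 0 := by positivity
  rw [hj]
  push_cast
  rw [mul_div_mul_left _ _ this]

lemma exists_hasDenominator {A : Type*} [Fintype A] {q : A → ℚ} (hq : ∀ a, 0 ≤ q a) :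
    ∃ N, 0 < N ∧ HasDenominator N (fun a => (q a : ℝ)) := by
  refine ⟨∏ a, (q a).den, Finset.prod_pos fun a _ => (q a).den_pos, fun a => ?_⟩
  obtain ⟨k, hk⟩ := Finset.dvd_prod_of_mem (fun a => (q a).den) (Finset.mem_univ a)
  have hk0 : k ≠ 0 := by
    rintro rfl
    exact (Finset.prod_pos fun a (_ : a ∈ Finset.univ) => (q a).den_pos).ne' (by simpa using hk)
  refine ⟨(q a).num.toNat * k, ?_⟩
  have h1 : ((q a).num.toNat : ℝ) = (q a).num := by
    have := Int.toNat_of_nonneg (Rat.num_nonneg.2 (hq a))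
    rw [← Int.cast_natCast, this]
  have h2 : ((q a : ℚ) : ℝ) = (q a).num / (q a).den := Rat.cast_def (q a)
  have h3 : (k : ℝ) ≠ 0 := by exact_mod_cast hk0
  change ((q a : ℚ) : ℝ) = _
  rw [hk, h2, Nat.cast_mul, Nat.cast_mul, h1, mul_div_mul_right _ _ h3]

/-- A pair of joint distributions with `X`-marginal `P` and equal `Y`-marginals is a limit of such
pairs with rational values and no larger supports. -/
lemma exists_rational_approx {P : X → ℝ} (hP : ∃ q : X → ℚ, P = fun x => (q x : ℝ))
    {Q₁ Q₂ : X × Y → ℝ} (h₁ : Q₁ ∈ jointWith P) (h₂ : Q₂ ∈ jointWith P)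
    (hY : margY Q₂ = margY Q₁) :
    ∃ S₁ S₂ : ℕ → X × Y → ℝ, Tendsto S₁ atTop (𝓝[jointWith P] Q₁) ∧
      Tendsto S₂ atTop (𝓝[jointWith P] Q₂) ∧ (∀ k, margY (S₂ k) = margY (S₁ k)) ∧
      (∀ k a, Q₁ a = 0 → S₁ k a = 0) ∧ (∀ k a, Q₂ a = 0 → S₂ k a = 0) ∧
      ∀ᶠ k in atTop, ∃ N, 0 < N ∧ HasDenominator N (S₁ k) ∧ HasDenominator N (S₂ k) := by
  obtain ⟨q, rfl⟩ := hP
  obtain ⟨φ, hφ1, hφ⟩ := exists_rat_linearMap_tendsto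
  have hφq : ∀ k (r : ℚ), φ k (r : ℝ) = r := by
    intro k r
    have := (φ k).map_smul r 1
    rwa [Rat.smul_def, mul_one, hφ1, smul_eq_mul, mul_one] at this
  have hlim : ∀ Q : X × Y → ℝ, Tendsto (fun k a => ((φ k (Q a) : ℚ) : ℝ)) atTop (𝓝 Q) :=
    fun Q => tendsto_pi_nhds.2 fun a => hφ (Q a)
  have hnn : ∀ Q : X × Y → ℝ, (∀ a, 0 ≤ Q a) → ∀ᶠ k in atTop, ∀ a, 0 ≤ φ k (Q a) := by
    intro Q hQ
    refine eventually_all.2 fun a => ?_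
    rcases (hQ a).eq_or_lt with h0 | h0
    · exact Eventually.of_forall fun k => by rw [← h0, map_zero]
    · filter_upwards [(hφ (Q a)).eventually_const_lt h0] with k hk
      exact_mod_cast hk.le
  have hmem : ∀ Q : X × Y → ℝ, Q ∈ jointWith (fun x => (q x : ℝ)) →
      ∀ᶠ k in atTop, (fun a => ((φ k (Q a) : ℚ) : ℝ)) ∈ jointWith (fun x => (q x : ℝ)) := by
    intro Q hQ
    filter_upwards [hnn Q hQ.1.1] with k hk
    refine ⟨⟨fun a => Rat.cast_nonneg.2 (hk a), ?_⟩, ?_⟩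
    · rw [← Rat.cast_sum, ← map_sum, hQ.1.2, hφ1, Rat.cast_one]
    · funext x
      have := congrFun hQ.2 x
      simp only [margX] at this ⊢
      rw [← Rat.cast_sum, ← map_sum, this, hφq]
  refine ⟨fun k a => φ k (Q₁ a), fun k a => φ k (Q₂ a),
    tendsto_nhdsWithin_iff.2 ⟨hlim Q₁, hmem Q₁ h₁⟩, tendsto_nhdsWithin_iff.2 ⟨hlim Q₂, hmem Q₂ h₂⟩,
    fun k => ?_, fun k a h0 => by simp [h0], fun k a h0 => by simp [h0], ?_⟩
  · funext y
    have := congrFun hY y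
    simp only [margY] at this ⊢
    rw [← Rat.cast_sum, ← map_sum, this, map_sum, Rat.cast_sum]
  · filter_upwards [hnn Q₁ h₁.1.1, hnn Q₂ h₂.1.1] with k hk1 hk2
    obtain ⟨N₁, hN₁, hd₁⟩ := exists_hasDenominator hk1
    obtain ⟨N₂, hN₂, hd₂⟩ := exists_hasDenominator hk2
    exact ⟨N₂ * N₁, Nat.mul_pos hN₂ hN₁, hd₁.mul hN₂, mul_comm N₁ N₂ ▸ hd₂.mul hN₁⟩

variable [DecidableEq X] [DecidableEq Y]

lemma exists_rat_of_typeClass_nonempty {P : X → ℝ}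
    (hP : ∃ k : ℕ, 0 < k ∧ (typeClass P k).Nonempty) : ∃ q : X → ℚ, P = fun x => (q x : ℝ) := by
  obtain ⟨k, -, x, hx⟩ := hP
  rw [mem_typeClass] at hx
  refine ⟨fun a => ((Finset.univ.filter fun i => x i = a).card : ℚ) / k, ?_⟩
  rw [← hx]
  funext a
  simp [empDist]

lemma exists_jointEmpDist_eq {P : X → ℝ} {Q : X × Y → ℝ} (hQ : Q ∈ jointWith P) {n : ℕ}
    (hn : 0 < n) (hd : HasDenominator n Q) :
    ∃ (x : Fin n → X) (y : Fin n → Y), jointEmpDist x y = Q := by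
  choose c hc using hd
  have hn' : (n : ℝ) ≠ 0 := by positivity
  have hsum : ∑ a, c a = n := by
    have h1 := hQ.1.2
    simp only [hc] at h1
    rw [← Finset.sum_div, div_eq_one_iff_eq hn'] at h1
    exact_mod_cast h1
  obtain ⟨z, hz⟩ := exists_empDist_eq c hsum
  exact ⟨fun i => (z i).1, fun i => (z i).2, hz.trans (funext fun a => (hc a).symm)⟩

/-- Rational joint distributions are joint types for infinitely many block lengths. -/
lemma frequently_exists_jointEmpDist_eq {P : X → ℝ} {Q₁ Q₂ : X × Y → ℝ} (h₁ : Q₁ ∈ jointWith P)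
    (h₂ : Q₂ ∈ jointWith P) {N : ℕ} (hN : 0 < N) (hd₁ : HasDenominator N Q₁)
    (hd₂ : HasDenominator N Q₂) :
    ∃ᶠ n in blockLengths P, (∃ (x : Fin n → X) (y : Fin n → Y), jointEmpDist x y = Q₁) ∧
      ∃ (x : Fin n → X) (y : Fin n → Y), jointEmpDist x y = Q₂ := by
  rw [blockLengths, frequently_inf_principal, frequently_atTop]
  intro n₀
  have hk : 0 < n₀ + 1 := n₀.succ_pos
  refine ⟨(n₀ + 1) * N, by nlinarith, ?_⟩
  have hn : 0 < (n₀ + 1) * N := Nat.mul_pos hk hN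
  have e₁ := exists_jointEmpDist_eq h₁ hn (hd₁.mul hk)
  refine ⟨?_, e₁, exists_jointEmpDist_eq h₂ hn (hd₂.mul hk)⟩
  obtain ⟨x, y, hxy⟩ := e₁
  exact ⟨x, mem_typeClass.2 (by rw [← margX_jointEmpDist x y, hxy, h₁.2])⟩

end Rational

/-! ### The error exponent -/

section Error

variable {X Y : Type*} [Fintype X] [Fintype Y] [DecidableEq X] [DecidableEq Y]

lemma beatProb_le_of_forall_le {P : X → ℝ} {n : ℕ} (hn : 0 < n) (hT : (typeClass P n).Nonempty)
    {h : (X × Y → ℝ) → EReal} {y : Fin n → Y} {s : EReal} {r : ℝ}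
    (hr : ∀ x ∈ typeClass P n, s < h (jointEmpDist x y) → r ≤ mutualInfo (jointEmpDist x y)) :
    beatProb P h y s ≤ slack n ^ slackDegree X Y * Real.exp (-(n * r)) := by
  classical
  have hT0 : (0 : ℝ) < (typeClass P n).card := by exact_mod_cast hT.card_pos
  unfold beatProb
  rw [div_le_iff₀ hT0]
  have h1 : (((typeClass P n).filter fun x => s < h (jointEmpDist x y)).card : ℝ) * Real.exp (n * r)
      ≤ ∑ x ∈ typeClass P n, Real.exp (n * mutualInfo (jointEmpDist x y)) := by
    rw [← nsmul_eq_mul]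
    refine (Finset.card_nsmul_le_sum _ (fun x => Real.exp (n * mutualInfo (jointEmpDist x y)))
      _ fun x hx => ?_).trans (Finset.sum_le_sum_of_subset_of_nonneg (Finset.filter_subset _ _)
      fun _ _ _ => (Real.exp_pos _).le)
    rw [Finset.mem_filter] at hx
    have := hr x hx.1 hx.2
    gcongr
  have h2 := h1.trans (sum_exp_mutualInfo_le hn hT y)
  rw [Real.exp_neg, mul_right_comm, ← div_eq_mul_inv, le_div_iff₀ (Real.exp_pos _)]
  exact h2

lemma exp_neg_mutualInfo_le_beatProb {P : X → ℝ} {n : ℕ} (hn : 0 < n)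
    {h : (X × Y → ℝ) → EReal} {y : Fin n → Y} {s : EReal} {x₀ : Fin n → X} {y₀ : Fin n → Y}
    (hx₀ : x₀ ∈ typeClass P n) (hy : empDist y = empDist y₀) (hs : s < h (jointEmpDist x₀ y₀)) :
    Real.exp (-(n * mutualInfo (jointEmpDist x₀ y₀))) ≤
      slack n ^ slackDegree X Y * beatProb P h y s := by
  classical
  have hT0 : (0 : ℝ) < (typeClass P n).card := by exact_mod_cast Finset.card_pos.2 ⟨x₀, hx₀⟩
  have h1 := exp_neg_mutualInfo_le hn (x₀ := x₀) hy
  rw [mem_typeClass.1 hx₀] at h1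
  unfold beatProb
  rw [← mul_div_assoc, le_div_iff₀ hT0]
  refine h1.trans ?_
  have := slack_pos n
  gcongr with x hx
  intro hxy
  rwa [hxy]

/-- The random coding bound at a fixed block length. -/
lemma ensembleAvg_errProb_le {W : X → Y → ℝ} (hW : IsChannel W) {P : X → ℝ} {R : ℝ} (hR : 0 < R)
    {h : (X × Y → ℝ) → EReal} {n : ℕ} (hn : 0 < n) (hT : (typeClass P n).Nonempty) {c : ℝ}
    (hc : ∀ Qt ∈ jointWith P, IsSupported W Qt → ∀ Q ∈ jointWith P, margY Q = margY Qt →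
      logLik W Qt < h Q → c ≤ realCondDiv W Qt + max (mutualInfo Q - R) 0) :
    ensembleAvg P (numCodewords R n) n (fun C => errProb W C (region W h C))
      ≤ 2 * slack n ^ (slackDegree X Y + slackDegree X Y) * Real.exp (-(n * c)) := by
  have hT0 : (0 : ℝ) < (typeClass P n).card := by exact_mod_cast hT.card_pos
  have hs := slack_pos n
  have hs1 : 1 ≤ slack n ^ slackDegree X Y := one_le_pow₀ (one_le_slack n)
  set M := numCodewords R n with hM
  have hM2 : 2 ≤ M := two_le_numCodewords hR hn
  rw [ensembleAvg_errProb W h (by omega) hT]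
  have hpt : ∀ x ∈ typeClass P n, ∀ y : Fin n → Y, chanProb W x y *
      (1 - (1 - beatProb P h y (logLik W (jointEmpDist x y))) ^ (M - 1))
      ≤ 2 * slack n ^ slackDegree X Y * Real.exp (-(n * c)) *
        (chanProb W x y * Real.exp (n * realCondDiv W (jointEmpDist x y))) := by
    intro x hx y
    by_cases h0 : chanProb W x y = 0
    · simp [h0]
    have hsupp := isSupported_of_chanProb_ne_zero h0
    set Qt := jointEmpDist x y with hQt
    have hQtP : Qt ∈ jointWith P := jointEmpDist_mem_jointWith hn hx y
    set p := beatProb P h y (logLik W Qt) with hp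
    have hp0 : 0 ≤ p := beatProb_nonneg _ _ _ _
    have hp1 : p ≤ 1 := beatProb_le_one _ _ _ _
    have hmain : 1 - (1 - p) ^ (M - 1) ≤ 2 * slack n ^ slackDegree X Y *
        Real.exp (n * (realCondDiv W Qt - c)) := by
      -- if `c ≤ D` the trivial bound `1` suffices
      rcases le_or_gt c (realCondDiv W Qt) with hcD | hcD
      · have h1 : 0 ≤ (1 - p) ^ (M - 1) := pow_nonneg (by linarith) _
        have h2 : 1 ≤ Real.exp (n * (realCondDiv W Qt - c)) :=
          Real.one_le_exp (mul_nonneg (by positivity) (by linarith))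
        nlinarith
      · -- here every competing joint type has `I - R ≥ c - D`
        have h1 : p ≤ slack n ^ slackDegree X Y *
            Real.exp (-(n * (R + (c - realCondDiv W Qt)))) := by
          refine beatProb_le_of_forall_le hn hT fun x' hx' hlt' => ?_
          have h3 := hc Qt hQtP hsupp _ (jointEmpDist_mem_jointWith hn hx' y)
            (by rw [hQt, margY_jointEmpDist, margY_jointEmpDist]) hlt'
          rcases max_choice (mutualInfo (jointEmpDist x' y) - R) 0 with h4 | h4 <;>
            rw [h4] at h3 <;> linarith
        have h2 : ((M - 1 : ℕ) : ℝ) ≤ 2 * Real.exp (n * R) :=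
          le_trans (by exact_mod_cast Nat.sub_le M 1) (numCodewords_le hR n)
        calc 1 - (1 - p) ^ (M - 1) ≤ ((M - 1 : ℕ) : ℝ) * p := one_sub_pow_le_mul hp1 _
          _ ≤ (2 * Real.exp (n * R)) * (slack n ^ slackDegree X Y *
            Real.exp (-(n * (R + (c - realCondDiv W Qt))))) := by gcongr
          _ = 2 * slack n ^ slackDegree X Y *
            (Real.exp (n * R) * Real.exp (-(n * (R + (c - realCondDiv W Qt))))) := by ring
          _ = _ := by rw [← Real.exp_add]; congr 2; ring
    have hcp := chanProb_nonneg hW x y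
    calc chanProb W x y * (1 - (1 - p) ^ (M - 1))
        ≤ chanProb W x y * (2 * slack n ^ slackDegree X Y *
          Real.exp (n * (realCondDiv W Qt - c))) := by gcongr
      _ = 2 * slack n ^ slackDegree X Y * chanProb W x y *
          Real.exp (n * (realCondDiv W Qt - c)) := by ring
      _ = 2 * slack n ^ slackDegree X Y * chanProb W x y *
          (Real.exp (-(n * c)) * Real.exp (n * realCondDiv W Qt)) := by
          rw [← Real.exp_add]; congr 2; ring
      _ = _ := by ring
  calc (1 / ((typeClass P n).card : ℝ)) * ∑ x ∈ typeClass P n, ∑ y, chanProb W x y *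
        (1 - (1 - beatProb P h y (logLik W (jointEmpDist x y))) ^ (M - 1))
      ≤ (1 / ((typeClass P n).card : ℝ)) * ∑ x ∈ typeClass P n, ∑ y : Fin n → Y,
        2 * slack n ^ slackDegree X Y * Real.exp (-(n * c)) *
        (chanProb W x y * Real.exp (n * realCondDiv W (jointEmpDist x y))) := by
        refine mul_le_mul_of_nonneg_left (Finset.sum_le_sum fun x hx =>
          Finset.sum_le_sum fun y _ => hpt x hx y) (by positivity)
    _ = (1 / ((typeClass P n).card : ℝ)) * (2 * slack n ^ slackDegree X Y * Real.exp (-(n * c))) *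
        ∑ x ∈ typeClass P n, ∑ y : Fin n → Y,
        (chanProb W x y * Real.exp (n * realCondDiv W (jointEmpDist x y))) := by
        simp only [Finset.mul_sum, mul_assoc]
    _ ≤ (1 / ((typeClass P n).card : ℝ)) * (2 * slack n ^ slackDegree X Y * Real.exp (-(n * c))) *
        (slack n ^ slackDegree X Y * (typeClass P n).card) := by
        gcongr
        exact sum_chanProb_mul_exp_le hW hn hT
    _ = _ := by rw [pow_add]; field_simp

lemma errFormulaStrict_le_errExponent {W : X → Y → ℝ} (hW : IsChannel W) {P : X → ℝ} {R : ℝ}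
    (hR : 0 < R) (h : (X × Y → ℝ) → EReal) :
    errFormulaStrict W P R h ≤ errExponent W P R h := by
  refine le_liminf_negLogRate 2 (slackDegree X Y + slackDegree X Y) ?_ fun c hc => ?_
  · refine Eventually.of_forall fun n =>
      div_nonneg (Finset.sum_nonneg fun C _ => ?_) (by positivity)
    refine mul_nonneg (by positivity) (Finset.sum_nonneg fun m _ => Finset.sum_nonneg fun y _ => ?_)
    split_ifs
    · exact le_rfl
    · exact chanProb_nonneg hW _ _
  · filter_upwards [eventually_blockLengths P,
      blockLengths_le P (eventually_gt_atTop 0)] with n hT hn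
    refine ensembleAvg_errProb_le hW hR hn hT fun Qt hQt hsupp Q hQ hY hlt => ?_
    have h1 : (c : EReal) ≤ condDiv W Qt + ((max (mutualInfo Q - R) 0 : ℝ) : EReal) :=
      hc.le.trans (iInf₂_le_of_le Qt hQt (iInf₂_le Q ⟨hQ, hY, hlt⟩))
    rw [condDiv_of_isSupported (nonneg_of_mem_jointWith hQt) hsupp, ← EReal.coe_add,
      EReal.coe_le_coe_iff] at h1
    exact h1

lemma errFormula_le_errFormulaStrict (W : X → Y → ℝ) (P : X → ℝ) (R : ℝ)
    (h : (X × Y → ℝ) → EReal) : errFormula W P R h ≤ errFormulaStrict W P R h :=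
  iInf₂_mono fun _ _ => iInf_le_iInf_of_subset fun _ hQ => ⟨hQ.1, hQ.2.1, hQ.2.2.le⟩

/-- A single pair of joint types bounds the error probability from below. -/
lemma le_ensembleAvg_errProb {W : X → Y → ℝ} (hW : IsChannel W) {P : X → ℝ} {R : ℝ} (hR : 0 < R)
    {h : (X × Y → ℝ) → EReal} {n : ℕ} (hn : 0 < n) {x₁ x₂ : Fin n → X} {y₁ y₂ : Fin n → Y}
    (hx₁ : x₁ ∈ typeClass P n) (hx₂ : x₂ ∈ typeClass P n) (hy : empDist y₂ = empDist y₁)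
    (hsupp : IsSupported W (jointEmpDist x₁ y₁))
    (hlt : logLik W (jointEmpDist x₁ y₁) < h (jointEmpDist x₂ y₂)) :
    Real.exp (-(n * (realCondDiv W (jointEmpDist x₁ y₁) +
        max (mutualInfo (jointEmpDist x₂ y₂) - R) 0)))
      ≤ 4 * slack n ^ (slackDegree X Y + slackDegree X Y) *
        ensembleAvg P (numCodewords R n) n (fun C => errProb W C (region W h C)) := by
  classical
  have hT : (typeClass P n).Nonempty := ⟨x₁, hx₁⟩
  have hT0 : (0 : ℝ) < (typeClass P n).card := by exact_mod_cast hT.card_pos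
  set s := slack n ^ slackDegree X Y with hsdef
  have hs1 : 1 ≤ s := one_le_pow₀ (one_le_slack n)
  have hs : 0 < s := by linarith
  set M := numCodewords R n with hM
  have hM2 : 2 ≤ M := two_le_numCodewords hR hn
  set Q₁ := jointEmpDist x₁ y₁ with hQ₁
  set Q₂ := jointEmpDist x₂ y₂ with hQ₂
  set e := Real.exp (-(n * max (mutualInfo Q₂ - R) 0)) with he
  have he1 : e ≤ 1 := Real.exp_le_one_iff.2 (neg_nonpos.2 (by positivity))
  rw [ensembleAvg_errProb W h (by omega) hT]
  have hpt : ∀ x ∈ typeClass P n, ∀ y : Fin n → Y,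
      (if jointEmpDist x y = Q₁ then chanProb W x y else 0) * e ≤ 4 * s * (chanProb W x y *
      (1 - (1 - beatProb P h y (logLik W (jointEmpDist x y))) ^ (M - 1))) := by
    intro x hx y
    have hcp := chanProb_nonneg hW x y
    have hp0 := beatProb_nonneg P h y (logLik W (jointEmpDist x y))
    have hp1 := beatProb_le_one P h y (logLik W (jointEmpDist x y))
    have hge := half_min_le_one_sub_pow hp0 hp1 (M - 1)
    split_ifs with hxy
    · have hyy : empDist y = empDist y₂ := by
        rw [hy, ← margY_jointEmpDist x y, hxy, hQ₁, margY_jointEmpDist]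
      have h1 := exp_neg_mutualInfo_le_beatProb (P := P) hn (h := h) hx₂ hyy (hxy ▸ hlt)
      rw [← hQ₂] at h1
      set p := beatProb P h y (logLik W (jointEmpDist x y))
      have h2 : Real.exp (n * R) / 2 ≤ ((M - 1 : ℕ) : ℝ) := by
        rw [Nat.cast_sub (by omega), Nat.cast_one]
        exact half_exp_le_numCodewords_sub_one hR hn
      have h3 : e ≤ 2 * s * min 1 (((M - 1 : ℕ) : ℝ) * p) := by
        rcases min_choice (1 : ℝ) (((M - 1 : ℕ) : ℝ) * p) with h4 | h4
        · rw [h4]; linarith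
        · rw [h4]
          calc e ≤ Real.exp (-(n * (mutualInfo Q₂ - R))) := by
                rw [he]; gcongr; exact le_max_left _ _
            _ = Real.exp (n * R) * Real.exp (-(n * mutualInfo Q₂)) := by
                rw [← Real.exp_add]; congr 1; ring
            _ ≤ (2 * ((M - 1 : ℕ) : ℝ)) * (s * p) := by gcongr; linarith
            _ = _ := by ring
      calc chanProb W x y * e
          ≤ chanProb W x y * (2 * s * min 1 (((M - 1 : ℕ) : ℝ) * p)) := by gcongr
        _ = 4 * s * (chanProb W x y * (min 1 (((M - 1 : ℕ) : ℝ) * p) / 2)) := by ring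
        _ ≤ _ := by gcongr
    · rw [zero_mul]
      have : 0 ≤ min 1 (((M - 1 : ℕ) : ℝ) * beatProb P h y (logLik W (jointEmpDist x y))) := by
        positivity
      have : 0 ≤ (1 - (1 - beatProb P h y (logLik W (jointEmpDist x y))) ^ (M - 1)) := by linarith
      positivity
  have hD := exp_neg_realCondDiv_le hW hn hsupp
  rw [← hQ₁, mem_typeClass.1 hx₁, ← hsdef] at hD
  have hsum : (∑ x ∈ typeClass P n, ∑ y : Fin n → Y,
      if jointEmpDist x y = Q₁ then chanProb W x y else 0) * e
      ≤ 4 * s * ∑ x ∈ typeClass P n, ∑ y, chanProb W x y *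
        (1 - (1 - beatProb P h y (logLik W (jointEmpDist x y))) ^ (M - 1)) := by
    simp only [Finset.sum_mul, Finset.mul_sum]
    exact Finset.sum_le_sum fun x hx => Finset.sum_le_sum fun y _ => by
      simpa only [Finset.mul_sum] using hpt x hx y
  have e1 : Real.exp (-(n * (realCondDiv W Q₁ + max (mutualInfo Q₂ - R) 0)))
      = Real.exp (-(n * realCondDiv W Q₁)) * e := by
    rw [he, ← Real.exp_add]; congr 1; ring
  rw [e1, pow_add, ← hsdef]
  refine le_of_mul_le_mul_right ?_ hT0
  calc Real.exp (-(n * realCondDiv W Q₁)) * e * (typeClass P n).card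
      = (Real.exp (-(n * realCondDiv W Q₁)) * (typeClass P n).card) * e := by ring
    _ ≤ (s * ∑ x ∈ typeClass P n, ∑ y : Fin n → Y,
        if jointEmpDist x y = Q₁ then chanProb W x y else 0) * e := by
        have : 0 < e := Real.exp_pos _
        gcongr
    _ = s * ((∑ x ∈ typeClass P n, ∑ y : Fin n → Y,
        if jointEmpDist x y = Q₁ then chanProb W x y else 0) * e) := by ring
    _ ≤ s * (4 * s * ∑ x ∈ typeClass P n, ∑ y, chanProb W x y *
        (1 - (1 - beatProb P h y (logLik W (jointEmpDist x y))) ^ (M - 1))) := by gcongr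
    _ = _ := by field_simp

lemma errExponent_le_errFormulaStrict {W : X → Y → ℝ} (hW : IsChannel W) {P : X → ℝ}
    (hP : ∃ q : X → ℚ, P = fun x => (q x : ℝ)) {R : ℝ} (hR : 0 < R) {h : (X × Y → ℝ) → EReal}
    (hh : IsThreshold h) : errExponent W P R h ≤ errFormulaStrict W P R h := by
  refine le_iInf₂ fun Qt hQt => le_iInf₂ fun Q hQ => ?_
  obtain ⟨hQP, hY, hlt⟩ := hQ
  by_cases hsupp : IsSupported W Qt
  swap
  · rw [condDiv_of_not_isSupported hsupp, EReal.top_add_coe]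
    exact le_top
  rw [condDiv_of_isSupported (nonneg_of_mem_jointWith hQt) hsupp, ← EReal.coe_add]
  refine EReal.le_of_forall_lt_iff_le.1 fun v hv => ?_
  rw [EReal.coe_lt_coe_iff] at hv
  obtain ⟨S₁, S₂, hS₁, hS₂, hSY, hz₁, -, hden⟩ := exists_rational_approx hP hQt hQP hY
  have hsupp' : ∀ k, IsSupported W (S₁ k) := fun k x y hxy => hz₁ k _ (hsupp x y hxy)
  have hv' : ∀ᶠ k in atTop, realCondDiv W (S₁ k) + max (mutualInfo (S₂ k) - R) 0 < v := by
    have h1 : Tendsto (fun k => realCondDiv W (S₁ k)) atTop (𝓝 (realCondDiv W Qt)) :=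
      ((continuous_realCondDiv W).tendsto Qt).comp (hS₁.mono_right nhdsWithin_le_nhds)
    have h2 : Tendsto (fun k => mutualInfo (S₂ k)) atTop (𝓝 (mutualInfo Q)) :=
      (continuousOn_mutualInfo P Q hQP).tendsto.comp hS₂
    exact (h1.add ((h2.sub_const R).max tendsto_const_nhds)).eventually_lt_const hv
  have hlt' : ∀ᶠ k in atTop, logLik W (S₁ k) < h (S₂ k) := by
    rw [logLik_of_isSupported hsupp] at hlt
    obtain ⟨a, ha1, ha2⟩ := EReal.lt_iff_exists_real_btwn.1 hlt
    rw [EReal.coe_lt_coe_iff] at ha1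
    have h1 : Tendsto (fun k => realLogLik W (S₁ k)) atTop (𝓝 (realLogLik W Qt)) :=
      ((continuous_realLogLik W).tendsto Qt).comp (hS₁.mono_right nhdsWithin_le_nhds)
    have h2 := (hS₂.mono_right (nhdsWithin_mono _ fun Q hQ => hQ.1)).eventually
      (hh.lowerSemicontinuousOn Q hQP.1 a ha2)
    filter_upwards [h1.eventually_lt_const ha1, h2] with k hk1 hk2
    rw [logLik_of_isSupported (hsupp' k)]
    exact (EReal.coe_lt_coe_iff.2 hk1).trans hk2
  obtain ⟨k, hk1, hk2, ⟨N, hN, hd₁, hd₂⟩, hm₁, hm₂⟩ := (hv'.and (hlt'.and (hden.and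
    ((hS₁.eventually self_mem_nhdsWithin).and (hS₂.eventually self_mem_nhdsWithin))))).exists
  refine le_trans ?_ (EReal.coe_le_coe_iff.2 hk1.le)
  refine liminf_negLogRate_le 4 (slackDegree X Y + slackDegree X Y) ?_ (by norm_num)
  refine ((frequently_exists_jointEmpDist_eq hm₁ hm₂ hN hd₁ hd₂).and_eventually
    ((eventually_gt_atTop 0).filter_mono (blockLengths_le P))).mono ?_
  rintro n ⟨⟨⟨x₁, y₁, e₁⟩, x₂, y₂, e₂⟩, hn⟩
  rw [← e₁, ← e₂]
  refine le_ensembleAvg_errProb hW hR hn ?_ ?_ ?_ (e₁ ▸ hsupp' k) (by rw [e₁, e₂]; exact hk2)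
  · rw [mem_typeClass, ← margX_jointEmpDist x₁ y₁, e₁, hm₁.2]
  · rw [mem_typeClass, ← margX_jointEmpDist x₂ y₂, e₂, hm₂.2]
  · rw [← margY_jointEmpDist x₂ y₂, ← margY_jointEmpDist x₁ y₁, e₁, e₂, hSY]

end Error

/-! ### Rounding to joint types with prescribed marginals -/

section Rounding

variable {X Y : Type*} [Fintype X] [Fintype Y]

lemma sum_marg_eq_one {P : X → ℝ} {Q : X × Y → ℝ} (hQ : Q ∈ jointWith P) :
    ∑ x, P x = 1 ∧ ∑ y, margY Q y = 1 := by
  constructor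
  · rw [← hQ.2, ← hQ.1.2, Fintype.sum_prod_type]; rfl
  · rw [← hQ.1.2, Fintype.sum_prod_type_right]; rfl

lemma hasDenominator_of_int {A : Type*} {n : ℕ} (hn : 0 < n) {Q : A → ℝ} (h0 : ∀ a, 0 ≤ Q a)
    (h : ∀ a, ∃ j : ℤ, n * Q a = j) : HasDenominator n Q := by
  intro a
  obtain ⟨j, hj⟩ := h a
  have hn' : (0 : ℝ) < n := by positivity
  have hj0 : 0 ≤ j := by
    have : (0 : ℝ) ≤ j := hj ▸ mul_nonneg hn'.le (h0 a)
    exact_mod_cast this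
  lift j to ℕ using hj0
  refine ⟨j, ?_⟩
  rw [eq_div_iff hn'.ne', mul_comm, hj]
  simp

/-- Let `Q` be positive on the product of the supports of its marginals `P` and `q`, let `P` be
an `n`-type for all `n` considered, and let the `n`-types `q n` converge to `q`. Then there are
joint `n`-types with marginals `P` and `q n` converging to `Q`. -/
lemma exists_hasDenominator_tendsto {l : Filter ℕ} (hl : l ≤ atTop) {P : X → ℝ} {Q : X × Y → ℝ}
    (hQ : Q ∈ jointWith P) (hpos : ∀ x y, P x ≠ 0 → margY Q y ≠ 0 → Q (x, y) ≠ 0)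
    (hPd : ∀ᶠ n in l, HasDenominator n P) {q : ℕ → Y → ℝ} (hq : Tendsto q l (𝓝 (margY Q)))
    (hqd : ∀ᶠ n in l, HasDenominator n (q n) ∧ ∑ y, q n y = 1) :
    ∃ S : ℕ → X × Y → ℝ, Tendsto S l (𝓝 Q) ∧
      ∀ᶠ n in l, S n ∈ jointWith P ∧ margY (S n) = q n ∧ HasDenominator n (S n) := by
  classical
  obtain ⟨hP1, hY1⟩ := sum_marg_eq_one hQ
  obtain ⟨x₀, -, hx₀⟩ : ∃ x ∈ Finset.univ, P x ≠ 0 :=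
    Finset.exists_ne_zero_of_sum_ne_zero (by rw [hP1]; exact one_ne_zero)
  obtain ⟨y₀, -, hy₀⟩ : ∃ y ∈ Finset.univ, margY Q y ≠ 0 :=
    Finset.exists_ne_zero_of_sum_ne_zero (by rw [hY1]; exact one_ne_zero)
  -- Round down off the row `x₀` and the column `y₀`, then fill in the column, then the row.
  let u : ℕ → X → Y → ℝ := fun n x y => (⌊n * Q (x, y)⌋₊ : ℝ) / n
  let v : ℕ → X → Y → ℝ := fun n x y =>
    if y = y₀ then P x - ∑ y' ∈ Finset.univ.erase y₀, u n x y' else u n x y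
  let w : ℕ → X → Y → ℝ := fun n x y =>
    if x = x₀ then q n y - ∑ x' ∈ Finset.univ.erase x₀, v n x' y else v n x y
  have hmargX : ∀ x, ∑ y, Q (x, y) = P x := fun x => congrFun hQ.2 x
  have hu : ∀ x y, Tendsto (fun n => u n x y) l (𝓝 (Q (x, y))) := by
    intro x y
    refine Tendsto.mono_left ?_ hl
    refine (((tendsto_nat_floor_mul_div_atTop (R := ℝ) (hQ.1.1 (x, y))).comp
      tendsto_natCast_atTop_atTop)).congr fun n => ?_
    simp only [Function.comp, u, mul_comm]
  have hule : ∀ n x y, u n x y ≤ Q (x, y) := by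
    intro n x y
    rcases Nat.eq_zero_or_pos n with rfl | hn
    · simpa [u] using hQ.1.1 (x, y)
    · have hn' : (0 : ℝ) < n := by positivity
      simp only [u]
      rw [div_le_iff₀ hn', mul_comm (Q (x, y))]
      exact Nat.floor_le (mul_nonneg hn'.le (hQ.1.1 _))
  have hv : ∀ x y, Tendsto (fun n => v n x y) l (𝓝 (Q (x, y))) := by
    intro x y
    by_cases hy : y = y₀
    · simp only [v, if_pos hy]
      have h1 : Q (x, y) = P x - ∑ y' ∈ Finset.univ.erase y₀, Q (x, y') := by
        rw [← hmargX x, ← Finset.add_sum_erase _ _ (Finset.mem_univ y₀), hy]; ring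
      rw [h1]
      exact tendsto_const_nhds.sub (tendsto_finsetSum _ fun y' _ => hu x y')
    · simp only [v, if_neg hy]
      exact hu x y
  have hw : ∀ x y, Tendsto (fun n => w n x y) l (𝓝 (Q (x, y))) := by
    intro x y
    by_cases hx : x = x₀
    · simp only [w, if_pos hx]
      have h1 : Q (x, y) = margY Q y - ∑ x' ∈ Finset.univ.erase x₀, Q (x', y) := by
        rw [margY, ← Finset.add_sum_erase _ _ (Finset.mem_univ x₀), hx]; ring
      rw [h1]
      exact (tendsto_pi_nhds.1 hq y).sub (tendsto_finsetSum _ fun x' _ => hv x' y)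
    · simp only [w, if_neg hx]
      exact hv x y
  have hu0 : ∀ n x y, 0 ≤ u n x y := fun n x y => by simp only [u]; positivity
  have hv0 : ∀ n x y, 0 ≤ v n x y := by
    intro n x y
    by_cases hy : y = y₀
    · simp only [v, if_pos hy]
      rw [← hmargX x, ← Finset.add_sum_erase _ _ (Finset.mem_univ y₀)]
      have h1 : ∑ y' ∈ Finset.univ.erase y₀, u n x y' ≤ ∑ y' ∈ Finset.univ.erase y₀, Q (x, y') :=
        Finset.sum_le_sum fun y' _ => hule n x y'
      have h2 := hQ.1.1 (x, y₀)
      linarith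
    · simp only [v, if_neg hy]
      exact hu0 n x y
  have hvrow : ∀ n x, ∑ y, v n x y = P x := by
    intro n x
    rw [← Finset.add_sum_erase _ _ (Finset.mem_univ y₀)]
    rw [Finset.sum_congr rfl fun y hy => show v n x y = u n x y from
      if_neg (Finset.ne_of_mem_erase hy)]
    simp [v]
  have hwcol : ∀ n y, ∑ x, w n x y = q n y := by
    intro n y
    rw [← Finset.add_sum_erase _ _ (Finset.mem_univ x₀)]
    rw [Finset.sum_congr rfl fun x hx => show w n x y = v n x y from
      if_neg (Finset.ne_of_mem_erase hx)]
    simp [w]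
  have hwrow : ∀ n x, ∑ y, q n y = 1 → ∑ y, w n x y = P x := by
    intro n x hqn
    by_cases hx : x = x₀
    · simp only [w, if_pos hx]
      rw [Finset.sum_sub_distrib, hqn, Finset.sum_comm, Finset.sum_congr rfl fun x' _ => hvrow n x',
        ← hP1, ← Finset.add_sum_erase _ _ (Finset.mem_univ x₀), hx]
      ring
    · simp only [w, if_neg hx]
      exact hvrow n x
  -- Only the row `x₀` can become negative: there `w` converges to `Q`, which is positive at `y`
  -- unless `q y = 0`, and in that case nothing is subtracted from `q n y`.
  have hw0 : ∀ᶠ n in l, ∀ x y, 0 ≤ w n x y := by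
    refine eventually_all.2 fun x => eventually_all.2 fun y => ?_
    by_cases hx : x = x₀
    · by_cases hz : margY Q y = 0
      · have hQz : ∀ x', Q (x', y) = 0 := fun x' =>
          le_antisymm ((le_margY hQ.1.1 x' y).trans hz.le) (hQ.1.1 _)
        have hyy : y ≠ y₀ := fun h => hy₀ (h ▸ hz)
        filter_upwards [hqd] with n hn
        have h1 : ∀ x', v n x' y = 0 := by
          intro x'
          simp [v, hyy, u, hQz]
        simp only [w, if_pos hx, h1, Finset.sum_const_zero, sub_zero]
        obtain ⟨j, hj⟩ := hn.1 y
        rw [hj]; positivity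
      · have h1 : 0 < Q (x, y) := (hQ.1.1 _).lt_of_ne' (hpos x y (hx ▸ hx₀) hz)
        exact ((hw x y).eventually_const_lt h1).mono fun n hn => hn.le
    · exact Eventually.of_forall fun n => by simp only [w, if_neg hx]; exact hv0 n x y
  refine ⟨fun n a => w n a.1 a.2, tendsto_pi_nhds.2 fun a => hw a.1 a.2, ?_⟩
  filter_upwards [hw0, hPd, hqd, hl (eventually_gt_atTop 0)] with n h0 hPn hqn hn
  have hn' : (n : ℝ) ≠ 0 := by positivity
  refine ⟨⟨⟨fun a => h0 a.1 a.2, ?_⟩, funext fun x => hwrow n x hqn.2⟩,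
    funext fun y => hwcol n y, ?_⟩
  · rw [Fintype.sum_prod_type_right, ← hqn.2]
    exact Finset.sum_congr rfl fun y _ => hwcol n y
  · refine hasDenominator_of_int hn (fun a => h0 a.1 a.2) fun a => ?_
    have hui : ∀ x y, ∃ j : ℤ, n * u n x y = j := fun x y =>
      ⟨⌊n * Q (x, y)⌋₊, by simp only [u]; field_simp; simp⟩
    have hvi : ∀ x y, ∃ j : ℤ, n * v n x y = j := by
      intro x y
      by_cases hy : y = y₀
      · choose j hj using hui
        obtain ⟨i, hi⟩ := hPn x
        refine ⟨i - ∑ y' ∈ Finset.univ.erase y₀, j x y', ?_⟩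
        simp only [v, if_pos hy, mul_sub, Finset.mul_sum, hj, hi]
        push_cast
        rw [mul_div_cancel₀ _ hn']
      · simpa only [v, if_neg hy] using hui x y
    by_cases hx : a.1 = x₀
    · choose j hj using hvi
      obtain ⟨i, hi⟩ := hqn.1 a.2
      refine ⟨i - ∑ x' ∈ Finset.univ.erase x₀, j x' a.2, ?_⟩
      simp only [w, if_pos hx, mul_sub, Finset.mul_sum, hj, hi]
      push_cast
      rw [mul_div_cancel₀ _ hn']
    · simpa only [w, if_neg hx] using hvi a.1 a.2

/-- Mixing with the product of the marginals makes a joint distribution positive on the product of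
the supports and lowers the mutual information below a positive bound. -/
lemma exists_mutualInfo_lt {P : X → ℝ} {R : ℝ} (hR : 0 < R) {h : (X × Y → ℝ) → EReal}
    (hh : IsThreshold h) {Q : X × Y → ℝ} (hQ : Q ∈ jointWith P) (hI : mutualInfo Q ≤ R)
    {a : EReal} (ha : a < h Q) :
    ∃ Q' ∈ jointWith P, margY Q' = margY Q ∧ mutualInfo Q' < R ∧ a < h Q' ∧
      ∀ x y, P x ≠ 0 → margY Q' y ≠ 0 → Q' (x, y) ≠ 0 := by
  obtain ⟨hP1, hY1⟩ := sum_marg_eq_one hQ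
  have hP0 : ∀ x, 0 ≤ P x := fun x => by
    rw [← hQ.2]; exact Finset.sum_nonneg fun y _ => hQ.1.1 _
  have hY0 : ∀ y, 0 ≤ margY Q y := fun y => Finset.sum_nonneg fun x _ => hQ.1.1 _
  set S : X × Y → ℝ := fun a => P a.1 * margY Q a.2 with hS
  have hSY : margY S = margY Q := by
    funext y
    simp only [margY, hS]
    rw [← Finset.sum_mul, hP1, one_mul]
  have hSX : margX S = P := by
    funext x
    simp only [margX, hS]
    rw [← Finset.mul_sum, hY1, mul_one]
  have hSP : S ∈ jointWith P := by
    refine ⟨⟨fun a => mul_nonneg (hP0 _) (hY0 _), ?_⟩, hSX⟩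
    rw [← hP1, Fintype.sum_prod_type]
    exact Finset.sum_congr rfl fun x _ => congrFun hSX x
  have hIS : mutualInfo S = 0 := by
    refine Finset.sum_eq_zero fun x _ => Finset.sum_eq_zero fun y _ => ?_
    rw [hSX, hSY]
    rcases eq_or_ne (P x * margY Q y) 0 with h0 | h0
    · simp [hS, h0]
    · simp [hS, div_self h0]
  let mix : ℝ → X × Y → ℝ := fun t => (1 - t) • Q + t • S
  have hmixP : ∀ t, 0 ≤ t → t ≤ 1 → mix t ∈ jointWith P := by
    intro t h0 h1
    refine ⟨convex_stdSimplex ℝ (X × Y) hQ.1 hSP.1 (by linarith) h0 (by ring), ?_⟩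
    funext x
    have e1 : ∑ y, Q (x, y) = P x := congrFun hQ.2 x
    have e2 : ∑ y, S (x, y) = P x := congrFun hSX x
    simp only [margX, mix, Pi.add_apply, Pi.smul_apply, smul_eq_mul]
    rw [Finset.sum_add_distrib, ← Finset.mul_sum, ← Finset.mul_sum, e1, e2]
    ring
  have hmixY : ∀ t, margY (mix t) = margY Q := by
    intro t
    funext y
    have e2 : ∑ x, S (x, y) = ∑ x, Q (x, y) := congrFun hSY y
    simp only [margY, mix, Pi.add_apply, Pi.smul_apply, smul_eq_mul]
    rw [Finset.sum_add_distrib, ← Finset.mul_sum, ← Finset.mul_sum, e2]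
    ring
  have hmixI : ∀ t, 0 ≤ t → t ≤ 1 → mutualInfo (mix t) ≤ (1 - t) * mutualInfo Q := by
    intro t h0 h1
    have e0 := mutualInfo_eq_entropy (nonneg_of_mem_jointWith (hmixP t h0 h1))
    have e1 := mutualInfo_eq_entropy (nonneg_of_mem_jointWith hQ)
    have e2 := mutualInfo_eq_entropy (nonneg_of_mem_jointWith hSP)
    rw [(hmixP t h0 h1).2, hmixY] at e0
    rw [hQ.2] at e1
    rw [hIS, hSX, hSY] at e2
    have h3 : (1 - t) * entropy Q + t * entropy S ≤ entropy (mix t) := by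
      simp only [entropy, Finset.mul_sum, ← Finset.sum_add_distrib]
      refine Finset.sum_le_sum fun b _ => ?_
      exact Real.concaveOn_negMulLog.2 (hQ.1.1 b) (hSP.1.1 b) (by linarith) h0 (by ring)
    rw [e0, e1]
    nlinarith
  have hlim : Tendsto mix (𝓝[>] 0) (𝓝[stdSimplex ℝ (X × Y)] Q) := by
    refine tendsto_nhdsWithin_iff.2 ⟨?_, ?_⟩
    · have : Continuous mix := by
        simp only [mix]; fun_prop
      have h1 := this.tendsto 0
      simp only [mix, sub_zero, one_smul, zero_smul, add_zero] at h1
      exact h1.mono_left nhdsWithin_le_nhds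
    · filter_upwards [Ioo_mem_nhdsGT (zero_lt_one' ℝ)] with t ht
      exact (hmixP t ht.1.le ht.2.le).1
  obtain ⟨t, hta, ht⟩ := ((hlim.eventually (hh.lowerSemicontinuousOn Q hQ.1 a ha)).and
    (Ioo_mem_nhdsGT (zero_lt_one' ℝ))).exists
  refine ⟨mix t, hmixP t ht.1.le ht.2.le, hmixY t, ?_, hta, fun x y hx hy => ?_⟩
  · refine (hmixI t ht.1.le ht.2.le).trans_lt ?_
    have h1 := ht.1
    have h2 := ht.2
    calc (1 - t) * mutualInfo Q ≤ (1 - t) * R := by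
          apply mul_le_mul_of_nonneg_left hI; linarith
      _ < R := by nlinarith
  · rw [hmixY] at hy
    have h1 : 0 < t * (P x * margY Q y) :=
      mul_pos ht.1 (mul_pos ((hP0 x).lt_of_ne' hx) ((hY0 y).lt_of_ne' hy))
    have h2 : 0 ≤ (1 - t) * Q (x, y) := mul_nonneg (by linarith [ht.2]) (hQ.1.1 _)
    have h3 : mix t (x, y) = (1 - t) * Q (x, y) + t * (P x * margY Q y) := rfl
    rw [h3]
    positivity

variable [DecidableEq X]

lemma hasDenominator_empDist {n : ℕ} (x : Fin n → X) : HasDenominator n (empDist x) :=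
  fun _ => ⟨_, rfl⟩

end Rounding

/-! ### The list size exponent -/

section List

variable {X Y : Type*} [Fintype X] [Fintype Y] [DecidableEq X] [DecidableEq Y]

/-- The average list size is of order `exp (-n c)` if this is the order of the contribution of
every triple of a transmitted word, an output and a listed word. -/
lemma ensembleAvg_listSize_le {W : X → Y → ℝ} (hW : IsChannel W) {P : X → ℝ} {M : ℕ}
    (hM : 2 ≤ M) {h : (X × Y → ℝ) → EReal} {n : ℕ} (hn : 0 < n) (hT : (typeClass P n).Nonempty)
    {c : ℝ}
    (hc : ∀ x ∈ typeClass P n, ∀ x' ∈ typeClass P n, ∀ y : Fin n → Y, chanProb W x y ≠ 0 →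
      h (jointEmpDist x y) ≤ logLik W (jointEmpDist x' y) →
      M * Real.exp (-(n * mutualInfo (jointEmpDist x' y))) *
        (1 - beatProb P h y (logLik W (jointEmpDist x' y))) ^ (M - 2)
        ≤ Real.exp (n * realCondDiv W (jointEmpDist x y)) * Real.exp (-(n * c))) :
    ensembleAvg P M n (fun C => listSize W C (region W h C))
      ≤ 1 * slack n ^ (slackDegree X Y + slackDegree X Y) * Real.exp (-(n * c)) := by
  classical
  have hT0 : (0 : ℝ) < (typeClass P n).card := by exact_mod_cast hT.card_pos
  set N : ℝ := ((typeClass P n).card : ℝ) with hN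
  set s := slack n ^ slackDegree X Y with hsdef
  have hs : 0 < s := pow_pos (slack_pos n) _
  rw [ensembleAvg_listSize W h hM hT, one_mul]
  have hMr : (2 : ℝ) ≤ M := by exact_mod_cast hM
  have hpt : ∀ y : Fin n → Y, ∀ x' ∈ typeClass P n,
      ((M : ℝ) - 1) * ((∑ x ∈ (typeClass P n).filter fun x =>
          h (jointEmpDist x y) ≤ logLik W (jointEmpDist x' y), chanProb W x y) *
        (1 - beatProb P h y (logLik W (jointEmpDist x' y))) ^ (M - 2))
      ≤ (Real.exp (n * mutualInfo (jointEmpDist x' y)) * Real.exp (-(n * c))) *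
        ∑ x ∈ typeClass P n, chanProb W x y * Real.exp (n * realCondDiv W (jointEmpDist x y)) := by
    intro y x' hx'
    set b := (1 - beatProb P h y (logLik W (jointEmpDist x' y))) ^ (M - 2) with hb
    have hp1 := beatProb_le_one P h y (logLik W (jointEmpDist x' y))
    have hb0 : 0 ≤ b := pow_nonneg (by linarith) _
    calc _ ≤ (M : ℝ) * ((∑ x ∈ (typeClass P n).filter fun x =>
          h (jointEmpDist x y) ≤ logLik W (jointEmpDist x' y), chanProb W x y) * b) := by
          refine mul_le_mul_of_nonneg_right (by linarith) (mul_nonneg ?_ hb0)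
          exact Finset.sum_nonneg fun x _ => chanProb_nonneg hW x y
      _ = ∑ x ∈ (typeClass P n).filter fun x =>
          h (jointEmpDist x y) ≤ logLik W (jointEmpDist x' y), chanProb W x y * (M * b) := by
          rw [← Finset.sum_mul]; ring
      _ ≤ ∑ x ∈ (typeClass P n).filter fun x =>
          h (jointEmpDist x y) ≤ logLik W (jointEmpDist x' y),
          Real.exp (n * mutualInfo (jointEmpDist x' y)) * Real.exp (-(n * c)) *
          (chanProb W x y * Real.exp (n * realCondDiv W (jointEmpDist x y))) := by
          refine Finset.sum_le_sum fun x hx => ?_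
          rw [Finset.mem_filter] at hx
          by_cases h0 : chanProb W x y = 0
          · simp [h0]
          have h1 := hc x hx.1 x' hx' y h0 hx.2
          have hcp := chanProb_nonneg hW x y
          have e1 : Real.exp (n * mutualInfo (jointEmpDist x' y)) *
              Real.exp (-(n * mutualInfo (jointEmpDist x' y))) = 1 := by
            rw [← Real.exp_add, add_neg_cancel, Real.exp_zero]
          calc chanProb W x y * (M * b)
              = chanProb W x y * (M * b) * (Real.exp (n * mutualInfo (jointEmpDist x' y)) *
                Real.exp (-(n * mutualInfo (jointEmpDist x' y)))) := by rw [e1, mul_one]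
            _ = chanProb W x y * Real.exp (n * mutualInfo (jointEmpDist x' y)) *
                (M * Real.exp (-(n * mutualInfo (jointEmpDist x' y))) * b) := by ring
            _ ≤ chanProb W x y * Real.exp (n * mutualInfo (jointEmpDist x' y)) *
                (Real.exp (n * realCondDiv W (jointEmpDist x y)) * Real.exp (-(n * c))) := by
                gcongr
            _ = _ := by ring
      _ ≤ ∑ x ∈ typeClass P n, Real.exp (n * mutualInfo (jointEmpDist x' y)) * Real.exp (-(n * c)) *
          (chanProb W x y * Real.exp (n * realCondDiv W (jointEmpDist x y))) := by
          refine Finset.sum_le_sum_of_subset_of_nonneg (Finset.filter_subset _ _) fun x _ _ => ?_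
          have hcp := chanProb_nonneg hW x y
          positivity
      _ = _ := by rw [Finset.mul_sum]
  have hdiv : ∀ y : Fin n → Y, 0 ≤ ∑ x ∈ typeClass P n,
      chanProb W x y * Real.exp (n * realCondDiv W (jointEmpDist x y)) := fun y =>
    Finset.sum_nonneg fun x _ => mul_nonneg (chanProb_nonneg hW x y) (Real.exp_pos _).le
  rw [div_mul_eq_mul_div, div_le_iff₀ (by positivity), Finset.mul_sum]
  calc ∑ y : Fin n → Y, ((M : ℝ) - 1) * ∑ x' ∈ typeClass P n,
        (∑ x ∈ (typeClass P n).filter fun x =>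
          h (jointEmpDist x y) ≤ logLik W (jointEmpDist x' y), chanProb W x y) *
        (1 - beatProb P h y (logLik W (jointEmpDist x' y))) ^ (M - 2)
      ≤ ∑ y : Fin n → Y, (∑ x' ∈ typeClass P n, Real.exp (n * mutualInfo (jointEmpDist x' y))) *
        (Real.exp (-(n * c)) *
        ∑ x ∈ typeClass P n, chanProb W x y * Real.exp (n * realCondDiv W (jointEmpDist x y))) := by
        refine Finset.sum_le_sum fun y _ => ?_
        rw [Finset.mul_sum, Finset.sum_mul]
        refine Finset.sum_le_sum fun x' hx' => (hpt y x' hx').trans_eq ?_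
        ring
    _ ≤ ∑ y : Fin n → Y, (s * N) * (Real.exp (-(n * c)) *
        ∑ x ∈ typeClass P n, chanProb W x y * Real.exp (n * realCondDiv W (jointEmpDist x y))) := by
        refine Finset.sum_le_sum fun y _ => ?_
        exact mul_le_mul_of_nonneg_right (sum_exp_mutualInfo_le hn hT y)
          (mul_nonneg (Real.exp_pos _).le (hdiv y))
    _ = (s * N) * Real.exp (-(n * c)) * ∑ x ∈ typeClass P n, ∑ y : Fin n → Y,
        chanProb W x y * Real.exp (n * realCondDiv W (jointEmpDist x y)) := by
        rw [Finset.sum_comm, Finset.mul_sum]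
        exact Finset.sum_congr rfl fun y _ => by ring
    _ ≤ (s * N) * Real.exp (-(n * c)) * (s * N) := by
        gcongr
        exact sum_chanProb_mul_exp_le hW hn hT
    _ = _ := by rw [pow_add]; ring

/-- If the competing words of a given output exceed `s` with probability at least
`exp (-n r)`, `r < R`, then all of them staying below is superexponentially unlikely. -/
lemma eventually_one_sub_pow_lt {R r : ℝ} (hR : 0 < R) (hr : r < R) (K : ℕ) (b : ℝ) :
    ∀ᶠ n : ℕ in atTop, ∀ p : ℝ, p ≤ 1 → Real.exp (-(n * r)) ≤ slack n ^ K * p →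
      2 * (1 - p) ^ (numCodewords R n - 2) ≤ Real.exp (-(n * b)) := by
  have hδ : 0 < (R - r) / 2 := by linarith
  filter_upwards [eventually_slack_pow_le 2 K hδ, eventually_slack_pow_le (|b| + 1) 1 hδ,
    eventually_slack_pow_le 4 0 hR, eventually_gt_atTop 0] with n h1 h2 h3 hn p hp1 hp
  have hs : 0 < slack n ^ K := pow_pos (slack_pos n) K
  have hp0 : 0 ≤ p := by
    by_contra! hlt
    have := Real.exp_pos (-(n * r))
    nlinarith
  have hM : Real.exp (n * R) / 2 ≤ ((numCodewords R n - 2 : ℕ) : ℝ) := by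
    rw [Nat.cast_sub (two_le_numCodewords hR hn), Nat.cast_two]
    have := exp_le_numCodewords R n
    rw [pow_zero, mul_one] at h3
    linarith
  set k := numCodewords R n - 2
  have hkp : (|b| + 1) * (n + 1) ≤ k * p := by
    have e1 : Real.exp (n * ((R - r) / 2)) * Real.exp (n * ((R - r) / 2))
        = Real.exp (n * R) * Real.exp (-(n * r)) := by
      rw [← Real.exp_add, ← Real.exp_add]; congr 1; ring
    have e2 : Real.exp (n * R) * Real.exp (-(n * r)) ≤ (2 * k) * (slack n ^ K * p) := by
      gcongr; linarith
    have e3 : Real.exp (n * ((R - r) / 2)) * Real.exp (n * ((R - r) / 2))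
        ≤ Real.exp (n * ((R - r) / 2)) * (k * p) := by
      rw [e1]
      refine e2.trans ?_
      calc (2 * k) * (slack n ^ K * p) = (2 * slack n ^ K) * (k * p) := by ring
        _ ≤ _ := by gcongr
    have e4 := le_of_mul_le_mul_left e3 (Real.exp_pos _)
    refine le_trans ?_ e4
    refine le_trans ?_ h2
    rw [pow_one]
    gcongr
    exact add_one_le_slack n
  have h4 : (1 - p) ^ k ≤ Real.exp (-(k * p)) := by
    rw [← mul_neg, Real.exp_nat_mul]
    refine pow_le_pow_left₀ (by linarith) ?_ k
    have := Real.add_one_le_exp (-p)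
    linarith
  have h5 : (2 : ℝ) ≤ Real.exp 1 := by
    have := Real.add_one_le_exp (1 : ℝ)
    linarith
  calc 2 * (1 - p) ^ k ≤ Real.exp 1 * Real.exp (-((|b| + 1) * (n + 1))) := by
        gcongr
        exact h4.trans (Real.exp_le_exp.2 (by linarith))
    _ = Real.exp (1 - (|b| + 1) * (n + 1)) := by rw [← Real.exp_add]; ring_nf
    _ ≤ Real.exp (-(n * b)) := by
        gcongr
        have h6 := neg_abs_le b
        have h7 := le_abs_self b
        have h8 : (0 : ℝ) ≤ n := by positivity
        nlinarith [abs_nonneg b]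

/-- Below the exponent of the single-letter formula, no triple of words contributes more than
`exp (-n c)` to the average list size. Along an ultrafilter of block lengths at which this fails
the joint types converge to a feasible point of the formula, which is a contradiction. -/
lemma eventually_triple_le {W : X → Y → ℝ} {P : X → ℝ} {R : ℝ}
    (hR : 0 < R) {h : (X × Y → ℝ) → EReal} (hh : IsThreshold h) {c : ℝ}
    (hc : (c : EReal) < listFormula W P R h) :
    ∀ᶠ n in blockLengths P, ∀ x ∈ typeClass P n, ∀ x' ∈ typeClass P n, ∀ y : Fin n → Y,
      chanProb W x y ≠ 0 → h (jointEmpDist x y) ≤ logLik W (jointEmpDist x' y) →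
      numCodewords R n * Real.exp (-(n * mutualInfo (jointEmpDist x' y))) *
        (1 - beatProb P h y (logLik W (jointEmpDist x' y))) ^ (numCodewords R n - 2)
        ≤ Real.exp (n * realCondDiv W (jointEmpDist x y)) * Real.exp (-(n * c)) := by
  by_contra hcon
  set bad : ℕ → Prop := fun n => ∃ Qt Q : X × Y → ℝ, Qt ∈ jointWith P ∧ Q ∈ jointWith P ∧
    margY Q = margY Qt ∧ IsSupported W Qt ∧ h Qt ≤ logLik W Q ∧ ∃ y : Fin n → Y,
      empDist y = margY Q ∧
      Real.exp (n * realCondDiv W Qt) * Real.exp (-(n * c)) <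
        numCodewords R n * Real.exp (-(n * mutualInfo Q)) *
        (1 - beatProb P h y (logLik W Q)) ^ (numCodewords R n - 2) with hbad
  have hfreq : ∃ᶠ n in blockLengths P, bad n := by
    rw [not_eventually] at hcon
    refine (hcon.and_eventually ((eventually_gt_atTop 0).filter_mono (blockLengths_le P))).mono ?_
    rintro n ⟨h1, hn⟩
    push Not at h1
    obtain ⟨x, hx, x', hx', y, h0, hle, hlt⟩ := h1
    exact ⟨jointEmpDist x y, jointEmpDist x' y, jointEmpDist_mem_jointWith hn hx y,
      jointEmpDist_mem_jointWith hn hx' y, by rw [margY_jointEmpDist, margY_jointEmpDist],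
      isSupported_of_chanProb_ne_zero h0, hle, y, (margY_jointEmpDist x' y).symm, hlt⟩
  have hne : (blockLengths P ⊓ 𝓟 {n | bad n}).NeBot := frequently_iff_neBot.1 hfreq
  set U := Ultrafilter.of (blockLengths P ⊓ 𝓟 {n | bad n}) with hU
  have hUle : (U : Filter ℕ) ≤ blockLengths P ⊓ 𝓟 {n | bad n} := Ultrafilter.of_le _
  have hUB : (U : Filter ℕ) ≤ blockLengths P := hUle.trans inf_le_left
  have hUtop : (U : Filter ℕ) ≤ atTop := hUB.trans (blockLengths_le P)
  have hUbad : ∀ᶠ n in (U : Filter ℕ), bad n := hUle (mem_inf_of_right (mem_principal_self _))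
  rw [hbad] at hUbad
  clear_value bad
  have hch : ∃ Qt Q : ℕ → X × Y → ℝ, ∀ᶠ n in (U : Filter ℕ),
      Qt n ∈ jointWith P ∧ Q n ∈ jointWith P ∧
      margY (Q n) = margY (Qt n) ∧ IsSupported W (Qt n) ∧ h (Qt n) ≤ logLik W (Q n) ∧
      ∃ y : Fin n → Y, empDist y = margY (Q n) ∧
      Real.exp (n * realCondDiv W (Qt n)) * Real.exp (-(n * c)) <
        numCodewords R n * Real.exp (-(n * mutualInfo (Q n))) *
        (1 - beatProb P h y (logLik W (Q n))) ^ (numCodewords R n - 2) := by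
    obtain ⟨Qt, hQt⟩ := hUbad.choice
    obtain ⟨Q, hQ⟩ := hQt.choice
    exact ⟨Qt, Q, hQ⟩
  obtain ⟨Qt, Q, hall⟩ := hch
  have hlimit : ∀ S : ℕ → X × Y → ℝ, (∀ᶠ n in (U : Filter ℕ), S n ∈ jointWith P) →
      ∃ S₀ ∈ jointWith P, Tendsto S U (𝓝[jointWith P] S₀) := by
    intro S hS
    obtain ⟨S₀, hS₀, hle⟩ := (isCompact_jointWith P).ultrafilter_le_nhds (U.map S)
      (le_principal_iff.2 hS)
    exact ⟨S₀, hS₀, tendsto_nhdsWithin_iff.2 ⟨hle, hS⟩⟩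
  obtain ⟨Qt₀, hQt₀, hlimt'⟩ := hlimit Qt (hall.mono fun n hn => hn.1)
  obtain ⟨Q₀, hQ₀, hlim'⟩ := hlimit Q (hall.mono fun n hn => hn.2.1)
  have hlimt : Tendsto Qt U (𝓝 Qt₀) := hlimt'.mono_right nhdsWithin_le_nhds
  have hlim : Tendsto Q U (𝓝 Q₀) := hlim'.mono_right nhdsWithin_le_nhds
  have hD : Tendsto (fun n => realCondDiv W (Qt n)) U (𝓝 (realCondDiv W Qt₀)) :=
    ((continuous_realCondDiv W).tendsto _).comp hlimt
  have hI : Tendsto (fun n => mutualInfo (Q n)) U (𝓝 (mutualInfo Q₀)) :=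
    (continuousOn_mutualInfo P Q₀ hQ₀).tendsto.comp hlim'
  have hf : Tendsto (fun n => realLogLik W (Q n)) U (𝓝 (realLogLik W Q₀)) :=
    ((continuous_realLogLik W).tendsto _).comp hlim
  have hYlim : Tendsto (fun n => margY (Q n)) U (𝓝 (margY Q₀)) :=
    (continuous_margY.tendsto _).comp hlim
  have hY : margY Q₀ = margY Qt₀ := by
    refine tendsto_nhds_unique hYlim (((continuous_margY.tendsto _).comp hlimt).congr' ?_)
    filter_upwards [hall] with n hn
    exact hn.2.2.1.symm
  have hst : IsSupported W Qt₀ :=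
    (isClosed_isSupported W).mem_of_tendsto hlimt (hall.mono fun n hn => hn.2.2.2.1)
  -- `h` is never `-∞` on distributions, so neither is the log-likelihood that dominates it
  have hsn : ∀ᶠ n in (U : Filter ℕ), IsSupported W (Q n) := by
    filter_upwards [hall] with n hn
    by_contra hns
    have h1 := hn.2.2.2.2.1
    rw [logLik_of_not_isSupported hns, le_bot_iff] at h1
    exact hh.ne_bot hn.1.1 h1
  have hs : IsSupported W Q₀ := (isClosed_isSupported W).mem_of_tendsto hlim hsn
  have hle : h Qt₀ ≤ logLik W Q₀ := by
    rw [logLik_of_isSupported hs]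
    by_contra! hlt
    obtain ⟨a, ha1, ha2⟩ := EReal.lt_iff_exists_real_btwn.1 hlt
    rw [EReal.coe_lt_coe_iff] at ha1
    have h1 := (hlimt'.mono_right (nhdsWithin_mono _ fun Q hQ => hQ.1)).eventually
      (hh.lowerSemicontinuousOn Qt₀ hQt₀.1 a ha2)
    obtain ⟨n, hn1, hn2, hn3, hn4⟩ :=
      (h1.and ((hf.eventually_lt_const ha1).and (hsn.and hall))).exists
    have h2 := hn4.2.2.2.2.1
    rw [logLik_of_isSupported hn3] at h2
    exact absurd (hn1.trans_le h2) (not_lt.2 (EReal.coe_le_coe_iff.2 hn2.le))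
  have hrate : realCondDiv W Qt₀ + (mutualInfo Q₀ - R) ≤ c := by
    have h1 : Tendsto (fun n : ℕ => c + Real.log 2 / n) U (𝓝 (c + 0)) :=
      tendsto_const_nhds.add ((tendsto_const_div_atTop_nhds_zero_nat _).mono_left hUtop)
    rw [add_zero] at h1
    refine le_of_tendsto_of_tendsto (hD.add (hI.sub_const R)) h1 ?_
    filter_upwards [hall, hUtop (eventually_gt_atTop 0)] with n hn hn0
    obtain ⟨y, -, hlt⟩ := hn.2.2.2.2.2
    have hn' : (0 : ℝ) < n := by positivity
    have hp0 := beatProb_nonneg P h y (logLik W (Q n))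
    have hp1 := beatProb_le_one P h y (logLik W (Q n))
    have h2 : (1 - beatProb P h y (logLik W (Q n))) ^ (numCodewords R n - 2) ≤ 1 :=
      pow_le_one₀ (by linarith) (by linarith)
    have h3 : Real.exp (n * (realCondDiv W (Qt n) - c)) <
        Real.exp (Real.log 2 + n * (R - mutualInfo (Q n))) := by
      calc Real.exp (n * (realCondDiv W (Qt n) - c))
          = Real.exp (n * realCondDiv W (Qt n)) * Real.exp (-(n * c)) := by
            rw [← Real.exp_add]; congr 1; ring
        _ < _ := hlt
        _ ≤ (2 * Real.exp (n * R)) * Real.exp (-(n * mutualInfo (Q n))) * 1 := by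
            gcongr
            exact numCodewords_le hR n
        _ = Real.exp (Real.log 2 + n * (R - mutualInfo (Q n))) := by
            rw [Real.exp_add, Real.exp_log two_pos, mul_one, mul_assoc, ← Real.exp_add]
            congr 2; ring
    rw [Real.exp_lt_exp] at h3
    have h4 : realCondDiv W (Qt n) + (mutualInfo (Q n) - R) - c ≤ Real.log 2 / n := by
      rw [le_div_iff₀ hn']
      nlinarith
    linarith
  -- A type `Q'` violating this constraint would yield competing types `S n` with the same
  -- `Y`-marginals as `Q n` and mutual information below `r < R`, which makes the power
  -- in `hall` superexponentially small.
  have hV : maxThreshold P R h (margY Q₀) ≤ logLik W Q₀ := by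
    refine iSup₂_le fun Q' hQ' => ?_
    obtain ⟨hQ'P, hQ'Y, hQ'I⟩ := hQ'
    rw [logLik_of_isSupported hs]
    by_contra! hlt
    obtain ⟨a, ha1, ha2⟩ := EReal.lt_iff_exists_real_btwn.1 hlt
    rw [EReal.coe_lt_coe_iff] at ha1
    obtain ⟨Q₁, hQ₁P, hQ₁Y, hQ₁I, hQ₁a, hpos⟩ := exists_mutualInfo_lt hR hh hQ'P hQ'I ha2
    rw [hQ'Y] at hQ₁Y
    have hPd : ∀ᶠ n in (U : Filter ℕ), HasDenominator n P := by
      filter_upwards [hUB (eventually_blockLengths P)] with n hn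
      obtain ⟨x, hx⟩ := hn
      rw [← mem_typeClass.1 hx]
      exact hasDenominator_empDist x
    obtain ⟨S, hSlim, hS⟩ := exists_hasDenominator_tendsto hUtop hQ₁P hpos hPd
      (q := fun n => margY (Q n)) (by rw [hQ₁Y]; exact hYlim) (by
        filter_upwards [hall] with n hn
        obtain ⟨y, hy, -⟩ := hn.2.2.2.2.2
        exact ⟨hy ▸ hasDenominator_empDist y, (sum_marg_eq_one hn.2.1).2⟩)
    have hSlim' : Tendsto S U (𝓝[jointWith P] Q₁) :=
      tendsto_nhdsWithin_iff.2 ⟨hSlim, hS.mono fun n hn => hn.1⟩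
    obtain ⟨r, hr1, hr2⟩ := exists_between hQ₁I
    have hSI : ∀ᶠ n in (U : Filter ℕ), mutualInfo (S n) < r :=
      ((continuousOn_mutualInfo P Q₁ hQ₁P).tendsto.comp hSlim').eventually_lt_const hr1
    have hSa := (hSlim'.mono_right (nhdsWithin_mono _ fun Q hQ => hQ.1)).eventually
      (hh.lowerSemicontinuousOn Q₁ hQ₁P.1 a hQ₁a)
    -- any upper bound for the exponent that the violated inequality leaves to the power
    set b := R + c - mutualInfo Q₀ - realCondDiv W Qt₀ + 1 with hb
    have hbn : ∀ᶠ n in (U : Filter ℕ),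
        R + c - mutualInfo (Q n) - realCondDiv W (Qt n) < b :=
      ((tendsto_const_nhds.sub hI).sub hD).eventually_lt_const (by rw [hb]; linarith)
    have hpos0 : ∀ᶠ n in (U : Filter ℕ), 0 < n := hUtop (eventually_gt_atTop 0)
    have hpow := (eventually_one_sub_pow_lt hR hr2 (slackDegree X Y) b).filter_mono hUtop
    obtain ⟨n, ⟨hnP, hnY, hnden⟩, hnI, hna, hnf, hns, hnb, hn0, hnpow, hn⟩ :=
      (hS.and (hSI.and (hSa.and ((hf.eventually_lt_const ha1).and (hsn.and (hbn.and
        (hpos0.and (hpow.and hall)))))))).exists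
    obtain ⟨x₀, y₀, hxy⟩ := exists_jointEmpDist_eq hnP hn0 hnden
    obtain ⟨y, hy, hlt'⟩ := hn.2.2.2.2.2
    have hx₀ : x₀ ∈ typeClass P n := by
      rw [mem_typeClass, ← margX_jointEmpDist x₀ y₀, hxy, hnP.2]
    have hyy : empDist y = empDist y₀ := by
      rw [hy, ← margY_jointEmpDist x₀ y₀, hxy, hnY]
    have hbeat := exp_neg_mutualInfo_le_beatProb (P := P) hn0 (h := h) (s := logLik W (Q n)) hx₀ hyy
      (by
        rw [hxy, logLik_of_isSupported hns]
        exact (EReal.coe_lt_coe_iff.2 hnf).trans hna)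
    rw [hxy] at hbeat
    have hn' : (0 : ℝ) < n := by positivity
    have h5 := hnpow _ (beatProb_le_one P h y (logLik W (Q n)))
      (le_trans (Real.exp_le_exp.2 (by nlinarith)) hbeat)
    have h6 : Real.exp (n * realCondDiv W (Qt n)) * Real.exp (-(n * c)) <
        Real.exp (n * R) * Real.exp (-(n * mutualInfo (Q n))) * Real.exp (-(n * b)) := by
      have hp1 := beatProb_le_one P h y (logLik W (Q n))
      have hq : 0 ≤ (1 - beatProb P h y (logLik W (Q n))) ^ (numCodewords R n - 2) :=
        pow_nonneg (by linarith) _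
      calc _ < _ := hlt'
        _ ≤ (2 * Real.exp (n * R)) * Real.exp (-(n * mutualInfo (Q n))) *
          (1 - beatProb P h y (logLik W (Q n))) ^ (numCodewords R n - 2) := by
            gcongr
            exact numCodewords_le hR n
        _ = Real.exp (n * R) * Real.exp (-(n * mutualInfo (Q n))) *
          (2 * (1 - beatProb P h y (logLik W (Q n))) ^ (numCodewords R n - 2)) := by ring
        _ ≤ _ := by gcongr
    rw [← Real.exp_add, ← Real.exp_add, ← Real.exp_add, Real.exp_lt_exp] at h6
    nlinarith
  have hfin : listFormula W P R h ≤ condDiv W Qt₀ + ((mutualInfo Q₀ - R : ℝ) : EReal) :=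
    iInf₂_le_of_le Qt₀ hQt₀ (iInf₂_le Q₀ ⟨hQ₀, hY, max_le hV hle⟩)
  rw [condDiv_of_isSupported (nonneg_of_mem_jointWith hQt₀) hst, ← EReal.coe_add] at hfin
  exact absurd (hc.trans_le hfin) (not_lt.2 (EReal.coe_le_coe_iff.2 hrate))

lemma listFormula_le_listExponent {W : X → Y → ℝ} (hW : IsChannel W) {P : X → ℝ} {R : ℝ}
    (hR : 0 < R) {h : (X × Y → ℝ) → EReal} (hh : IsThreshold h) :
    listFormula W P R h ≤ listExponent W P R h := by
  refine le_liminf_negLogRate 1 (slackDegree X Y + slackDegree X Y) ?_ fun c hc => ?_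
  · refine Eventually.of_forall fun n =>
      div_nonneg (Finset.sum_nonneg fun C _ => ?_) (by positivity)
    refine Finset.sum_nonneg fun y _ => mul_nonneg (by positivity) (Finset.sum_nonneg fun m _ => ?_)
    exact mul_nonneg (chanProb_nonneg hW _ _) (by positivity)
  · filter_upwards [eventually_blockLengths P, blockLengths_le P (eventually_gt_atTop 0),
      eventually_triple_le hR hh hc] with n hT hn h1
    exact ensembleAvg_listSize_le hW (two_le_numCodewords hR hn) hn hT h1

/-- A single pair of joint types bounds the average list size from below, if competing codewords
are unlikely to keep the wrong word off the list. -/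
lemma le_ensembleAvg_listSize {W : X → Y → ℝ} (hW : IsChannel W) {P : X → ℝ} {R : ℝ} (hR : 0 < R)
    {h : (X × Y → ℝ) → EReal} {n : ℕ} (hn : 0 < n) {x₁ x₂ : Fin n → X} {y₁ y₂ : Fin n → Y}
    (hx₁ : x₁ ∈ typeClass P n) (hx₂ : x₂ ∈ typeClass P n) (hy : empDist y₂ = empDist y₁)
    (hsupp : IsSupported W (jointEmpDist x₁ y₁))
    (hle : h (jointEmpDist x₁ y₁) ≤ logLik W (jointEmpDist x₂ y₂))
    (hp : ∀ y : Fin n → Y, empDist y = empDist y₁ →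
      numCodewords R n * beatProb P h y (logLik W (jointEmpDist x₂ y₂)) ≤ 1 / 2) :
    Real.exp (-(n * (realCondDiv W (jointEmpDist x₁ y₁) +
        (mutualInfo (jointEmpDist x₂ y₂) - R))))
      ≤ 4 * slack n ^ (slackDegree X Y + slackDegree X Y) *
        ensembleAvg P (numCodewords R n) n (fun C => listSize W C (region W h C)) := by
  classical
  have hT : (typeClass P n).Nonempty := ⟨x₁, hx₁⟩
  have hT0 : (0 : ℝ) < (typeClass P n).card := by exact_mod_cast hT.card_pos
  set N : ℝ := ((typeClass P n).card : ℝ) with hN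
  set s := slack n ^ slackDegree X Y with hsdef
  have hs1 : 1 ≤ s := one_le_pow₀ (one_le_slack n)
  have hs : 0 < s := by linarith
  set M := numCodewords R n with hM
  have hM2 : 2 ≤ M := two_le_numCodewords hR hn
  have hMge : Real.exp (n * R) / 2 ≤ (M : ℝ) - 1 := half_exp_le_numCodewords_sub_one hR hn
  set Q₁ := jointEmpDist x₁ y₁ with hQ₁
  set Q₂ := jointEmpDist x₂ y₂ with hQ₂
  rw [ensembleAvg_listSize W h hM2 hT]
  set e := Real.exp (-(n * mutualInfo Q₂)) with he
  have he0 : 0 < e := Real.exp_pos _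
  set B : (Fin n → Y) → ℝ := fun y => ∑ x' ∈ typeClass P n,
    (∑ x ∈ (typeClass P n).filter fun x =>
      h (jointEmpDist x y) ≤ logLik W (jointEmpDist x' y), chanProb W x y) *
    (1 - beatProb P h y (logLik W (jointEmpDist x' y))) ^ (M - 2) with hB
  set A : (Fin n → Y) → ℝ := fun y => ∑ x ∈ typeClass P n,
    if jointEmpDist x y = Q₁ then chanProb W x y else 0 with hA
  have hterm : ∀ y : Fin n → Y, ∀ x' ∈ typeClass P n, 0 ≤
      (∑ x ∈ (typeClass P n).filter fun x =>
        h (jointEmpDist x y) ≤ logLik W (jointEmpDist x' y), chanProb W x y) *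
      (1 - beatProb P h y (logLik W (jointEmpDist x' y))) ^ (M - 2) := fun y x' _ =>
    mul_nonneg (Finset.sum_nonneg fun x _ => chanProb_nonneg hW x y)
      (pow_nonneg (by linarith [beatProb_le_one P h y (logLik W (jointEmpDist x' y))]) _)
  have hA0 : ∀ y, 0 ≤ A y := fun y => Finset.sum_nonneg fun x _ => by
    split_ifs
    · exact chanProb_nonneg hW x y
    · exact le_rfl
  -- each `y` that has type `Q₁` with some word also has type `Q₂` with enough words
  have hAB : ∀ y, e * N * A y ≤ 2 * s * B y := by
    intro y
    by_cases hex : ∃ x ∈ typeClass P n, jointEmpDist x y = Q₁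
    · obtain ⟨x, hx, hxy⟩ := hex
      have hyy : empDist y = empDist y₁ := by
        rw [← margY_jointEmpDist x y, hxy, hQ₁, margY_jointEmpDist]
      have hcnt := exp_neg_mutualInfo_le hn (x₀ := x₂) (hyy.trans hy.symm)
      rw [mem_typeClass.1 hx₂, ← hQ₂, ← he, ← hN, ← hsdef] at hcnt
      have hp0 := beatProb_nonneg P h y (logLik W Q₂)
      have hp1 := beatProb_le_one P h y (logLik W Q₂)
      have hhalf : 1 / 2 ≤ (1 - beatProb P h y (logLik W Q₂)) ^ (M - 2) := by
        have h1 := one_sub_pow_le_mul hp1 (M - 2)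
        have h2 : ((M - 2 : ℕ) : ℝ) ≤ M := by exact_mod_cast Nat.sub_le M 2
        have h3 := hp y hyy
        have h4 : ((M - 2 : ℕ) : ℝ) * beatProb P h y (logLik W Q₂)
          ≤ M * beatProb P h y (logLik W Q₂) := by gcongr
        linarith
      have hBge : (((typeClass P n).filter fun x => jointEmpDist x y = Q₂).card : ℝ) *
          (A y * (1 / 2)) ≤ B y := by
        rw [← nsmul_eq_mul, ← Finset.sum_const]
        refine le_trans (Finset.sum_le_sum fun x' hx' => ?_)
          (Finset.sum_le_sum_of_subset_of_nonneg (Finset.filter_subset _ _)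
            fun x' hx' _ => hterm y x' hx')
        rw [Finset.mem_filter] at hx'
        rw [hx'.2]
        refine mul_le_mul ?_ hhalf (by norm_num)
          (Finset.sum_nonneg fun x _ => chanProb_nonneg hW x y)
        simp only [hA]
        rw [← Finset.sum_filter]
        refine Finset.sum_le_sum_of_subset_of_nonneg (fun x hx => ?_)
          fun x _ _ => chanProb_nonneg hW x y
        rw [Finset.mem_filter] at hx ⊢
        exact ⟨hx.1, by rw [hx.2]; exact hle⟩
      have hAy := hA0 y
      calc e * N * A y ≤ (s * ((typeClass P n).filter fun x => jointEmpDist x y = Q₂).card) *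
            A y := by gcongr
        _ = 2 * s * ((((typeClass P n).filter fun x => jointEmpDist x y = Q₂).card : ℝ) *
            (A y * (1 / 2))) := by ring
        _ ≤ _ := by gcongr
    · have : A y = 0 := Finset.sum_eq_zero fun x hx => if_neg fun hxy => hex ⟨x, hx, hxy⟩
      rw [this, mul_zero]
      have : 0 ≤ B y := Finset.sum_nonneg fun x' hx' => hterm y x' hx'
      positivity
  have hD := exp_neg_realCondDiv_le hW hn hsupp
  rw [← hQ₁, mem_typeClass.1 hx₁, ← hsdef, Finset.sum_comm] at hD
  have e1 : Real.exp (-(n * (realCondDiv W Q₁ + (mutualInfo Q₂ - R))))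
      = Real.exp (-(n * realCondDiv W Q₁)) * e * Real.exp (n * R) := by
    rw [he, ← Real.exp_add, ← Real.exp_add]; congr 1; ring
  rw [e1, pow_add, ← hsdef, div_mul_eq_mul_div, ← mul_div_assoc, le_div_iff₀ (by positivity)]
  have hB0 : 0 ≤ ∑ y, B y := Finset.sum_nonneg fun y _ =>
    Finset.sum_nonneg fun x' hx' => hterm y x' hx'
  calc Real.exp (-(n * realCondDiv W Q₁)) * e * Real.exp (n * R) * N ^ 2
      = (Real.exp (-(n * realCondDiv W Q₁)) * N) * (e * N) * Real.exp (n * R) := by ring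
    _ ≤ (s * ∑ y, A y) * (e * N) * Real.exp (n * R) := by gcongr
    _ = s * (∑ y, e * N * A y) * Real.exp (n * R) := by rw [← Finset.mul_sum]; ring
    _ ≤ s * (∑ y, 2 * s * B y) * (2 * ((M : ℝ) - 1)) := by
        refine mul_le_mul (mul_le_mul_of_nonneg_left (Finset.sum_le_sum fun y _ => hAB y) hs.le)
          (by linarith) (Real.exp_pos _).le (mul_nonneg hs.le ?_)
        rw [← Finset.mul_sum]
        positivity
    _ = _ := by rw [← Finset.mul_sum]; ring

/-- The strict constraint of the list size formula propagates to nearby `Y`-marginals, with a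
margin in the mutual information. -/
lemma exists_pos_eventually_forall_le {W : X → Y → ℝ} {P : X → ℝ} {R : ℝ}
    {h : (X × Y → ℝ) → EReal} {Q : X × Y → ℝ}
    (hlt : maxThreshold P R (upperEnvelope P h) (margY Q) < (realLogLik W Q : EReal)) :
    ∃ δ > 0, ∀ᶠ Q₁ in 𝓝 Q, ∀ Q' ∈ jointWith P, margY Q' = margY Q₁ → mutualInfo Q' < R + δ →
      h Q' ≤ (realLogLik W Q₁ : EReal) := by
  -- tube lemma over the compact set of all `Q'`, jointly in `Q₁` and the margin
  have key : ∀ᶠ z : (X × Y → ℝ) × ℝ in 𝓝 (Q, 0), ∀ Q' ∈ (jointWith P : Set (X × Y → ℝ)),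
      Q' ∈ jointWith P → margY Q' = margY z.1 → mutualInfo Q' < R + z.2 →
      h Q' ≤ (realLogLik W z.1 : EReal) := by
    refine (isCompact_jointWith P).eventually_forall_of_forall_eventually fun Q' hQ' => ?_
    have c1 : Continuous fun w : ((X × Y → ℝ) × ℝ) × (X × Y → ℝ) => margY w.2 :=
      continuous_margY.comp continuous_snd
    have c2 : Continuous fun w : ((X × Y → ℝ) × ℝ) × (X × Y → ℝ) => margY w.1.1 :=
      continuous_margY.comp (continuous_fst.comp continuous_fst)
    have c3 : Tendsto (fun w : ((X × Y → ℝ) × ℝ) × (X × Y → ℝ) => w.2) (𝓝 ((Q, 0), Q')) (𝓝 Q') :=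
      continuous_snd.tendsto _
    by_cases hY : margY Q' = margY Q
    · by_cases hI : mutualInfo Q' ≤ R
      · have h1 : upperEnvelope P h Q' < (realLogLik W Q : EReal) :=
          lt_of_le_of_lt (le_iSup₂_of_le (f := fun Q' (_ : Q' ∈ {Q' : X × Y → ℝ | Q' ∈ jointWith P ∧
            margY Q' = margY Q ∧ mutualInfo Q' ≤ R}) => upperEnvelope P h Q') Q' ⟨hQ', hY, hI⟩
            le_rfl) hlt
        obtain ⟨a, ha1, ha2⟩ := EReal.lt_iff_exists_real_btwn.1 h1
        rw [EReal.coe_lt_coe_iff] at ha2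
        have h2 : ∀ᶠ Q₃ in 𝓝[jointWith P] Q', h Q₃ < (a : EReal) := eventually_lt_of_limsup_lt ha1
        rw [eventually_nhdsWithin_iff] at h2
        have c4 : Tendsto (fun w : ((X × Y → ℝ) × ℝ) × (X × Y → ℝ) => realLogLik W w.1.1)
            (𝓝 ((Q, 0), Q')) (𝓝 (realLogLik W Q)) :=
          ((continuous_realLogLik W).comp (continuous_fst.comp continuous_fst)).tendsto _
        filter_upwards [c3.eventually h2, c4.eventually_const_lt ha2] with w hw1 hw2 hw _ _
        exact (hw1 hw).le.trans (EReal.coe_le_coe_iff.2 hw2.le)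
      · rw [not_le] at hI
        have hE : Continuous fun w : ((X × Y → ℝ) × ℝ) × (X × Y → ℝ) =>
            entropy (margX w.2) + entropy (margY w.2) - entropy w.2 - (R + w.1.2) := by
          have e1 : Continuous fun w : ((X × Y → ℝ) × ℝ) × (X × Y → ℝ) => entropy (margX w.2) :=
            continuous_entropy.comp (continuous_margX.comp continuous_snd)
          have e2 : Continuous fun w : ((X × Y → ℝ) × ℝ) × (X × Y → ℝ) => entropy (margY w.2) :=
            continuous_entropy.comp c1
          have e3 : Continuous fun w : ((X × Y → ℝ) × ℝ) × (X × Y → ℝ) => entropy w.2 :=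
            continuous_entropy.comp continuous_snd
          fun_prop
        have h0 : 0 < entropy (margX Q') + entropy (margY Q') - entropy Q' - (R + 0) := by
          rw [← mutualInfo_eq_entropy (nonneg_of_mem_jointWith hQ')]; linarith
        filter_upwards [(hE.tendsto ((Q, 0), Q')).eventually_const_lt h0] with w hw hwP _ hwI
        rw [← mutualInfo_eq_entropy (nonneg_of_mem_jointWith hwP)] at hw
        linarith
    · have : ∀ᶠ w in 𝓝 (((Q, 0), Q') : ((X × Y → ℝ) × ℝ) × (X × Y → ℝ)), margY w.2 ≠ margY w.1.1 :=
        (isOpen_ne_fun c1 c2).mem_nhds hY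
      filter_upwards [this] with w hw _ hw'
      exact absurd hw' hw
  rw [nhds_prod_eq, eventually_prod_iff] at key
  obtain ⟨pa, hpa, pb, hpb, hall⟩ := key
  obtain ⟨δ, hδ, hδ0⟩ := ((hpb.filter_mono (nhdsWithin_le_nhds (s := Set.Ioi 0))).and
    self_mem_nhdsWithin).exists
  refine ⟨δ, hδ0, hpa.mono fun Q₁ hQ₁ Q' hQ' hY hI => hall hQ₁ hδ Q' hQ' hQ' hY hI⟩

lemma listExponent_le_listFormulaStrict {W : X → Y → ℝ} (hW : IsChannel W) {P : X → ℝ}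
    (hP : ∃ q : X → ℚ, P = fun x => (q x : ℝ)) {R : ℝ} (hR : 0 < R) (h : (X × Y → ℝ) → EReal) :
    listExponent W P R h ≤ listFormulaStrict W P R h := by
  refine le_iInf₂ fun Qt hQt => le_iInf₂ fun Q hQ => ?_
  obtain ⟨hQP, hY, hlt⟩ := hQ
  by_cases hsupp : IsSupported W Qt
  swap
  · rw [condDiv_of_not_isSupported hsupp, EReal.top_add_coe]
    exact le_top
  have hsuppQ : IsSupported W Q := by
    by_contra hns
    rw [logLik_of_not_isSupported hns] at hlt
    exact not_lt_bot hlt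
  rw [condDiv_of_isSupported (nonneg_of_mem_jointWith hQt) hsupp, ← EReal.coe_add]
  rw [logLik_of_isSupported hsuppQ, max_lt_iff] at hlt
  obtain ⟨hltV, hltE⟩ := hlt
  refine EReal.le_of_forall_lt_iff_le.1 fun v hv => ?_
  rw [EReal.coe_lt_coe_iff] at hv
  obtain ⟨S₁, S₂, hS₁, hS₂, hSY, hz₁, hz₂, hden⟩ := exists_rational_approx hP hQt hQP hY
  have hsupp₁ : ∀ k, IsSupported W (S₁ k) := fun k x y hxy => hz₁ k _ (hsupp x y hxy)
  have hsupp₂ : ∀ k, IsSupported W (S₂ k) := fun k x y hxy => hz₂ k _ (hsuppQ x y hxy)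
  have hv' : ∀ᶠ k in atTop, realCondDiv W (S₁ k) + (mutualInfo (S₂ k) - R) < v := by
    have h1 : Tendsto (fun k => realCondDiv W (S₁ k)) atTop (𝓝 (realCondDiv W Qt)) :=
      ((continuous_realCondDiv W).tendsto Qt).comp (hS₁.mono_right nhdsWithin_le_nhds)
    have h2 : Tendsto (fun k => mutualInfo (S₂ k)) atTop (𝓝 (mutualInfo Q)) :=
      (continuousOn_mutualInfo P Q hQP).tendsto.comp hS₂
    exact (h1.add (h2.sub_const R)).eventually_lt_const hv
  have hle' : ∀ᶠ k in atTop, h (S₁ k) ≤ logLik W (S₂ k) := by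
    obtain ⟨a, ha1, ha2⟩ := EReal.lt_iff_exists_real_btwn.1 hltE
    rw [EReal.coe_lt_coe_iff] at ha2
    have h1 : ∀ᶠ Q₃ in 𝓝[jointWith P] Qt, h Q₃ < (a : EReal) := eventually_lt_of_limsup_lt ha1
    have h2 : Tendsto (fun k => realLogLik W (S₂ k)) atTop (𝓝 (realLogLik W Q)) :=
      ((continuous_realLogLik W).tendsto Q).comp (hS₂.mono_right nhdsWithin_le_nhds)
    filter_upwards [hS₁.eventually h1, h2.eventually_const_lt ha2] with k hk1 hk2
    rw [logLik_of_isSupported (hsupp₂ k)]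
    exact hk1.le.trans (EReal.coe_le_coe_iff.2 hk2.le)
  obtain ⟨δ, hδ, hV⟩ := exists_pos_eventually_forall_le hltV
  obtain ⟨k, hk1, hk2, hk3, ⟨N, hN, hd₁, hd₂⟩, hm₁, hm₂⟩ := (hv'.and (hle'.and
    (((hS₂.mono_right nhdsWithin_le_nhds).eventually hV).and (hden.and
    ((hS₁.eventually self_mem_nhdsWithin).and (hS₂.eventually self_mem_nhdsWithin)))))).exists
  refine le_trans ?_ (EReal.coe_le_coe_iff.2 hk1.le)
  refine liminf_negLogRate_le 4 (slackDegree X Y + slackDegree X Y) ?_ (by norm_num)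
  refine ((frequently_exists_jointEmpDist_eq hm₁ hm₂ hN hd₁ hd₂).and_eventually
    (((eventually_gt_atTop 0).and (eventually_slack_pow_le 4 (slackDegree X Y) hδ)).filter_mono
      (blockLengths_le P))).mono ?_
  rintro n ⟨⟨⟨x₁, y₁, e₁⟩, x₂, y₂, e₂⟩, hn, hn4⟩
  have hx₁ : x₁ ∈ typeClass P n := by
    rw [mem_typeClass, ← margX_jointEmpDist x₁ y₁, e₁, hm₁.2]
  rw [← e₁, ← e₂]
  refine le_ensembleAvg_listSize hW hR hn hx₁ ?_ ?_ (e₁ ▸ hsupp₁ k) (by rw [e₁, e₂]; exact hk2) ?_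
  · rw [mem_typeClass, ← margX_jointEmpDist x₂ y₂, e₂, hm₂.2]
  · rw [← margY_jointEmpDist x₂ y₂, ← margY_jointEmpDist x₁ y₁, e₁, e₂, hSY]
  · intro y hy
    have hb : beatProb P h y (logLik W (jointEmpDist x₂ y₂))
        ≤ slack n ^ slackDegree X Y * Real.exp (-(n * (R + δ))) := by
      refine beatProb_le_of_forall_le hn ⟨x₁, hx₁⟩ fun x hx hlt => ?_
      by_contra! hI
      have h1 := hk3 _ (jointEmpDist_mem_jointWith hn hx y)
        (by rw [margY_jointEmpDist, hy, ← margY_jointEmpDist x₁ y₁, e₁, hSY]) hI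
      rw [e₂, logLik_of_isSupported (hsupp₂ k)] at hlt
      exact absurd hlt (not_lt.2 h1)
    have hs := slack_pos n
    calc (numCodewords R n : ℝ) * beatProb P h y (logLik W (jointEmpDist x₂ y₂))
        ≤ (2 * Real.exp (n * R)) * (slack n ^ slackDegree X Y * Real.exp (-(n * (R + δ)))) := by
          have := beatProb_nonneg P h y (logLik W (jointEmpDist x₂ y₂))
          gcongr
          exact numCodewords_le hR n
      _ = (4 * slack n ^ slackDegree X Y) * (Real.exp (n * R) * Real.exp (-(n * (R + δ)))) / 2 := by
          ring
      _ ≤ Real.exp (n * δ) * (Real.exp (n * R) * Real.exp (-(n * (R + δ)))) / 2 := by gcongr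
      _ = 1 / 2 := by
          rw [← Real.exp_add, ← Real.exp_add]
          rw [show n * δ + (n * R + -(n * (R + δ))) = 0 by ring, Real.exp_zero]

end List

/-! ### Shifts of the threshold -/

section Offsets

/-- Two interlacing decreasing functions agree off the countable set of jumps. -/
lemma countable_ne_of_antitone {F g : ℝ → EReal} (hFg : ∀ t, F t ≤ g t)
    (h : ∀ t t', t < t' → g t' ≤ F t) : {t | g t ≠ F t}.Countable := by
  have hg : Antitone g := by
    intro t t' htt'
    rcases htt'.eq_or_lt with rfl | hlt
    · exact le_rfl
    · exact (h t t' hlt).trans (hFg t)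
  refine hg.countable_not_continuousAt.mono ?_
  intro t ht (hcont : ContinuousAt g t)
  refine ht (le_antisymm ?_ (hFg t))
  refine le_of_tendsto (hcont.tendsto.mono_left (nhdsWithin_le_nhds (s := Set.Ioi t))) ?_
  filter_upwards [self_mem_nhdsWithin] with t' ht'
  exact h t t' ht'

/-- Two interlacing increasing functions agree off the countable set of jumps. -/
lemma countable_ne_of_monotone {F g : ℝ → EReal} (hFg : ∀ t, F t ≤ g t)
    (h : ∀ t t', t' < t → g t' ≤ F t) : {t | g t ≠ F t}.Countable := by
  have hg : Monotone g := by
    intro t' t htt'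
    rcases htt'.eq_or_lt with rfl | hlt
    · exact le_rfl
    · exact (h t t' hlt).trans (hFg t)
  refine hg.countable_not_continuousAt.mono ?_
  intro t ht (hcont : ContinuousAt g t)
  refine ht (le_antisymm ?_ (hFg t))
  refine le_of_tendsto (hcont.tendsto.mono_left (nhdsWithin_le_nhds (s := Set.Iio t))) ?_
  filter_upwards [self_mem_nhdsWithin] with t' ht'
  exact h t t' ht'

lemma add_coe_lt_add_coe {a : EReal} (h1 : a ≠ ⊥) (h2 : a ≠ ⊤) {t t' : ℝ} (h : t < t') :
    a + (t : EReal) < a + (t' : EReal) := by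
  lift a to ℝ using ⟨h2, h1⟩
  rw [← EReal.coe_add, ← EReal.coe_add, EReal.coe_lt_coe_iff]
  linarith

variable {X Y : Type*} [Fintype X] [Fintype Y]

lemma logLik_ne_top (W : X → Y → ℝ) (Q : X × Y → ℝ) : logLik W Q ≠ ⊤ := by
  by_cases h : IsSupported W Q
  · rw [logLik_of_isSupported h]; exact EReal.coe_ne_top _
  · rw [logLik_of_not_isSupported h]; exact bot_ne_top

lemma errFormulaStrict_add_le (W : X → Y → ℝ) (P : X → ℝ) (R : ℝ) {h : (X × Y → ℝ) → EReal}
    (hh : IsThreshold h) {t t' : ℝ} (htt' : t < t') :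
    errFormulaStrict W P R (fun Q => h Q + (t' : EReal)) ≤
      errFormula W P R (fun Q => h Q + (t : EReal)) := by
  refine iInf₂_mono fun Qt _ => iInf_le_iInf_of_subset fun Q hQ => ⟨hQ.1, hQ.2.1, ?_⟩
  by_cases htop : h Q = ⊤
  · simpa only [htop, EReal.top_add_coe] using (logLik_ne_top W Qt).lt_top
  · exact hQ.2.2.trans_lt (add_coe_lt_add_coe (hh.ne_bot hQ.1.1) htop htt')

lemma IsThreshold.continuousOn_of_ne_top {h : (X × Y → ℝ) → EReal} (hh : IsThreshold h)
    (hfin : ∀ Q ∈ stdSimplex ℝ (X × Y), h Q ≠ ⊤) : ContinuousOn h (stdSimplex ℝ (X × Y)) := by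
  obtain ⟨G, -, -, hcont, -, hG'⟩ := hh
  refine hcont.mono fun Q hQ => ?_
  by_contra hQG
  exact hfin Q hQ (hG' Q hQ hQG)

lemma upperEnvelope_eq {P : X → ℝ} {h : (X × Y → ℝ) → EReal} (hh : IsThreshold h)
    (hfin : ∀ Q ∈ stdSimplex ℝ (X × Y), h Q ≠ ⊤) {Q : X × Y → ℝ} (hQ : Q ∈ jointWith P) :
    upperEnvelope P h Q = h Q := by
  have : (𝓝[jointWith P] Q).NeBot := mem_closure_iff_nhdsWithin_neBot.1 (subset_closure hQ)
  exact (((hh.continuousOn_of_ne_top hfin) Q hQ.1).mono fun Q hQ => hQ.1).tendsto.limsup_eq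

lemma listFormulaStrict_add_le (W : X → Y → ℝ) (P : X → ℝ) (R : ℝ) {h : (X × Y → ℝ) → EReal}
    (hh : IsThreshold h) (hfin : ∀ Q ∈ stdSimplex ℝ (X × Y), h Q ≠ ⊤) {t t' : ℝ} (htt' : t' < t) :
    listFormulaStrict W P R (fun Q => h Q + (t' : EReal)) ≤
      listFormula W P R (fun Q => h Q + (t : EReal)) := by
  have henv : ∀ Q ∈ jointWith P, upperEnvelope P (fun Q => h Q + (t' : EReal)) Q
      = h Q + (t' : EReal) := fun Q hQ => upperEnvelope_eq (hh.add_const t')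
    (fun Q hQ => EReal.add_ne_top (hfin Q hQ) (EReal.coe_ne_top t')) hQ
  refine le_iInf₂ fun Qt hQt => le_iInf₂ fun Q hQ => ?_
  refine iInf₂_le_of_le Qt hQt (iInf₂_le Q ⟨hQ.1, hQ.2.1, ?_⟩)
  have hmax := max_le_iff.1 hQ.2.2
  have hlt : h Qt + (t' : EReal) < logLik W Q :=
    (add_coe_lt_add_coe (hh.ne_bot hQt.1) (hfin Qt hQt.1) htt').trans_le hmax.2
  refine max_lt ?_ (by rw [henv Qt hQt]; exact hlt)
  have hbot : logLik W Q ≠ ⊥ := (bot_le.trans_lt hlt).ne'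
  -- the supremum stays below `logLik W Q - (t - t')`
  have hsub : logLik W Q + ((-(t - t') : ℝ) : EReal) < logLik W Q := by
    have := add_coe_lt_add_coe hbot (logLik_ne_top W Q) (show -(t - t') < 0 by linarith)
    simpa using this
  refine lt_of_le_of_lt (iSup₂_le fun Q' hQ' => ?_) hsub
  rw [henv Q' hQ'.1]
  have h1 : h Q' + (t : EReal) ≤ logLik W Q :=
    (le_iSup₂_of_le (f := fun Q' (_ : Q' ∈ {Q' : X × Y → ℝ | Q' ∈ jointWith P ∧
      margY Q' = margY Q ∧ mutualInfo Q' ≤ R}) => h Q' + (t : EReal)) Q' hQ' le_rfl).trans hmax.1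
  have h2 : h Q' + (t' : EReal) = h Q' + (t : EReal) + ((-(t - t') : ℝ) : EReal) := by
    rw [add_assoc, ← EReal.coe_add]
    congr 2
    ring
  rw [h2]
  gcongr

end Offsets

end ErasureList

theorem theorem1 {X Y : Type*} [Fintype X] [Fintype Y] [DecidableEq X] [DecidableEq Y]
    (W : X → Y → ℝ) (hW : ErasureList.IsChannel W)
    (P : X → ℝ) (hP : ∃ k : ℕ, 0 < k ∧ (ErasureList.typeClass P k).Nonempty)
    (R : ℝ) (hR : 0 < R)
    (h : (X × Y → ℝ) → EReal) (hh : ErasureList.IsThreshold h) :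
    -- the error exponent
    (ErasureList.errFormula W P R h ≤ ErasureList.errExponent W P R h ∧
      ErasureList.errExponent W P R h = ErasureList.errFormulaStrict W P R h ∧
      (ErasureList.errFormulaStrict W P R h = ErasureList.errFormula W P R h →
        ErasureList.errExponent W P R h = ErasureList.errFormula W P R h)) ∧
    -- the list size exponent
    (ErasureList.listFormula W P R h ≤ ErasureList.listExponent W P R h ∧
      ErasureList.listExponent W P R h ≤ ErasureList.listFormulaStrict W P R h ∧
      (ErasureList.listFormulaStrict W P R h = ErasureList.listFormula W P R h →
        ErasureList.listExponent W P R h = ErasureList.listFormula W P R h)) ∧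
    -- exactness for all but countably many offsets of the threshold
    {t : ℝ | ErasureList.errExponent W P R (fun Q => h Q + (t : EReal)) ≠
      ErasureList.errFormula W P R (fun Q => h Q + (t : EReal))}.Countable ∧
    ((∀ Q ∈ stdSimplex ℝ (X × Y), h Q ≠ ⊤) →
      {t : ℝ | ErasureList.listExponent W P R (fun Q => h Q + (t : EReal)) ≠
        ErasureList.listFormula W P R (fun Q => h Q + (t : EReal))}.Countable) := by
  have hP' := ErasureList.exists_rat_of_typeClass_nonempty hP
  have herr : ∀ g : (X × Y → ℝ) → EReal, ErasureList.IsThreshold g →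
      ErasureList.errExponent W P R g = ErasureList.errFormulaStrict W P R g := fun g hg =>
    le_antisymm (ErasureList.errExponent_le_errFormulaStrict hW hP' hR hg)
      (ErasureList.errFormulaStrict_le_errExponent hW hR g)
  have hlow := ErasureList.listFormula_le_listExponent hW (P := P) hR hh
  have hupp := ErasureList.listExponent_le_listFormulaStrict hW hP' hR h
  refine ⟨⟨?_, herr h hh, fun heq => (herr h hh).trans heq⟩,
    ⟨hlow, hupp, fun heq => le_antisymm (hupp.trans_eq heq) hlow⟩, ?_, fun hfin => ?_⟩
  · rw [herr h hh]
    exact ErasureList.errFormula_le_errFormulaStrict W P R h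
  · simp only [herr _ (hh.add_const _)]
    exact ErasureList.countable_ne_of_antitone
      (fun t => ErasureList.errFormula_le_errFormulaStrict W P R _)
      fun t t' htt' => ErasureList.errFormulaStrict_add_le W P R hh htt'
  · have hl := fun t : ℝ => ErasureList.listFormula_le_listExponent hW (P := P) hR (hh.add_const t)
    have hu := fun t : ℝ =>
      ErasureList.listExponent_le_listFormulaStrict hW hP' hR (fun Q => h Q + (t : EReal))
    refine (ErasureList.countable_ne_of_monotone (fun t => (hl t).trans (hu t))
      fun t t' htt' => ErasureList.listFormulaStrict_add_le W P R hh hfin htt').mono ?_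
    intro t ht heq
    exact ht (le_antisymm ((hu t).trans_eq heq) (hl t))
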